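/- Let $d\ge 2$, $s\in(0,1)$, $m>0$, $\epsilon>0$, $Q=\mathbb R^d\times\mathbb S^{d-1}$, and let $b,\lambda:\mathbb R^d\to\mathbb R$. Put $\sigma(x)=c_{d-1,s}^{-1}2^{m-2s}b(x)$, where $c_{n,s}=\frac{s4^s\Gamma(n/2+s)}{\pi^{n/2}\Gamma(1-s)}$. Assume that $\sigma$ and $\lambda$ are Lipschitz and that $\sigma_0\le\sigma\le\sigma_0^{-1}$, $\lambda_0\le\lambda\le\lambda_0^{-1}$ for some constants $\sigma_0,\lambda_0>0$. *Radiative transfer.* For $g\in(0,1)$ let $$k_g(x,\theta,\theta')=\frac{\epsilon^{2s}(1+g)^m\,b(x)}{(1+g^2-2g\,\theta\cdot\theta')^{\frac{d-1}2+s}}$$ be the Henyey–Greenstein kernel in the narrow beam scaling. For $h\in L^2(Q)$, a solution of the stationary radiative transfer equation is a function $u\in L^2(Q)$ with $\theta\cdot\nabla_xu\in L^2(Q)$ (in the sense of distributions) such that, a.e. in $Q$, $$\theta\cdot\nabla_xu+\lambda u=\int_{\mathbb S^{d-1}}k_g(x,\theta,\theta')\big(u(x,\theta')-u(x,\theta)\big)d\theta'+h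 .$$ *Fractional Fokker–Planck.* Let $K(\theta',\theta)=c_{d-1,s}2^{s-\frac{d-1}2}(1-\theta\cdot\theta')^{-\frac{d-1}2-s}$ and $$\mathcal B(v,\psi)=\tfrac12\int_{\mathbb S^{d-1}}\int_{\mathbb S^{d-1}}K(\theta',\theta)(v(\theta')-v(\theta))(\psi(\theta')-\psi(\theta))\,d\theta'd\theta .$$ Let $\mathcal H^s_\epsilon$ be the space of $u\in L^2(Q)$ with $$\|u\|_{\mathcal H^s_\epsilon}^2=\|u\|_{L^2(Q)}^2+\epsilon^{2s}\int_{\mathbb R^d}\big(\mathcal B(u(x,\cdot),u(x,\cdot))+\|u(x,\cdot)\|^2_{L^2(\mathbb S^{d-1})}\big)dx<\infty .$$ For $h\in L^2(Q)$, a weak solution of the fractional Fokker–Planck equation is a $u\in\mathcal H^s_\epsilon$ with $\theta\cdot\nabla_xu\in(\mathcal H^s_\epsilon)'$ such that, for all $\varphi\in C_c^\infty(Q)$, $$\int_Q\big(-u\,\theta\cdot\nabla_x\varphi+\lambda u\varphi\big)dxd\theta+\epsilon^{2s}\int_{\mathbb R^d}\sigma(x)\,\mathcal B(u(x,\cdot),\varphi(x,\cdot))\,dx=\int_Qh\varphi\,dxd\theta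 .$$ *Integrable sources.* For either equation and $f\in L^1(Q)$, a measurable function $u$ is called the solution with source $f$ if there are $f_n\in L^1(Q)\cap L^2(Q)$ and solutions $u_n$ with source $f_n$, in the above sense, such that $\|f_n-f\|_{L^1(Q)}\to0$ and $\|u_n-u\|_{L^1(Q)}\to0$. (If $f\in L^1\cap L^2$, the solutions in the above sense are solutions in this sense.) *Distance.* For $\Omega\subset\mathbb R^d$ open and bounded, and $\kappa>0$, $$\mathcal W^1_{\bar\Omega,\kappa}(u,v)=\sup_\psi\int_{\bar\Omega\times\mathbb S^{d-1}}\psi\,(u-v)\,dxd\theta ,$$ the supremum being over $\psi:\bar\Omega\times\mathbb S^{d-1}\to\mathbb R$ with $\|\psi\|_\infty\le1$ and $\mathrm{Lip}(\psi)\le\kappa$ (for the Euclidean distance of $\mathbb R^d\times\mathbb R^d$). **Theorem.** Let $f\in L^1(Q)$, $f\ge0$. For each $g\in(0,1)$ the radiative transfer equation with kernel $k_g$ and source $f$ has a solution $u^g\in L^1(Q)$, the fractional Fokker–Planck equation with source $f$ has a solution $u\in L^1(Q)$, and both are unique up to null sets. Moreover, for every bounded open $\Omega\subset\mathbb R^d$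 there exist a strictly increasing sequence $(g_k)\subset(0,1)$ with $g_k\to1$, and $\kappa_0>0$ depending only on $\|\lambda\|_{C^1}=\|\lambda\|_\infty+\mathrm{Lip}(\lambda)$ and $\|f\|_{L^1}$, such that $$\mathcal W^1_{\bar\Omega,\kappa}(u^{g_k},u)\to0\quad\text{as }k\to\infty,\qquad\text{for all }\kappa\ge\kappa_0 .$$ -/

import Mathlib

open MeasureTheory Filter Topology Set
open scoped NNReal ENNReal ContDiff

noncomputable section

/-- The position space `ℝ^d` with its Euclidean structure. -/
abbrev Pos (d : ℕ) : Type := EuclideanSpace ℝ (Fin d)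

/-- The unit sphere `S^{d-1}` of directions. -/
abbrev Dir (d : ℕ) : Type := Metric.sphere (0 : Pos d) 1

/-- The phase space `Q = ℝ^d × S^{d-1}`. -/
abbrev Phase (d : ℕ) : Type := Pos d × Dir d

/-- The surface measure `dθ` on `S^{d-1}`. -/
abbrev dirMeasure (d : ℕ) : Measure (Dir d) := (volume : Measure (Pos d)).toSphere

/-- The measure `dx dθ` on phase space. -/
abbrev phaseMeasure (d : ℕ) : Measure (Phase d) := (volume : Measure (Pos d)).prod (dirMeasure d)

/-- Test functions. The elements of `C_c^∞(ℝ^d × S^{d-1})` are exactly the restrictions to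
`ℝ^d × S^{d-1}` of smooth compactly supported functions on `ℝ^d × ℝ^d`, because the sphere is a
compact submanifold of `ℝ^d`; a test function is given here by such an extension, and only its
values on `ℝ^d × S^{d-1}` are ever used. -/
def IsTest {d : ℕ} (φ : Pos d × Pos d → ℝ) : Prop :=
  ContDiff ℝ ∞ φ ∧ HasCompactSupport φ

/-- Restriction of a function on `ℝ^d × ℝ^d` to phase space. -/
def onPhase {d : ℕ} (φ : Pos d × Pos d → ℝ) (p : Phase d) : ℝ := φ (p.1, (p.2 : Pos d))

/-- The transport derivative `θ · ∇_x φ (x, θ)` of a smooth function. -/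
def transport {d : ℕ} (φ : Pos d × Pos d → ℝ) (p : Phase d) : ℝ :=
  fderiv ℝ (fun y : Pos d => φ (y, (p.2 : Pos d))) p.1 (p.2 : Pos d)

/-- `w = θ · ∇_x u` in the sense of distributions on `ℝ^d × S^{d-1}`. -/
def IsWeakTransport {d : ℕ} (u w : Phase d → ℝ) : Prop :=
  ∀ φ : Pos d × Pos d → ℝ, IsTest φ →
    ∫ p, u p * transport φ p ∂(phaseMeasure d) = -∫ p, w p * onPhase φ p ∂(phaseMeasure d)

/-! ### The stationary radiative transfer equation -/

/-- The Henyey–Greenstein kernel in the narrow beam scaling,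
`k_g(x, θ, θ') = ε^{2s} (1+g)^m b(x) / (1 + g² - 2 g θ·θ')^{(d-1)/2+s}`. -/
def hgKernel {d : ℕ} (s m ε : ℝ) (b : Pos d → ℝ) (g : ℝ) (x : Pos d) (θ θ' : Dir d) : ℝ :=
  ε ^ (2 * s) * (1 + g) ^ m * b x /
    (1 + g ^ 2 - 2 * g * inner ℝ (θ : Pos d) (θ' : Pos d)) ^ (((d : ℝ) - 1) / 2 + s)

/-- The collision operator `I(u)(x, θ) = ∫ k(x, θ, θ') (u(x, θ') - u(x, θ)) dθ'`. -/
def collision {d : ℕ} (k : Pos d → Dir d → Dir d → ℝ) (u : Phase d → ℝ) (p : Phase d) : ℝ :=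
  ∫ θ', k p.1 p.2 θ' * (u (p.1, θ') - u p) ∂(dirMeasure d)

/-- `u ∈ W²`, that is `u ∈ L²` and `θ · ∇_x u ∈ L²`, and `u` solves the stationary radiative
transfer equation `θ · ∇_x u + lam u = I(u) + f` almost everywhere. -/
def IsRTESolution {d : ℕ} (lam : Pos d → ℝ) (k : Pos d → Dir d → Dir d → ℝ)
    (f u : Phase d → ℝ) : Prop :=
  MemLp u 2 (phaseMeasure d) ∧
  ∃ w : Phase d → ℝ, MemLp w 2 (phaseMeasure d) ∧ IsWeakTransport u w ∧
    ∀ᵐ p ∂(phaseMeasure d), w p + lam p.1 * u p = collision k u p + f p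

/-! ### The fractional Fokker–Planck equation -/

/-- The normalizing constant `c_{n,s} = s 4^s Γ(n/2+s) / (π^{n/2} Γ(1-s))` of the fractional
Laplacian `(-Δ)^s` on `ℝ^n`. -/
def fracLapConst (n s : ℝ) : ℝ :=
  s * 4 ^ s * Real.Gamma (n / 2 + s) / (Real.pi ^ (n / 2) * Real.Gamma (1 - s))

/-- The diffusion coefficient `σ(x) = c_{d-1,s}⁻¹ 2^{m-2s} b(x)`. -/
def diffCoeff {d : ℕ} (s m : ℝ) (b : Pos d → ℝ) (x : Pos d) : ℝ :=
  (fracLapConst ((d : ℝ) - 1) s)⁻¹ * 2 ^ (m - 2 * s) * b x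

/-- The angular kernel
`K(θ', θ) = c_{d-1,s} 2^{s-(d-1)/2} / (1 - θ·θ')^{(d-1)/2+s}`. -/
def angKernel {d : ℕ} (s : ℝ) (θ' θ : Dir d) : ℝ :=
  fracLapConst ((d : ℝ) - 1) s * 2 ^ (s - ((d : ℝ) - 1) / 2) /
    (1 - inner ℝ (θ : Pos d) (θ' : Pos d)) ^ (((d : ℝ) - 1) / 2 + s)

/-- The bilinear form
`B(v, ψ) = 1/2 ∬ K(θ', θ) (v(θ') - v(θ)) (ψ(θ') - ψ(θ)) dθ' dθ`. -/
def angForm {d : ℕ} (s : ℝ) (v ψ : Dir d → ℝ) : ℝ :=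
  1 / 2 * ∫ q : Dir d × Dir d, angKernel s q.1 q.2 * (v q.1 - v q.2) * (ψ q.1 - ψ q.2)
    ∂((dirMeasure d).prod (dirMeasure d))

/-- The quadratic form `B(v, v)`, as an element of `[0, ∞]`. -/
def angEnergy {d : ℕ} (s : ℝ) (v : Dir d → ℝ) : ℝ≥0∞ :=
  1 / 2 * ∫⁻ q : Dir d × Dir d, ENNReal.ofReal (angKernel s q.1 q.2 * (v q.1 - v q.2) ^ 2)
    ∂((dirMeasure d).prod (dirMeasure d))

/-- The square of the norm of `𝓗^s_ε = L²_x(ℝ^d; H^s_B)`, as an element of `[0, ∞]`: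
`‖u‖²_{L²} + ε^{2s} ∫ (B(u(x,·), u(x,·)) + ‖u(x,·)‖²_{L²_θ}) dx`. -/
def hNormSq {d : ℕ} (s ε : ℝ) (u : Phase d → ℝ) : ℝ≥0∞ :=
  (∫⁻ p, ENNReal.ofReal (u p ^ 2) ∂(phaseMeasure d)) +
  ENNReal.ofReal (ε ^ (2 * s)) *
    ∫⁻ x : Pos d, (angEnergy s (fun θ => u (x, θ)) +
      ∫⁻ θ, ENNReal.ofReal (u (x, θ) ^ 2) ∂(dirMeasure d))

/-- Membership in `𝓨^s_ε = {u ∈ 𝓗^s_ε : θ · ∇_x u ∈ (𝓗^s_ε)'}`: the distribution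
`φ ↦ -∫ u (θ · ∇_x φ)` is bounded on test functions for the norm of `𝓗^s_ε`. -/
def InYSpace {d : ℕ} (s ε : ℝ) (u : Phase d → ℝ) : Prop :=
  AEStronglyMeasurable u (phaseMeasure d) ∧ hNormSq s ε u < ⊤ ∧
  ∃ C : ℝ≥0, ∀ φ : Pos d × Pos d → ℝ, IsTest φ →
    ENNReal.ofReal ((∫ p, u p * transport φ p ∂(phaseMeasure d)) ^ 2) ≤
      C * hNormSq s ε (onPhase φ)

/-- `u ∈ 𝓨^s_ε` is a weak solution of the fractional Fokker–Planck equation: for all test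
functions `φ`,
`∫ (-u (θ·∇_x φ) + lam u φ) dx dθ + ε^{2s} ∫ σ(x) B(u(x,·), φ(x,·)) dx = ∫ f φ dx dθ`. -/
def IsFFPSolution {d : ℕ} (s ε : ℝ) (lam σ : Pos d → ℝ) (f u : Phase d → ℝ) : Prop :=
  InYSpace s ε u ∧
  ∀ φ : Pos d × Pos d → ℝ, IsTest φ →
    (∫ p, (-(u p * transport φ p) + lam p.1 * u p * onPhase φ p) ∂(phaseMeasure d)) +
      ε ^ (2 * s) * ∫ x : Pos d, σ x *
        angForm s (fun θ => u (x, θ)) (fun θ => onPhase φ (x, θ))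
    = ∫ p, f p * onPhase φ p ∂(phaseMeasure d)

/-! ### Integrable sources -/

/-- Solutions for sources in `L¹`. Here `Sol h v` says that `v` is a solution, in the `L²` setting,
for the source `h`. Then `u` is a solution for the integrable source `f` if it is the `L¹`-limit of
solutions `u_n` for sources `f_n ∈ L¹ ∩ L²` that converge to `f` in `L¹`. With constant sequences
one sees that for `f ∈ L¹ ∩ L²` every solution in the `L²` setting is one in this sense. -/
def IsL1Solution {d : ℕ} (Sol : (Phase d → ℝ) → (Phase d → ℝ) → Prop)
    (f u : Phase d → ℝ) : Prop :=
  AEStronglyMeasurable u (phaseMeasure d) ∧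
  ∃ fn un : ℕ → Phase d → ℝ,
    (∀ n, Integrable (fn n) (phaseMeasure d) ∧ MemLp (fn n) 2 (phaseMeasure d) ∧
      Sol (fn n) (un n)) ∧
    Tendsto (fun n => eLpNorm (fn n - f) 1 (phaseMeasure d)) atTop (𝓝 0) ∧
    Tendsto (fun n => eLpNorm (un n - u) 1 (phaseMeasure d)) atTop (𝓝 0)

/-! ### Coefficients and the Wasserstein distance -/

/-- `σ` and `lam` are Lipschitz continuous and, for some `σ₀, lam₀ > 0`,
`σ₀ ≤ σ ≤ σ₀⁻¹` and `lam₀ ≤ lam ≤ lam₀⁻¹`. -/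
def CoeffCond {d : ℕ} (σ lam : Pos d → ℝ) : Prop :=
  (∃ L : ℝ≥0, LipschitzWith L σ) ∧ (∃ L : ℝ≥0, LipschitzWith L lam) ∧
  (∃ σ₀ : ℝ, 0 < σ₀ ∧ ∀ x, σ₀ ≤ σ x ∧ σ x ≤ σ₀⁻¹) ∧
  (∃ lam₀ : ℝ, 0 < lam₀ ∧ ∀ x, lam₀ ≤ lam x ∧ lam x ≤ lam₀⁻¹)

/-- The `C¹` norm of a bounded Lipschitz function: its supremum norm plus its best Lipschitz
constant. -/
def c1Norm {d : ℕ} (h : Pos d → ℝ) : ℝ :=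
  (⨆ x, |h x|) + sInf {L : ℝ | 0 ≤ L ∧ ∀ x y, |h x - h y| ≤ L * dist x y}

/-- The class `BL_{1,κ}` on a subset `A` of phase space: `|ψ| ≤ 1` and `Lip(ψ) ≤ κ` on `A`, for the
Euclidean distance that `ℝ^d × S^{d-1}` inherits from `ℝ^d × ℝ^d`. -/
def IsBL {d : ℕ} (A : Set (Phase d)) (κ : ℝ) (ψ : Phase d → ℝ) : Prop :=
  (∀ p ∈ A, |ψ p| ≤ 1) ∧
  ∀ p ∈ A, ∀ q ∈ A, |ψ p - ψ q| ≤ κ * √(dist p.1 q.1 ^ 2 + dist p.2 q.2 ^ 2)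

/-- The distance `W¹_{Ω̄,κ}` between the measures `u dx dθ` and `v dx dθ`: the supremum of
`∫_{Ω̄ × S^{d-1}} ψ (u - v) dx dθ` over `ψ ∈ BL_{1,κ}(Ω̄ × S^{d-1})`. As this class is symmetric
under `ψ ↦ -ψ`, the supremum may be taken in `[0, ∞]`. -/
def wassersteinDist {d : ℕ} (Ω : Set (Pos d)) (κ : ℝ) (u v : Phase d → ℝ) : ℝ≥0∞ :=
  ⨆ (ψ : Phase d → ℝ) (_ : IsBL (closure Ω ×ˢ univ) κ ψ),
    ENNReal.ofReal (∫ p in closure Ω ×ˢ univ, ψ p * (u p - v p) ∂(phaseMeasure d))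

end

/-! ### Pairings and bounds in `L²`. -/

section L2

variable {X : Type*} [MeasurableSpace X] {μ : Measure X}

/-! For `g < 1` the Henyey–Greenstein kernel is bounded and symmetric, so the collision operator is
bounded and self-adjoint on `L²` with negative quadratic form, and transport is skew. Lions' lemma
applied to the formal adjoint on test functions gives `L²` solutions (`exists_isRTESolution`).
Transport also satisfies `∫ (θ·∇u) β(u) = 0` whenever `β` is the derivative of a convex function
with suitable growth (`IsWeakTransport.integral_mul_comp_eq_zero`). The choice `β(a) = a` gives an
energy identity, hence bounds uniform in `g` on `u` and on the jump `u - u'` weighted by `√k_g`; a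
smoothed sign gives `‖u‖₁ ≤ c⁻¹ ‖f‖₁`, where `c` is a positive lower bound of the absorption.

As `g → 1` the kernels converge off the diagonal to `ε^{2s} σ K` and stay below a multiple of `K`.
Weak limits of the `u^g` and of their weighted jumps exist along ultrafilters. The second limit is
identified off the diagonal from the first, after multiplication by a weight that removes the
singularity. For test functions the weighted jumps converge strongly, so the weak formulation passes
to the limit (`IsEnergySolution.of_weak_limit`). This constructs the Fokker–Planck solutions.

Uniqueness (`IsEnergySolution.ae_eq_zero`) is the delicate point, because `θ·∇u` lies only in a dual
space and `u` is not an admissible test function. The equation is mollified in `x` by an even bump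
`r`. The transport term then becomes an honest `L²` pairing, and tested with `u` it vanishes because
`θ·∇r` is odd. Testing with `u` rests on the density statement `pairing_eq_zero_of_test`: a
functional that is `L²` in the function and in its weighted jump, and that vanishes on test
functions, vanishes on the energy space. There one extends a function radially off the sphere,
convolves in `ℝ^d × ℝ^d`, and reads the restriction to phase space as an average of compositions
with near-identity maps of the sphere, which distort both surface measure and angular kernel by
bounded factors.

Uniqueness makes the whole family `u^g` converge weakly in `L²`, and the `L¹` bound passes to the
limit. Both equations are thus Lipschitz from sources to solutions in `L¹`, which yields existence
and uniqueness for integrable sources by completeness, and, after approximating `f` in `L¹ ∩ L²`,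
convergence of `∫_S (u^g - u)` for every `S` of finite measure (`tendsto_setIntegral_sub`). A
compact set has finite nets, so functions with a common Lipschitz bound are approximated, uniformly
over the class, by functions with finitely many level sets. With the `L¹` bound this turns
convergence on sets into convergence of the distance, for every `κ ≥ 0` (`tendsto_wassersteinDist`).
-/

lemma integrable_mul_of_memLp_two {f g : X → ℝ} (hf : MemLp f 2 μ) (hg : MemLp g 2 μ) :
    Integrable (fun x => f x * g x) μ :=
  MemLp.integrable_mul hf hg

lemma integral_lin_comb_three {f g h : X → ℝ} (hf : Integrable f μ) (hg : Integrable g μ)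
    (hh : Integrable h μ) (a b c : ℝ) :
    ∫ x, (a * f x + b * g x + c * h x) ∂μ = a * ∫ x, f x ∂μ + b * ∫ x, g x ∂μ + c * ∫ x, h x ∂μ := by
  have h1 : Integrable (fun x => a * f x + b * g x) μ := (hf.const_mul a).add (hg.const_mul b)
  rw [integral_add h1 (hh.const_mul c), integral_add (hf.const_mul a) (hg.const_mul b),
    integral_const_mul, integral_const_mul, integral_const_mul]

lemma integral_mul_eq_inner {f g : X → ℝ} (hf : MemLp f 2 μ) (hg : MemLp g 2 μ) :
    ∫ x, f x * g x ∂μ = inner ℝ (hf.toLp f) (hg.toLp g) := by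
  rw [L2.inner_def]
  apply integral_congr_ae
  filter_upwards [hf.coeFn_toLp, hg.coeFn_toLp] with x h1 h2
  simp [h1, h2, mul_comm]

lemma abs_integral_mul_le {f g : X → ℝ} (hf : MemLp f 2 μ) (hg : MemLp g 2 μ) :
    |∫ x, f x * g x ∂μ| ≤ (eLpNorm f 2 μ).toReal * (eLpNorm g 2 μ).toReal := by
  rw [integral_mul_eq_inner hf hg]
  have := abs_real_inner_le_norm (hf.toLp f) (hg.toLp g)
  simpa [Lp.norm_toLp] using this

lemma integral_sq_eq {f : X → ℝ} (hf : MemLp f 2 μ) :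
    ∫ x, f x * f x ∂μ = (eLpNorm f 2 μ).toReal ^ 2 := by
  rw [integral_mul_eq_inner hf hf, real_inner_self_eq_norm_sq, Lp.norm_toLp]

lemma eLpNorm_two_sq (f : X → ℝ) :
    eLpNorm f 2 μ ^ 2 = ∫⁻ x, ENNReal.ofReal (f x ^ 2) ∂μ := by
  have h := eLpNorm_nnreal_pow_eq_lintegral (f := f) (μ := μ) (p := 2) (by norm_num)
  have e : ((2 : ℝ≥0) : ℝ≥0∞) = 2 := rfl
  rw [e] at h
  rw [← ENNReal.rpow_natCast]
  refine Eq.trans (by norm_num) (h.trans (lintegral_congr fun x => ?_))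
  rw [← ofReal_norm, ENNReal.ofReal_rpow_of_nonneg (norm_nonneg _) (by norm_num)]
  congr 1
  simp

lemma memLp_two_iff_lintegral {f : X → ℝ} (hf : AEStronglyMeasurable f μ) :
    MemLp f 2 μ ↔ ∫⁻ x, ENNReal.ofReal (f x ^ 2) ∂μ < ⊤ := by
  rw [← eLpNorm_two_sq]
  refine ⟨fun h => ENNReal.pow_lt_top h.2, fun h => ⟨hf, ?_⟩⟩
  by_contra h'
  simp only [not_lt, top_le_iff] at h'
  rw [h'] at h
  simp at h

lemma tendsto_integral_mul_of_tendsto_eLpNorm {ι : Type*} {l : Filter ι} {F : ι → X → ℝ}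
    {f g : X → ℝ} (hF : ∀ᶠ i in l, MemLp (F i) 2 μ) (hf : MemLp f 2 μ) (hg : MemLp g 2 μ)
    (h : Tendsto (fun i => eLpNorm (F i - f) 2 μ) l (𝓝 0)) :
    Tendsto (fun i => ∫ x, F i x * g x ∂μ) l (𝓝 (∫ x, f x * g x ∂μ)) := by
  rw [tendsto_iff_norm_sub_tendsto_zero]
  have h' : Tendsto (fun i => (eLpNorm (F i - f) 2 μ).toReal * (eLpNorm g 2 μ).toReal) l (𝓝 0) := by
    have := ((ENNReal.tendsto_toReal ENNReal.zero_ne_top).comp h).mul_const (eLpNorm g 2 μ).toReal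
    simpa using this
  refine squeeze_zero' (Eventually.of_forall fun _ => norm_nonneg _) ?_ h'
  filter_upwards [hF] with i hi
  rw [Real.norm_eq_abs, ← integral_sub (integrable_mul_of_memLp_two hi hg)
    (integrable_mul_of_memLp_two hf hg)]
  refine le_trans (le_of_eq ?_) (abs_integral_mul_le (hi.sub hf) hg)
  congr 1
  refine integral_congr_ae (Eventually.of_forall fun x => ?_)
  simp [sub_mul]

/-- Split off `∫ F (G - g)`, which is small because `F` is bounded in `L²`. Weak convergence of `F`
is needed only against the single function `g`. -/
lemma tendsto_integral_mul_of_weak_of_strong {ι : Type*} {l : Filter ι} {F G : ι → X → ℝ}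
    {f g : X → ℝ} {C : ℝ≥0} (hF : ∀ᶠ i in l, MemLp (F i) 2 μ)
    (hC : ∀ᶠ i in l, eLpNorm (F i) 2 μ ≤ C) (hG : ∀ᶠ i in l, MemLp (G i) 2 μ) (hg : MemLp g 2 μ)
    (hw : Tendsto (fun i => ∫ x, F i x * g x ∂μ) l (𝓝 (∫ x, f x * g x ∂μ)))
    (hs : Tendsto (fun i => eLpNorm (G i - g) 2 μ) l (𝓝 0)) :
    Tendsto (fun i => ∫ x, F i x * G i x ∂μ) l (𝓝 (∫ x, f x * g x ∂μ)) := by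
  have h' : Tendsto (fun i => C * (eLpNorm (G i - g) 2 μ).toReal) l (𝓝 0) := by
    have := ((ENNReal.tendsto_toReal ENNReal.zero_ne_top).comp hs).const_mul (C : ℝ)
    simpa using this
  have h2 : Tendsto (fun i => ∫ x, F i x * (G i - g) x ∂μ) l (𝓝 0) := by
    refine squeeze_zero_norm' ?_ h'
    filter_upwards [hF, hC, hG] with i h1 h2 h3
    refine (abs_integral_mul_le h1 (h3.sub hg)).trans ?_
    gcongr
    exact ENNReal.toReal_le_coe_of_le_coe h2
  have h3 := h2.add hw
  rw [zero_add] at h3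
  refine h3.congr' ?_
  filter_upwards [hF, hG] with i h1 h2
  rw [← integral_add (integrable_mul_of_memLp_two h1 (h2.sub hg))
    (integrable_mul_of_memLp_two h1 hg)]
  refine integral_congr_ae (Eventually.of_forall fun x => ?_)
  simp only [Pi.sub_apply]
  ring

lemma ae_eq_zero_of_integral_weight_mul_sq {w f : X → ℝ} {c : ℝ} (hc : 0 < c) (hf : MemLp f 2 μ)
    (hw : ∀ x, c ≤ w x) (hi : Integrable (fun x => w x * f x * f x) μ)
    (h : ∫ x, w x * f x * f x ∂μ ≤ 0) :
    f =ᵐ[μ] 0 := by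
  have h1 : ∫ x, c * (f x * f x) ∂μ ≤ ∫ x, w x * f x * f x ∂μ := by
    refine integral_mono ((integrable_mul_of_memLp_two hf hf).const_mul c) hi fun x => ?_
    simp only
    nlinarith [hw x, mul_self_nonneg (f x)]
  rw [integral_const_mul] at h1
  have h2 : ∫ x, f x * f x ∂μ = 0 := by
    refine le_antisymm ?_ (integral_nonneg fun x => mul_self_nonneg _)
    by_contra h3
    push Not at h3
    nlinarith
  rw [integral_eq_zero_iff_of_nonneg (fun x => mul_self_nonneg _)
    (integrable_mul_of_memLp_two hf hf)] at h2
  filter_upwards [h2] with x hx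
  simpa using hx

lemma memLp_two_mul_of_ae_bound {f w : X → ℝ} (hf : MemLp f 2 μ) (hw : AEStronglyMeasurable w μ)
    {M : ℝ} (hM : ∀ᵐ x ∂μ, |w x| ≤ M) : MemLp (fun x => w x * f x) 2 μ := by
  refine MemLp.of_le_mul (c := M) hf (hw.mul hf.1) ?_
  filter_upwards [hM] with x hx
  rw [norm_mul]
  exact mul_le_mul_of_nonneg_right hx (norm_nonneg _)

lemma memLp_two_mul_of_bound {f w : X → ℝ} (hf : MemLp f 2 μ) (hw : AEStronglyMeasurable w μ)
    {M : ℝ} (hM : ∀ x, |w x| ≤ M) : MemLp (fun x => w x * f x) 2 μ :=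
  memLp_two_mul_of_ae_bound hf hw (Eventually.of_forall hM)

lemma eLpNorm_two_mul_le_of_bound {f w : X → ℝ} {M : ℝ} (hM : ∀ x, |w x| ≤ M) :
    eLpNorm (fun x => w x * f x) 2 μ ≤ ENNReal.ofReal M * eLpNorm f 2 μ := by
  refine eLpNorm_le_mul_eLpNorm_of_ae_le_mul (Eventually.of_forall fun x => ?_) 2
  rw [norm_mul]
  exact mul_le_mul_of_nonneg_right (hM x) (norm_nonneg _)

/-- Domination of the image measure replaces preservation of measure, since the perturbations of the
sphere used below preserve its measure only up to a factor. -/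
lemma memLp_comp_of_map_le {Y : Type*} [MeasurableSpace Y] {ν : Measure Y} {T : X → Y}
    (hT : Measurable T) {c : ℝ≥0} (h : μ.map T ≤ c • ν) {f : Y → ℝ} (hf : MemLp f 2 ν) :
    MemLp (fun x => f (T x)) 2 μ ∧
      eLpNorm (fun x => f (T x)) 2 μ ≤ (c : ℝ≥0∞) ^ (1 / (2 : ℝ)) * eLpNorm f 2 ν := by
  have h' : μ.map T ≤ (c : ℝ≥0∞) • ν := h
  have h1 : MemLp f 2 (μ.map T) := hf.of_measure_le_smul ENNReal.coe_ne_top h'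
  have e : eLpNorm f 2 (μ.map T) = eLpNorm (fun x => f (T x)) 2 μ :=
    eLpNorm_map_measure h1.1 hT.aemeasurable
  refine ⟨(memLp_map_measure_iff h1.1 hT.aemeasurable).1 h1, ?_⟩
  rw [← e]
  have := eLpNorm_le_of_measure_le_smul (p := 2) (f := f) h'
  simpa using this

lemma quasiMeasurePreserving_of_map_le {Y : Type*} [MeasurableSpace Y] {ν : Measure Y} {T : X → Y}
    (hT : Measurable T) {c : ℝ≥0} (h : μ.map T ≤ c • ν) :
    Measure.QuasiMeasurePreserving T μ ν :=
  ⟨hT, (Measure.absolutelyContinuous_of_le h).trans (Measure.smul_absolutelyContinuous (c := c))⟩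

/-- Cauchy–Schwarz against the constant `1` on each fibre, whose measure is finite. -/
lemma memLp_two_integral_right {Z : Type*} [MeasurableSpace Z] {ν : Measure Z} [SFinite μ]
    [IsFiniteMeasure ν] {F : X × Z → ℝ} (hF : MemLp F 2 (μ.prod ν)) :
    MemLp (fun x => ∫ z, F (x, z) ∂ν) 2 μ := by
  have hm : AEStronglyMeasurable (fun x => ∫ z, F (x, z) ∂ν) μ := hF.1.integral_prod_right'
  rw [memLp_two_iff_lintegral hm]
  have h1 := (memLp_two_iff_lintegral hF.1).1 hF
  rw [lintegral_prod _ (by have := hF.1.aemeasurable; fun_prop)] at h1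
  have hsq : Integrable (fun p => F p * F p) (μ.prod ν) := integrable_mul_of_memLp_two hF hF
  have key : ∀ᵐ x ∂μ, ENNReal.ofReal ((∫ z, F (x, z) ∂ν) ^ 2) ≤
      ν univ * ∫⁻ z, ENNReal.ofReal (F (x, z) ^ 2) ∂ν := by
    filter_upwards [hsq.prod_right_ae, hF.1.prodMk_left] with x hx hmx
    have hx2 : MemLp (fun z => F (x, z)) 2 ν := by
      rw [memLp_two_iff_integrable_sq hmx]
      simpa [sq] using hx
    have h3 := abs_integral_mul_le hx2 (memLp_const (1 : ℝ))
    simp only [mul_one] at h3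
    have h4 : (∫ z, F (x, z) ∂ν) ^ 2 ≤
        (eLpNorm (fun z => F (x, z)) 2 ν).toReal ^ 2 * (eLpNorm (fun _ : Z => (1 : ℝ)) 2 ν).toReal ^ 2 := by
      rw [← mul_pow, ← sq_abs]
      exact pow_le_pow_left₀ (abs_nonneg _) h3 2
    rw [← ENNReal.toReal_pow, ← ENNReal.toReal_pow, eLpNorm_two_sq, eLpNorm_two_sq,
      ← ENNReal.toReal_mul] at h4
    simp only [one_pow, ENNReal.ofReal_one, lintegral_const, one_mul] at h4
    refine (ENNReal.ofReal_le_ofReal h4).trans ?_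
    rw [mul_comm (ν univ)]
    exact ENNReal.ofReal_toReal_le
  refine (lintegral_mono_ae key).trans_lt ?_
  rw [lintegral_const_mul' _ _ (measure_ne_top _ _)]
  exact ENNReal.mul_lt_top (measure_lt_top _ _) h1

end L2

/-! ### Weak compactness and Lions' lemma. -/

section Compactness

variable {X : Type*} [MeasurableSpace X] {μ : Measure X}

/-- Along an ultrafilter every bounded family of reals converges. The limits of the pairings form a
bounded functional on `L²`, which Riesz represents. No subsequence is extracted, so separability
plays no role. -/
lemma exists_weak_limit {ι : Type*} (𝒰 : Ultrafilter ι) {F : ι → X → ℝ} {C : ℝ≥0}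
    (hF : ∀ᶠ i in 𝒰, MemLp (F i) 2 μ ∧ eLpNorm (F i) 2 μ ≤ C) :
    ∃ f : X → ℝ, MemLp f 2 μ ∧ ∀ g, MemLp g 2 μ →
      Tendsto (fun i => ∫ x, F i x * g x ∂μ) 𝒰 (𝓝 (∫ x, f x * g x ∂μ)) := by
  classical
  let H := Lp ℝ 2 μ
  have hb : ∀ g : H, ∀ᶠ i in (𝒰 : Filter ι), |∫ x, F i x * g x ∂μ| ≤ C * ‖g‖ := by
    intro g
    filter_upwards [hF] with i hi
    refine (abs_integral_mul_le hi.1 (Lp.memLp g)).trans ?_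
    rw [Lp.norm_def]
    gcongr
    exact ENNReal.toReal_le_coe_of_le_coe hi.2
  have hlim : ∀ g : H, ∃ a : ℝ, Tendsto (fun i => ∫ x, F i x * g x ∂μ) 𝒰 (𝓝 a) := by
    intro g
    have hc : IsCompact (Icc (-(C * ‖g‖)) (C * ‖g‖)) := isCompact_Icc
    obtain ⟨a, -, ha⟩ := hc.ultrafilter_le_nhds (𝒰.map fun i => ∫ x, F i x * g x ∂μ) (by
      rw [le_principal_iff, Ultrafilter.coe_map, mem_map]
      filter_upwards [hb g] with i hi
      exact abs_le.1 hi)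
    exact ⟨a, ha⟩
  choose ℓ hℓ using hlim
  let L : H →ₗ[ℝ] ℝ :=
    { toFun := ℓ
      map_add' := fun g h => by
        refine tendsto_nhds_unique (hℓ (g + h)) (((hℓ g).add (hℓ h)).congr' ?_)
        filter_upwards [hF] with i hi
        rw [← integral_add (integrable_mul_of_memLp_two hi.1 (Lp.memLp g))
          (integrable_mul_of_memLp_two hi.1 (Lp.memLp h))]
        refine integral_congr_ae ?_
        filter_upwards [Lp.coeFn_add g h] with x hx
        rw [hx, Pi.add_apply, mul_add]
      map_smul' := fun c g => by
        refine tendsto_nhds_unique (hℓ (c • g)) (((hℓ g).const_mul c).congr fun i => ?_)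
        rw [← integral_const_mul]
        refine integral_congr_ae ?_
        filter_upwards [Lp.coeFn_smul c g] with x hx
        rw [hx, Pi.smul_apply, smul_eq_mul]
        ring }
  let L' : H →L[ℝ] ℝ := L.mkContinuous C fun g => by
    refine le_of_tendsto (hℓ g).norm ?_
    filter_upwards [hb g] with i hi
    exact hi
  let w : H := (InnerProductSpace.toDual ℝ H).symm L'
  refine ⟨w, Lp.memLp w, fun g hg => ?_⟩
  have e1 : ∫ x, w x * g x ∂μ = ℓ (hg.toLp g) := by
    rw [integral_mul_eq_inner (Lp.memLp w) hg, Lp.toLp_coeFn]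
    exact InnerProductSpace.toDual_symm_apply
  rw [e1]
  refine (hℓ (hg.toLp g)).congr fun i => integral_congr_ae ?_
  filter_upwards [hg.coeFn_toLp] with x hx
  rw [hx]

/-- A variant of the Lax–Milgram theorem due to Lions. -/
lemma exists_of_coercive_on_tests {H V : Type*} [NormedAddCommGroup H] [InnerProductSpace ℝ H]
    [CompleteSpace H] [AddCommGroup V] [Module ℝ V] (S J : V →ₗ[ℝ] H) {c : ℝ} (hc : 0 < c)
    (h : ∀ v, c * ‖J v‖ ^ 2 ≤ inner ℝ (S v) (J v)) (f : H) :
    ∃ u : H, ∀ v, inner ℝ u (S v) = inner ℝ f (J v) := by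
  have hb : ∀ v, ‖J v‖ ≤ c⁻¹ * ‖S v‖ := by
    intro v
    have h1 := (h v).trans (real_inner_le_norm (S v) (J v))
    rcases (norm_nonneg (J v)).eq_or_lt with h0 | h0
    · rw [← h0]; positivity
    · rw [inv_mul_eq_div, le_div_iff₀ hc]
      nlinarith
  have hker : LinearMap.ker S ≤ LinearMap.ker ((innerₛₗ ℝ f).comp J) := by
    intro v hv
    have := hb v
    rw [LinearMap.mem_ker.1 hv, norm_zero, mul_zero, norm_le_zero_iff] at this
    simp [this]
  -- By `hb` the value `inner f (J v)` depends only on `S v` and is bounded by `‖f‖ c⁻¹ ‖S v‖`.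
  -- Hahn–Banach extends this functional from the range of `S`, and Riesz then produces `u`.
  let ℓ : LinearMap.range S →ₗ[ℝ] ℝ :=
    ((LinearMap.ker S).liftQ ((innerₛₗ ℝ f).comp J) hker).comp
      (S.quotKerEquivRange.symm : LinearMap.range S →ₗ[ℝ] _)
  have hℓ : ∀ v, ℓ ⟨S v, v, rfl⟩ = inner ℝ f (J v) := by
    intro v
    have : S.quotKerEquivRange.symm ⟨S v, v, rfl⟩ = (LinearMap.ker S).mkQ v := by
      rw [LinearEquiv.symm_apply_eq]
      exact Subtype.ext (by simp)
    simp [ℓ, this]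
  let ℓ' : LinearMap.range S →L[ℝ] ℝ := ℓ.mkContinuous (‖f‖ * c⁻¹) (by
    rintro ⟨_, v, rfl⟩
    rw [hℓ]
    refine (abs_real_inner_le_norm f (J v)).trans ?_
    rw [mul_assoc]
    gcongr
    exact hb v)
  obtain ⟨g, hg, -⟩ := exists_extension_norm_eq (LinearMap.range S) ℓ'
  refine ⟨(InnerProductSpace.toDual ℝ H).symm g, fun v => ?_⟩
  rw [InnerProductSpace.toDual_symm_apply, ← hℓ v]
  exact hg ⟨S v, v, rfl⟩

end Compactness

/-! ### Strong continuity of composition with near-identity maps. -/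

section Composition

variable {X : Type*} [MetricSpace X] [ProperSpace X] [MeasurableSpace X] [BorelSpace X]
  {μ : Measure X} [μ.Regular]

/-- Composition with maps that converge uniformly to the identity and do not concentrate mass is
strongly continuous on `L²`. -/
lemma tendsto_eLpNorm_comp_sub {ι : Type*} {l : Filter ι} {T : ι → X → X} {c : ℝ≥0}
    (hT : ∀ᶠ i in l, Measurable (T i) ∧ μ.map (T i) ≤ c • μ) {δ : ι → ℝ}
    (hδ : Tendsto δ l (𝓝 0)) (hd : ∀ᶠ i in l, ∀ x, dist (T i x) x ≤ δ i) {f : X → ℝ}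
    (hf : MemLp f 2 μ) :
    Tendsto (fun i => eLpNorm (fun x => f (T i x) - f x) 2 μ) l (𝓝 0) := by
  rw [ENNReal.tendsto_nhds_zero]
  intro ε hε
  set K : ℝ≥0∞ := (c : ℝ≥0∞) ^ (1 / (2 : ℝ)) with hK
  have hKtop : K ≠ ⊤ := ENNReal.rpow_ne_top_of_nonneg (by norm_num) ENNReal.coe_ne_top
  -- The three summands bound `(f - g) ∘ T`, `g ∘ T - g` and `g - f`, where `g` is a continuous
  -- approximation of `f`; `K` is the norm bound for composition.
  obtain ⟨η, hη0, hη⟩ : ∃ η : ℝ≥0∞, η ≠ 0 ∧ K * η + η + η ≤ ε := by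
    have ht : Tendsto (fun η : ℝ≥0∞ => K * η + η + η) (𝓝[>] 0) (𝓝 (K * 0 + 0 + 0)) := by
      have h0 : Tendsto (fun η : ℝ≥0∞ => η) (𝓝[>] 0) (𝓝 0) := nhdsWithin_le_nhds
      exact ((ENNReal.Tendsto.const_mul h0 (Or.inr hKtop)).add h0).add h0
    simp only [mul_zero, add_zero] at ht
    have := (ht.eventually (Iio_mem_nhds hε)).and self_mem_nhdsWithin
    obtain ⟨η, h1, h2⟩ := this.exists
    exact ⟨η, (ne_of_gt h2), le_of_lt h1⟩
  obtain ⟨g, hgc, hfg, hgcont, hg⟩ :=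
    hf.exists_hasCompactSupport_eLpNorm_sub_le (by norm_num) hη0
  have huc : UniformContinuous g := hgc.uniformContinuous_of_continuous hgcont
  -- Once the displacement is below `1`, this compact set carries both `g` and `g ∘ T`, so uniform
  -- smallness of `g ∘ T - g` gives smallness in `L²`.
  set A : Set X := Metric.cthickening 1 (tsupport g) with hA
  have hAc : IsCompact A := hgc.isCompact.cthickening
  have hAfin : μ A < ⊤ := hAc.measure_lt_top
  obtain ⟨a, ha0, ha⟩ : ∃ a : ℝ, 0 < a ∧ ENNReal.ofReal a * μ A ^ (1 / (2 : ℝ)) ≤ η := by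
    have ht : Tendsto (fun a : ℝ => ENNReal.ofReal a * μ A ^ (1 / (2 : ℝ))) (𝓝[>] 0)
        (𝓝 (ENNReal.ofReal 0 * μ A ^ (1 / (2 : ℝ)))) := by
      have h0 : Tendsto (fun a : ℝ => ENNReal.ofReal a) (𝓝[>] 0) (𝓝 (ENNReal.ofReal 0)) :=
        (ENNReal.continuous_ofReal.tendsto 0).mono_left nhdsWithin_le_nhds
      exact ENNReal.Tendsto.mul_const h0
        (Or.inr (ENNReal.rpow_ne_top_of_nonneg (by norm_num) hAfin.ne))
    simp only [ENNReal.ofReal_zero, zero_mul] at ht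
    have := (ht.eventually (Iio_mem_nhds (pos_iff_ne_zero.2 hη0))).and self_mem_nhdsWithin
    obtain ⟨a, h1, h2⟩ := this.exists
    exact ⟨a, h2, le_of_lt h1⟩
  obtain ⟨r, hr0, hr⟩ := Metric.uniformContinuous_iff.1 huc a ha0
  filter_upwards [hT, hd, hδ.eventually (Iio_mem_nhds (lt_min hr0 one_pos))] with i hi hdi hδi
  have hδr : δ i < r := lt_of_lt_of_le hδi (min_le_left _ _)
  have hδ1 : δ i < 1 := lt_of_lt_of_le hδi (min_le_right _ _)
  have hfg' : MemLp (f - g) 2 μ := hf.sub hg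
  have h1 := memLp_comp_of_map_le hi.1 hi.2 hfg'
  have h2 := memLp_comp_of_map_le hi.1 hi.2 hg
  have h3 : eLpNorm (fun x => g (T i x) - g x) 2 μ ≤ η := by
    refine le_trans ?_ ha
    have := eLpNorm_sub_le_of_dist_bdd μ (p := 2) (by norm_num) hAc.measurableSet ha0.le
      (f := fun x => g (T i x)) (g := g) (fun x => (hr (lt_of_le_of_lt (hdi x) hδr)).le) ?_ ?_
    · rw [one_div] at this ⊢; simpa [Pi.sub_def] using this
    · intro x hx
      have hx' : T i x ∈ tsupport g := subset_tsupport g hx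
      exact Metric.mem_cthickening_of_dist_le x (T i x) 1 _ hx'
        (by rw [dist_comm]; exact (hdi x).trans hδ1.le)
    · exact (subset_tsupport g).trans (Metric.self_subset_cthickening _)
  have e : (fun x => f (T i x) - f x) =
      (fun x => (f - g) (T i x)) + (fun x => g (T i x) - g x) + (g - f) := by
    funext x; simp
  rw [e]
  refine le_trans ?_ hη
  refine (eLpNorm_add_le (h1.1.1.add (h2.1.1.sub hg.1)) (hg.sub hf).1 (by norm_num)).trans ?_
  refine add_le_add ((eLpNorm_add_le h1.1.1 (h2.1.1.sub hg.1) (by norm_num)).trans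
    (add_le_add (h1.2.trans ?_) h3)) ?_
  · gcongr
  · rw [eLpNorm_sub_comm]; exact hfg

end Composition

/-- If `P 0 ≠ 0`, continuity keeps `P` within `|P 0| / 2` of `P 0` near `0`, and a concentrated bump
average cannot vanish. It passes from mollified identities to the unmollified one, both for the
density of test functions and for uniqueness. -/
lemma eq_zero_of_bump_averages {E : Type*} [NormedAddCommGroup E] [NormedSpace ℝ E]
    [FiniteDimensional ℝ E] [MeasurableSpace E] [BorelSpace E] {μ : Measure E}
    [μ.IsAddHaarMeasure] {P : E → ℝ} (hP : ContinuousAt P 0) {R : ℝ} (hR : 0 < R)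
    (h : ∀ φ : ContDiffBump (0 : E), φ.rOut < R →
      Integrable (fun z => φ.normed μ z * P z) μ ∧ ∫ z, φ.normed μ z * P z ∂μ = 0) : P 0 = 0 := by
  by_contra hne
  obtain ⟨r, hr0, hr⟩ := Metric.continuousAt_iff.1 hP (|P 0| / 2) (by positivity)
  set ρ := min r R / 2
  have hρ : 0 < ρ := by positivity
  let φ : ContDiffBump (0 : E) := ⟨ρ / 2, ρ, by positivity, by linarith⟩
  have hφr : φ.rOut < r := by
    have := min_le_left r R
    change min r R / 2 < r; linarith
  have hφR : φ.rOut < R := by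
    have := min_le_right r R
    change min r R / 2 < R; linarith
  obtain ⟨hi, h0⟩ := h φ hφR
  have e : P 0 = ∫ z, φ.normed μ z * (P 0 - P z) ∂μ := by
    simp_rw [mul_sub]
    rw [integral_sub ((φ.integrable_normed (μ := μ)).mul_const _) hi, h0, integral_mul_const,
      φ.integral_normed, one_mul, sub_zero]
  have hint : Integrable (fun z => φ.normed μ z * (|P 0| / 2)) μ :=
    φ.integrable_normed.mul_const _
  have hb : |∫ z, φ.normed μ z * (P 0 - P z) ∂μ| ≤ ∫ z, φ.normed μ z * (|P 0| / 2) ∂μ := by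
    refine (Real.norm_eq_abs _).symm.le.trans
      (norm_integral_le_of_norm_le hint (Eventually.of_forall fun z => ?_))
    rw [norm_mul, Real.norm_of_nonneg (φ.nonneg_normed (μ := μ) z)]
    by_cases hz : z ∈ Metric.ball (0 : E) φ.rOut
    · refine mul_le_mul_of_nonneg_left ?_ (φ.nonneg_normed (μ := μ) z)
      rw [← dist_eq_norm, dist_comm]
      exact (hr (lt_trans hz hφr)).le
    · have : φ.normed μ z = 0 := by
        rw [← Function.notMem_support, φ.support_normed_eq]; exact hz
      simp [this]
  rw [← e, integral_mul_const, φ.integral_normed, one_mul] at hb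
  have := abs_pos.2 hne
  linarith

/-! ### The space of a position and two directions. -/

section PairSpace

instance (d : ℕ) : SFinite (phaseMeasure d) :=
  @Measure.prod.instSFinite _ _ _ _ _ inferInstance _ inferInstance

instance (d : ℕ) : SigmaFinite (phaseMeasure d) :=
  @Measure.prod.instSigmaFinite _ _ _ _ _ inferInstance _ inferInstance

instance (d : ℕ) : (phaseMeasure d).Regular :=
  @Measure.Regular.of_sigmaCompactSpace_of_isLocallyFiniteMeasure _ _ _ _ _ _ _ inferInstance


variable {d : ℕ}

/-- The product measure `dx dθ dθ'`. -/
noncomputable abbrev pairMeasure (d : ℕ) : Measure (Pos d × (Dir d × Dir d)) :=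
  (volume : Measure (Pos d)).prod ((dirMeasure d).prod (dirMeasure d))

instance (d : ℕ) : SFinite (pairMeasure d) :=
  @Measure.prod.instSFinite _ _ _ _ _ inferInstance _ inferInstance

instance (d : ℕ) : (pairMeasure d).Regular :=
  @Measure.Regular.of_sigmaCompactSpace_of_isLocallyFiniteMeasure _ _ _ _ _ _ _ inferInstance

/-- The angular difference `u(x, θ) - u(x, θ')`. -/
def jump (u : Phase d → ℝ) (q : Pos d × (Dir d × Dir d)) : ℝ :=
  u (q.1, q.2.1) - u (q.1, q.2.2)

/-- Forgetting one direction multiplies the measure by the area of the sphere. -/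
lemma map_pair_fst_le : (pairMeasure d).map (fun q => ((q.1, q.2.1) : Phase d)) ≤
    (dirMeasure d univ).toNNReal • phaseMeasure d := by
  have h : (fun q : Pos d × (Dir d × Dir d) => ((q.1, q.2.1) : Phase d)) =
      Prod.map id Prod.fst := rfl
  rw [h, ← Measure.map_prod_map _ _ measurable_id measurable_fst, Measure.map_id,
    Measure.map_fst_prod, Measure.prod_smul_right]
  refine le_of_eq ?_
  conv_lhs => rw [← ENNReal.coe_toNNReal (measure_ne_top (dirMeasure d) univ)]
  rfl

lemma map_pair_snd_le : (pairMeasure d).map (fun q => ((q.1, q.2.2) : Phase d)) ≤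
    (dirMeasure d univ).toNNReal • phaseMeasure d := by
  have h : (fun q : Pos d × (Dir d × Dir d) => ((q.1, q.2.2) : Phase d)) =
      Prod.map id Prod.snd := rfl
  rw [h, ← Measure.map_prod_map _ _ measurable_id measurable_snd, Measure.map_id,
    Measure.map_snd_prod, Measure.prod_smul_right]
  refine le_of_eq ?_
  conv_lhs => rw [← ENNReal.coe_toNNReal (measure_ne_top (dirMeasure d) univ)]
  rfl

lemma quasi_pair_fst : Measure.QuasiMeasurePreserving
    (fun q : Pos d × (Dir d × Dir d) => ((q.1, q.2.1) : Phase d)) (pairMeasure d)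
    (phaseMeasure d) :=
  quasiMeasurePreserving_of_map_le (by fun_prop) map_pair_fst_le

lemma quasi_pair_snd : Measure.QuasiMeasurePreserving
    (fun q : Pos d × (Dir d × Dir d) => ((q.1, q.2.2) : Phase d)) (pairMeasure d)
    (phaseMeasure d) :=
  quasiMeasurePreserving_of_map_le (by fun_prop) map_pair_snd_le

lemma memLp_pair_fst {u : Phase d → ℝ} (hu : MemLp u 2 (phaseMeasure d)) :
    MemLp (fun q : Pos d × (Dir d × Dir d) => u (q.1, q.2.1)) 2 (pairMeasure d) :=
  (memLp_comp_of_map_le (by fun_prop) map_pair_fst_le hu).1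

lemma memLp_pair_snd {u : Phase d → ℝ} (hu : MemLp u 2 (phaseMeasure d)) :
    MemLp (fun q : Pos d × (Dir d × Dir d) => u (q.1, q.2.2)) 2 (pairMeasure d) :=
  (memLp_comp_of_map_le (by fun_prop) map_pair_snd_le hu).1

lemma memLp_jump {u : Phase d → ℝ} (hu : MemLp u 2 (phaseMeasure d)) :
    MemLp (jump u) 2 (pairMeasure d) :=
  (memLp_pair_fst hu).sub (memLp_pair_snd hu)

lemma aestronglyMeasurable_jump {u : Phase d → ℝ}
    (hu : AEStronglyMeasurable u (phaseMeasure d)) :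
    AEStronglyMeasurable (jump u) (pairMeasure d) :=
  (hu.comp_quasiMeasurePreserving quasi_pair_fst).sub
    (hu.comp_quasiMeasurePreserving quasi_pair_snd)

lemma measurePreserving_pair_swap : MeasurePreserving
    (fun q : Pos d × (Dir d × Dir d) => (q.1, q.2.swap)) (pairMeasure d) (pairMeasure d) :=
  (MeasurePreserving.id _).prod Measure.measurePreserving_swap

lemma integral_pair_swap (F : Pos d × (Dir d × Dir d) → ℝ) :
    ∫ q, F (q.1, q.2.swap) ∂(pairMeasure d) = ∫ q, F q ∂(pairMeasure d) :=
  measurePreserving_pair_swap.integral_comp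
    ((MeasurableEquiv.refl _).prodCongr MeasurableEquiv.prodComm).measurableEmbedding F

lemma measurePreserving_pair_assoc : MeasurePreserving
    (MeasurableEquiv.prodAssoc : (Pos d × Dir d) × Dir d ≃ᵐ Pos d × (Dir d × Dir d))
    ((phaseMeasure d).prod (dirMeasure d)) (pairMeasure d) :=
  measurePreserving_prodAssoc _ _ _

lemma integral_pairMeasure {F : Pos d × (Dir d × Dir d) → ℝ} (hF : Integrable F (pairMeasure d)) :
    ∫ q, F q ∂(pairMeasure d) = ∫ p, ∫ b, F (p.1, (p.2, b)) ∂(dirMeasure d) ∂(phaseMeasure d) := by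
  rw [← measurePreserving_pair_assoc.integral_comp' F]
  exact integral_prod _ ((measurePreserving_pair_assoc.integrable_comp_emb
    MeasurableEquiv.prodAssoc.measurableEmbedding).2 hF)

lemma memLp_integral_pair {F : Pos d × (Dir d × Dir d) → ℝ} (hF : MemLp F 2 (pairMeasure d)) :
    MemLp (fun p : Phase d => ∫ b, F (p.1, (p.2, b)) ∂(dirMeasure d)) 2 (phaseMeasure d) :=
  memLp_two_integral_right (hF.comp_measurePreserving measurePreserving_pair_assoc)

end PairSpace

/-! ### Test functions and their transport derivative. -/

section TestFunctions

variable {d : ℕ}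

/-- The extension `(x, y) ↦ y · ∇_x φ(x, y)` of the transport derivative. -/
noncomputable def transportExt (φ : Pos d × Pos d → ℝ) (z : Pos d × Pos d) : ℝ :=
  fderiv ℝ φ z (z.2, 0)

lemma hasFDerivAt_slice {φ : Pos d × Pos d → ℝ} (hφ : IsTest φ) (x y : Pos d) :
    HasFDerivAt (fun x' : Pos d => φ (x', y))
      ((fderiv ℝ φ (x, y)).comp (ContinuousLinearMap.inl ℝ (Pos d) (Pos d))) x := by
  have h1 : HasFDerivAt φ (fderiv ℝ φ (x, y)) (x, y) :=
    (hφ.1.differentiable (by simp)).differentiableAt.hasFDerivAt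
  exact h1.comp x (hasFDerivAt_prodMk_left x y)

lemma transport_eq {φ : Pos d × Pos d → ℝ} (hφ : IsTest φ) (p : Phase d) :
    transport φ p = onPhase (transportExt φ) p := by
  rw [transport, (hasFDerivAt_slice hφ p.1 p.2).fderiv]
  simp [onPhase, transportExt]

lemma IsTest.transportExt {φ : Pos d × Pos d → ℝ} (hφ : IsTest φ) :
    IsTest (transportExt φ) := by
  refine ⟨?_, ?_⟩
  · have h1 : ContDiff ℝ ∞ (fderiv ℝ φ) := hφ.1.fderiv_right (by simp)
    exact h1.clm_apply (contDiff_snd.prodMk contDiff_const)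
  · refine (hφ.2.fderiv ℝ).mono fun z hz => ?_
    intro h0
    apply hz
    simp [_root_.transportExt, h0]

lemma IsTest.continuous_onPhase {φ : Pos d × Pos d → ℝ} (hφ : IsTest φ) :
    Continuous (onPhase φ) := by
  have := hφ.1.continuous
  unfold onPhase
  fun_prop

lemma isClosedEmbedding_phase :
    IsClosedEmbedding (fun p : Phase d => ((p.1, (p.2 : Pos d)) : Pos d × Pos d)) :=
  IsClosedEmbedding.id.prodMap (Metric.isClosed_sphere.isClosedEmbedding_subtypeVal)

lemma IsTest.hasCompactSupport_onPhase {φ : Pos d × Pos d → ℝ} (hφ : IsTest φ) :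
    HasCompactSupport (onPhase φ) :=
  hφ.2.comp_isClosedEmbedding isClosedEmbedding_phase

lemma IsTest.memLp {φ : Pos d × Pos d → ℝ} (hφ : IsTest φ) (p : ℝ≥0∞) :
    MemLp (onPhase φ) p (phaseMeasure d) :=
  hφ.continuous_onPhase.memLp_of_hasCompactSupport hφ.hasCompactSupport_onPhase

lemma IsTest.memLp_transport {φ : Pos d × Pos d → ℝ} (hφ : IsTest φ) (p : ℝ≥0∞) :
    MemLp (transport φ) p (phaseMeasure d) := by
  rw [show transport φ = onPhase (_root_.transportExt φ) from funext (transport_eq hφ)]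
  exact hφ.transportExt.memLp p

lemma IsTest.exists_bound {φ : Pos d × Pos d → ℝ} (hφ : IsTest φ) :
    ∃ M R : ℝ, 0 ≤ M ∧ 0 ≤ R ∧ (∀ z, |φ z| ≤ M) ∧ ∀ z, R < ‖z.1‖ → φ z = 0 := by
  obtain ⟨M, hM⟩ := hφ.1.continuous.bounded_above_of_compact_support hφ.2
  obtain ⟨R, hR⟩ := hφ.2.isCompact.isBounded.exists_norm_le
  refine ⟨M, max R 0, (norm_nonneg _).trans (hM 0), le_max_right _ _, hM, fun z hz => ?_⟩
  by_contra hne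
  have h1 := hR z (subset_tsupport φ hne)
  have h2 := norm_fst_le z
  have := le_max_left R 0
  linarith

lemma IsTest.exists_lipschitz {φ : Pos d × Pos d → ℝ} (hφ : IsTest φ) :
    ∃ L : ℝ≥0, LipschitzWith L φ := by
  obtain ⟨L, hL⟩ := (hφ.1.of_le (by norm_num)).lipschitzWith_of_hasCompactSupport
    (n := 1) hφ.2 (by norm_num)
  exact ⟨L, hL⟩

lemma IsTest.add {φ ψ : Pos d × Pos d → ℝ} (hφ : IsTest φ) (hψ : IsTest ψ) :
    IsTest (φ + ψ) := ⟨hφ.1.add hψ.1, hφ.2.add hψ.2⟩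

lemma IsTest.smul {φ : Pos d × Pos d → ℝ} (c : ℝ) (hφ : IsTest φ) :
    IsTest (c • φ) := ⟨hφ.1.const_smul c, hφ.2.smul_left (f := fun _ => c)⟩

lemma IsTest.zero : IsTest (0 : Pos d × Pos d → ℝ) := ⟨contDiff_const, HasCompactSupport.zero⟩

lemma transport_add {φ ψ : Pos d × Pos d → ℝ} (hφ : IsTest φ) (hψ : IsTest ψ) :
    transport (φ + ψ) = transport φ + transport ψ := by
  funext p
  rw [Pi.add_apply, transport_eq (hφ.add hψ), transport_eq hφ, transport_eq hψ]
  simp only [onPhase, transportExt]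
  rw [fderiv_add (hφ.1.differentiable (by simp)).differentiableAt
    (hψ.1.differentiable (by simp)).differentiableAt]
  rfl

lemma transport_smul {φ : Pos d × Pos d → ℝ} (c : ℝ) (hφ : IsTest φ) :
    transport (c • φ) = c • transport φ := by
  funext p
  rw [Pi.smul_apply, transport_eq (hφ.smul c), transport_eq hφ]
  simp only [onPhase, transportExt]
  rw [fderiv_const_smul (hφ.1.differentiable (by simp)).differentiableAt]
  rfl

/-- Phase space is closed in `ℝ^d × ℝ^d`, so its measure pushes forward to a measure finite on
compacts. Density of smooth compactly supported functions for that measure is applied to the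
extension of `u` by zero. -/
lemma exists_isTest_eLpNorm_sub_le {u : Phase d → ℝ} (hu : MemLp u 2 (phaseMeasure d)) {ε : ℝ}
    (hε : 0 < ε) :
    ∃ φ, IsTest φ ∧ eLpNorm (u - onPhase φ) 2 (phaseMeasure d) ≤ ENNReal.ofReal ε := by
  set e : Phase d → Pos d × Pos d := fun p => (p.1, (p.2 : Pos d)) with he
  have hce : IsClosedEmbedding e := isClosedEmbedding_phase
  have hme : MeasurableEmbedding e := hce.measurableEmbedding
  have hfin : IsFiniteMeasureOnCompacts ((phaseMeasure d).map e) := by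
    refine ⟨fun K hK => ?_⟩
    rw [hme.map_apply]
    exact (hce.isCompact_preimage hK).measure_lt_top
  have h1 : (Function.extend e u 0) ∘ e = u := by
    funext p
    exact hme.injective.extend_apply _ _ _
  have h2 : MemLp (Function.extend e u 0) 2 ((phaseMeasure d).map e) := by
    rw [hme.memLp_map_measure_iff, h1]
    exact hu
  obtain ⟨g, hg1, hg2, hg3⟩ := h2.exist_eLpNorm_sub_le (by norm_num) (by norm_num) hε
  refine ⟨g, ⟨hg2, hg1⟩, ?_⟩
  rw [hme.eLpNorm_map_measure] at hg3
  refine le_trans (le_of_eq ?_) hg3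
  congr 1
  funext p
  simp only [Pi.sub_apply, Function.comp_apply]
  rw [show Function.extend e u 0 (e p) = u p from hme.injective.extend_apply _ _ _]
  rfl

/-- Integration by parts along `θ` for each fixed `θ`. This skew-symmetry is what makes the adjoint
problem coercive. -/
lemma integral_test_mul_transport {φ : Pos d × Pos d → ℝ} (hφ : IsTest φ) :
    ∫ p, onPhase φ p * transport φ p ∂(phaseMeasure d) = 0 := by
  have hi : Integrable (fun p => onPhase φ p * transport φ p) (phaseMeasure d) :=
    integrable_mul_of_memLp_two (hφ.memLp 2) (hφ.memLp_transport 2)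
  rw [integral_prod_symm _ hi]
  refine integral_eq_zero_of_ae ?_
  filter_upwards [hi.prod_left_ae] with θ hθ
  have hs : ∀ x : Pos d, DifferentiableAt ℝ (fun x' => φ (x', (θ : Pos d))) x :=
    fun x => (hasFDerivAt_slice hφ x θ).differentiableAt
  have hθ' : Integrable (fun x : Pos d => φ (x, (θ : Pos d)) *
      fderiv ℝ (fun x' => φ (x', (θ : Pos d))) x (θ : Pos d)) volume := hθ
  have hsq : Integrable (fun x : Pos d => φ (x, (θ : Pos d)) * φ (x, (θ : Pos d))) volume := by
    have hc : Continuous fun x : Pos d => φ (x, (θ : Pos d)) := by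
      have := hφ.1.continuous
      fun_prop
    refine (hc.mul hc).integrable_of_hasCompactSupport ?_
    obtain ⟨M, R, -, -, -, hR⟩ := hφ.exists_bound
    refine HasCompactSupport.intro (isCompact_closedBall (0 : Pos d) R) fun x hx => ?_
    simp [hR (x, (θ : Pos d)) (by simpa using hx)]
  have := integral_mul_fderiv_eq_neg_fderiv_mul_of_integrable (v := (θ : Pos d))
    (by simpa only [mul_comm] using hθ') hθ' hsq (fun x _ => hs x) (fun x _ => hs x)
  have h2 : ∫ x : Pos d, fderiv ℝ (fun x' => φ (x', (θ : Pos d))) x (θ : Pos d) *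
      φ (x, (θ : Pos d)) = ∫ x : Pos d, φ (x, (θ : Pos d)) *
      fderiv ℝ (fun x' => φ (x', (θ : Pos d))) x (θ : Pos d) := by
    simp only [mul_comm]
  rw [h2] at this
  change ∫ x : Pos d, φ (x, (θ : Pos d)) *
      fderiv ℝ (fun x' => φ (x', (θ : Pos d))) x (θ : Pos d) = 0
  linarith

end TestFunctions

/-! ### The free transport flow. -/

section Flow

variable {d : ℕ}

/-- The free transport flow `(x, θ) ↦ (x + r θ, θ)`. -/
noncomputable def flow (r : ℝ) (p : Phase d) : Phase d := (p.1 + r • (p.2 : Pos d), p.2)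

lemma continuous_flow (r : ℝ) : Continuous (flow r : Phase d → Phase d) := by
  unfold flow; fun_prop

lemma flow_flow_neg (r : ℝ) (p : Phase d) : flow r (flow (-r) p) = p := by
  simp [flow]

lemma flow_neg_flow (r : ℝ) (p : Phase d) : flow (-r) (flow r p) = p := by
  simp [flow]

/-- For fixed `θ` the flow is a translation, so it is a skew product over the directions. -/
lemma measurePreserving_flow (r : ℝ) :
    MeasurePreserving (flow r : Phase d → Phase d) (phaseMeasure d) (phaseMeasure d) := by
  have h : MeasurePreserving (fun p : Dir d × Pos d => (p.1, p.2 + r • (p.1 : Pos d)))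
      ((dirMeasure d).prod volume) ((dirMeasure d).prod volume) :=
    (MeasurePreserving.id (dirMeasure d)).skew_product (g := fun θ x => x + r • (θ : Pos d))
      (by fun_prop) (Eventually.of_forall fun θ => (measurePreserving_add_right volume _).map_eq)
  exact (Measure.measurePreserving_swap.comp h).comp Measure.measurePreserving_swap

lemma map_flow_le (r : ℝ) : (phaseMeasure d).map (flow r) ≤ (1 : ℝ≥0) • phaseMeasure d := by
  rw [(measurePreserving_flow r).map_eq, one_smul]

/-- The free transport flow as a measurable equivalence. -/
noncomputable def flowEquiv (r : ℝ) : Phase d ≃ᵐ Phase d where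
  toFun := flow r
  invFun := flow (-r)
  left_inv := flow_neg_flow r
  right_inv := flow_flow_neg r
  measurable_toFun := (continuous_flow r).measurable
  measurable_invFun := (continuous_flow (-r)).measurable

lemma integral_flow (r : ℝ) (F : Phase d → ℝ) :
    ∫ p, F (flow r p) ∂(phaseMeasure d) = ∫ p, F p ∂(phaseMeasure d) :=
  (measurePreserving_flow r).integral_comp (flowEquiv r).measurableEmbedding F

lemma dist_flow_le (r : ℝ) (p : Phase d) : dist (flow r p) p ≤ |r| := by
  have h : ‖(p.2 : Pos d)‖ = 1 := by simp
  rw [Prod.dist_eq]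
  simp [flow, norm_smul, h]

lemma memLp_flow {u : Phase d → ℝ} (hu : MemLp u 2 (phaseMeasure d)) (r : ℝ) :
    MemLp (fun p => u (flow r p)) 2 (phaseMeasure d) :=
  hu.comp_measurePreserving (measurePreserving_flow r)

lemma eLpNorm_flow {u : Phase d → ℝ} (hu : AEStronglyMeasurable u (phaseMeasure d)) (r : ℝ) :
    eLpNorm (fun p => u (flow r p)) 2 (phaseMeasure d) = eLpNorm u 2 (phaseMeasure d) :=
  eLpNorm_comp_measurePreserving hu (measurePreserving_flow r)

lemma tendsto_eLpNorm_flow_sub {u : Phase d → ℝ} (hu : MemLp u 2 (phaseMeasure d)) :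
    Tendsto (fun r => eLpNorm (fun p => u (flow r p) - u p) 2 (phaseMeasure d)) (𝓝 0) (𝓝 0) := by
  refine tendsto_eLpNorm_comp_sub (δ := fun r => |r|)
    (Eventually.of_forall fun r => ⟨(continuous_flow r).measurable, map_flow_le r⟩) ?_
    (Eventually.of_forall fun r p => dist_flow_le r p) hu
  have := (continuous_abs (G := ℝ)).tendsto 0
  rwa [abs_zero] at this

/-- The transported test function `(x, y) ↦ φ(x + r y, y)`. -/
def flowTest (r : ℝ) (φ : Pos d × Pos d → ℝ) (z : Pos d × Pos d) : ℝ := φ (z.1 + r • z.2, z.2)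

lemma IsTest.flowTest {φ : Pos d × Pos d → ℝ} (hφ : IsTest φ) (r : ℝ) :
    IsTest (flowTest r φ) := by
  refine ⟨?_, ?_⟩
  · have : ContDiff ℝ ∞ fun z : Pos d × Pos d => (z.1 + r • z.2, z.2) := by fun_prop
    exact hφ.1.comp this
  · let e : Pos d × Pos d ≃ₜ Pos d × Pos d :=
      { toFun := fun z => (z.1 + r • z.2, z.2)
        invFun := fun z => (z.1 - r • z.2, z.2)
        left_inv := fun z => by simp
        right_inv := fun z => by simp
        continuous_toFun := by fun_prop
        continuous_invFun := by fun_prop }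
    exact hφ.2.comp_homeomorph e

lemma transport_flowTest {φ : Pos d × Pos d → ℝ} (r : ℝ) (p : Phase d) :
    transport (flowTest r φ) p = transport φ (flow r p) := by
  unfold transport flowTest flow
  simp only
  rw [fderiv_comp_add_right (f := fun y => φ (y, (p.2 : Pos d)))]

lemma hasDerivAt_flow {φ : Pos d × Pos d → ℝ} (hφ : IsTest φ) (p : Phase d) (r : ℝ) :
    HasDerivAt (fun r => onPhase φ (flow r p)) (transport φ (flow r p)) r := by
  have h1 := hasFDerivAt_slice hφ (p.1 + r • (p.2 : Pos d)) p.2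
  have h2 : HasDerivAt (fun r : ℝ => p.1 + r • (p.2 : Pos d)) (p.2 : Pos d) r := by
    simpa using ((hasDerivAt_id r).smul_const (p.2 : Pos d)).const_add p.1
  have h3 := h1.comp_hasDerivAt r h2
  have h4 : transport φ (flow r p) = ((fderiv ℝ φ (p.1 + r • (p.2 : Pos d), (p.2 : Pos d))).comp
      (ContinuousLinearMap.inl ℝ (Pos d) (Pos d))) (p.2 : Pos d) := by
    unfold transport flow
    rw [h1.fderiv]
  rw [h4]
  exact h3

lemma hasDerivAt_integral_flow {u : Phase d → ℝ} (hu : MemLp u 2 (phaseMeasure d))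
    {φ : Pos d × Pos d → ℝ} (hφ : IsTest φ) (r : ℝ) :
    HasDerivAt (fun r => ∫ p, u p * onPhase φ (flow r p) ∂(phaseMeasure d))
      (∫ p, u p * transport φ (flow r p) ∂(phaseMeasure d)) r := by
  obtain ⟨M, R, hM0, hR0, hM, hR⟩ := hφ.transportExt.exists_bound
  -- For parameters within distance `1` of `r`, points outside `A` are not carried into the support
  -- of the transport derivative, so `|u| M` on `A` dominates.
  set A : Set (Phase d) := Metric.closedBall 0 (R + |r| + 1) ×ˢ univ with hA
  have hAm : MeasurableSet A := Metric.isClosed_closedBall.measurableSet.prod MeasurableSet.univ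
  have hAfin : phaseMeasure d A < ⊤ := by
    refine IsCompact.measure_lt_top ?_
    exact (isCompact_closedBall _ _).prod isCompact_univ
  have hind : MemLp (A.indicator fun _ => M) 2 (phaseMeasure d) :=
    memLp_indicator_const 2 hAm M (Or.inr hAfin.ne)
  refine (hasDerivAt_integral_of_dominated_loc_of_deriv_le
    (F := fun r p => u p * onPhase φ (flow r p)) (F' := fun r p => u p * transport φ (flow r p))
    (bound := fun p => |u p| * A.indicator (fun _ => M) p) (s := Metric.ball r 1)
    (Metric.ball_mem_nhds r one_pos)
    (Eventually.of_forall fun r' => hu.1.mul (memLp_flow (hφ.memLp 2) r').1)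
    (integrable_mul_of_memLp_two hu (memLp_flow (hφ.memLp 2) r))
    (hu.1.mul (memLp_flow (hφ.memLp_transport 2) r).1) ?_
    (integrable_mul_of_memLp_two hu.abs hind) ?_).2
  · refine Eventually.of_forall fun p r' hr' => ?_
    rw [norm_mul, Real.norm_eq_abs]
    refine mul_le_mul_of_nonneg_left ?_ (abs_nonneg _)
    rw [transport_eq hφ]
    by_cases hp : p ∈ A
    · rw [indicator_of_mem hp]
      exact hM _
    · rw [indicator_of_notMem hp]
      have hp1 : R + |r| + 1 < ‖p.1‖ := by simpa [hA] using hp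
      have h1 : ‖(p.2 : Pos d)‖ = 1 := by simp
      have h2 : |r'| < |r| + 1 := by
        have h := abs_sub_abs_le_abs_sub r' r
        have h' : |r' - r| < 1 := hr'
        linarith
      have h3 : R < ‖p.1 + r' • (p.2 : Pos d)‖ := by
        have := norm_sub_norm_le p.1 (-(r' • (p.2 : Pos d)))
        rw [sub_neg_eq_add, norm_neg, norm_smul, h1, mul_one, Real.norm_eq_abs] at this
        linarith
      have := hR ((flow r' p).1, ((flow r' p).2 : Pos d)) h3
      simp [onPhase, this]
  · exact Eventually.of_forall fun p r' _ => (hasDerivAt_flow hφ p r').const_mul (u p)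

end Flow

/-! ### Weak transport derivatives and renormalization. -/

section WeakTransport

variable {d : ℕ}

/-- The map `r ↦ ∫ u φ(flow r)` has derivative `-∫ w φ(flow r)`. After adding `r ∫ w φ` the
derivative is `-∫ w (φ(flow r) - φ)`, and the mean value inequality applies. The bound involves no
derivative of `φ`, so that it survives approximation. -/
lemma IsWeakTransport.abs_integral_flow_le_of_isTest {u w : Phase d → ℝ}
    (hu : MemLp u 2 (phaseMeasure d)) (hw : MemLp w 2 (phaseMeasure d)) (h : IsWeakTransport u w)
    {φ : Pos d × Pos d → ℝ} (hφ : IsTest φ) {τ M : ℝ}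
    (hM : ∀ r, |r| ≤ |τ| →
      (eLpNorm (fun p => onPhase φ (flow r p) - onPhase φ p) 2 (phaseMeasure d)).toReal ≤ M) :
    |∫ p, u p * (onPhase φ (flow τ p) - onPhase φ p) ∂(phaseMeasure d) +
      τ * ∫ p, w p * onPhase φ p ∂(phaseMeasure d)| ≤
      |τ| * ((eLpNorm w 2 (phaseMeasure d)).toReal * M) := by
  set c := ∫ p, w p * onPhase φ p ∂(phaseMeasure d)
  set H : ℝ → ℝ := fun r => ∫ p, u p * onPhase φ (flow r p) ∂(phaseMeasure d) + r * c
  have hd : ∀ r, HasDerivAt H (-(∫ p, w p * onPhase φ (flow r p) ∂(phaseMeasure d)) + c) r := by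
    intro r
    have h1 := hasDerivAt_integral_flow hu hφ r
    have h2 := h _ (hφ.flowTest r)
    simp only [transport_flowTest] at h2
    rw [h2] at h1
    exact h1.add (by simpa using (hasDerivAt_id r).mul_const c)
  have hb : ∀ r ∈ Metric.closedBall (0 : ℝ) |τ|,
      ‖-(∫ p, w p * onPhase φ (flow r p) ∂(phaseMeasure d)) + c‖ ≤
        (eLpNorm w 2 (phaseMeasure d)).toReal * M := by
    intro r hr
    have hr' : |r| ≤ |τ| := by simpa using hr
    have hm := (memLp_flow (hφ.memLp 2) r).sub (hφ.memLp 2)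
    have e : -(∫ p, w p * onPhase φ (flow r p) ∂(phaseMeasure d)) + c =
        -∫ p, w p * (onPhase φ (flow r p) - onPhase φ p) ∂(phaseMeasure d) := by
      simp_rw [mul_sub]
      rw [integral_sub (integrable_mul_of_memLp_two hw (memLp_flow (hφ.memLp 2) r))
        (integrable_mul_of_memLp_two hw (hφ.memLp 2))]
      ring
    rw [e, norm_neg]
    refine (abs_integral_mul_le hw hm).trans ?_
    gcongr
    exact hM r hr'
  have := (convex_closedBall (0 : ℝ) |τ|).norm_image_sub_le_of_norm_hasDerivWithin_le
    (f := H) (fun r _ => (hd r).hasDerivWithinAt) hb (x := 0) (y := τ) (by simp) (by simp)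
  rw [sub_zero, Real.norm_eq_abs, Real.norm_eq_abs, mul_comm] at this
  refine le_trans (le_of_eq ?_) this
  congr 1
  simp only [H, zero_mul, add_zero]
  simp_rw [mul_sub]
  rw [integral_sub (integrable_mul_of_memLp_two hu (memLp_flow (hφ.memLp 2) τ))
        (integrable_mul_of_memLp_two hu (hφ.memLp 2))]
  have : ∀ p : Phase d, flow 0 p = p := fun p => by simp [flow]
  simp_rw [this]
  ring

/-- Test functions `φ n` tend to `v` in `L²`. Since the flow preserves the measure, replacing `v` by
`φ n` worsens the modulus `M` only by `2 ‖φ n - v‖`. -/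
lemma IsWeakTransport.abs_integral_flow_le {u w : Phase d → ℝ}
    (hu : MemLp u 2 (phaseMeasure d)) (hw : MemLp w 2 (phaseMeasure d)) (h : IsWeakTransport u w)
    {v : Phase d → ℝ} (hv : MemLp v 2 (phaseMeasure d)) {τ M : ℝ}
    (hM : ∀ r, |r| ≤ |τ| →
      (eLpNorm (fun p => v (flow r p) - v p) 2 (phaseMeasure d)).toReal ≤ M) :
    |∫ p, u p * (v (flow τ p) - v p) ∂(phaseMeasure d) +
      τ * ∫ p, w p * v p ∂(phaseMeasure d)| ≤
      |τ| * ((eLpNorm w 2 (phaseMeasure d)).toReal * M) := by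
  have hex : ∀ n : ℕ, ∃ φ, IsTest φ ∧
      eLpNorm (v - onPhase φ) 2 (phaseMeasure d) ≤ ENNReal.ofReal (1 / ((n : ℝ) + 1)) :=
    fun n => exists_isTest_eLpNorm_sub_le hv (by positivity)
  choose φ hφ hφv using hex
  have hc : Tendsto (fun n => eLpNorm (onPhase (φ n) - v) 2 (phaseMeasure d)) atTop (𝓝 0) := by
    have h0 : Tendsto (fun n : ℕ => ENNReal.ofReal (1 / ((n : ℝ) + 1))) atTop (𝓝 0) := by
      have := ENNReal.tendsto_ofReal (tendsto_one_div_add_atTop_nhds_zero_nat (𝕜 := ℝ))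
      simpa using this
    refine tendsto_of_tendsto_of_tendsto_of_le_of_le tendsto_const_nhds h0
      (fun _ => zero_le) fun n => ?_
    simp only
    rw [eLpNorm_sub_comm]
    exact hφv n
  have hcτ : Tendsto (fun n => eLpNorm ((fun p => onPhase (φ n) (flow τ p)) - fun p => v (flow τ p))
      2 (phaseMeasure d)) atTop (𝓝 0) := by
    refine hc.congr fun n => ?_
    exact (eLpNorm_flow (((hφ n).memLp 2).sub hv).1 τ).symm
  have t1 := tendsto_integral_mul_of_tendsto_eLpNorm
    (Eventually.of_forall fun n => memLp_flow ((hφ n).memLp 2) τ) (memLp_flow hv τ) hu hcτ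
  have t2 := tendsto_integral_mul_of_tendsto_eLpNorm
    (Eventually.of_forall fun n => (hφ n).memLp 2) hv hu hc
  have t3 := tendsto_integral_mul_of_tendsto_eLpNorm
    (Eventually.of_forall fun n => (hφ n).memLp 2) hv hw hc
  have hsplit : ∀ f : Phase d → ℝ, MemLp f 2 (phaseMeasure d) →
      ∫ p, u p * (f (flow τ p) - f p) ∂(phaseMeasure d) + τ * ∫ p, w p * f p ∂(phaseMeasure d) =
      ∫ p, f (flow τ p) * u p ∂(phaseMeasure d) - ∫ p, f p * u p ∂(phaseMeasure d) +
        τ * ∫ p, f p * w p ∂(phaseMeasure d) := by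
    intro f hf
    simp_rw [mul_sub]
    rw [integral_sub (integrable_mul_of_memLp_two hu (memLp_flow hf τ))
        (integrable_mul_of_memLp_two hu hf)]
    simp only [mul_comm]
  have t4 := ((t1.sub t2).add (t3.const_mul τ)).abs
  rw [← hsplit v hv] at t4
  have t5 : Tendsto (fun n => |τ| * ((eLpNorm w 2 (phaseMeasure d)).toReal *
      (M + 2 * (eLpNorm (onPhase (φ n) - v) 2 (phaseMeasure d)).toReal))) atTop
      (𝓝 (|τ| * ((eLpNorm w 2 (phaseMeasure d)).toReal * (M + 2 * 0)))) := by
    have := (ENNReal.tendsto_toReal ENNReal.zero_ne_top).comp hc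
    exact (((this.const_mul 2).const_add M).const_mul _).const_mul _
  rw [mul_zero, add_zero] at t5
  refine le_of_tendsto_of_tendsto' t4 t5 fun n => ?_
  rw [← hsplit (onPhase (φ n)) ((hφ n).memLp 2)]
  refine h.abs_integral_flow_le_of_isTest hu hw (hφ n) fun r hr => ?_
  have m0 := ((hφ n).memLp 2).sub hv
  have m1 := memLp_flow m0 r
  have m2 := (memLp_flow hv r).sub hv
  have e : (fun p => onPhase (φ n) (flow r p) - onPhase (φ n) p) =
      (fun p => (onPhase (φ n) - v) (flow r p)) + ((fun p => v (flow r p)) - v)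
        - (onPhase (φ n) - v) := by
    funext p; simp
  rw [e]
  have i1 := eLpNorm_sub_le (m1.1.add m2.1) m0.1 (p := 2) (by norm_num)
  have i2 := eLpNorm_add_le m1.1 m2.1 (p := 2) (by norm_num)
  have i3 := i1.trans (add_le_add_left i2 _)
  rw [eLpNorm_flow m0.1] at i3
  have i4 := ENNReal.toReal_mono (by
    exact ENNReal.add_ne_top.2 ⟨ENNReal.add_ne_top.2 ⟨m0.2.ne, m2.2.ne⟩, m0.2.ne⟩) i3
  rw [ENNReal.toReal_add (ENNReal.add_ne_top.2 ⟨m0.2.ne, m2.2.ne⟩) m0.2.ne,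
    ENNReal.toReal_add m0.2.ne m2.2.ne] at i4
  have := hM r hr
  have e2 : (fun p => v (flow r p) - v p) = (fun p => v (flow r p)) - v := rfl
  rw [e2] at this
  linarith

/-- The renormalization property of transport: `∫ (θ · ∇_x u) β(u) = 0` when `β` is the
derivative of the convex function `B`. -/
lemma IsWeakTransport.integral_mul_comp_eq_zero {u w : Phase d → ℝ}
    (hu : MemLp u 2 (phaseMeasure d)) (hw : MemLp w 2 (phaseMeasure d)) (h : IsWeakTransport u w)
    {B β : ℝ → ℝ} (hβc : Continuous β) (hBc : Continuous B) {C : ℝ} (hβ : ∀ a, |β a| ≤ C * |a|)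
    (hB : ∀ a, |B a| ≤ C * (a * a)) (hconv : ∀ a b, (a - b) * β b ≤ B a - B b) :
    ∫ p, w p * β (u p) ∂(phaseMeasure d) = 0 := by
  have hv : MemLp (fun p => β (u p)) 2 (phaseMeasure d) :=
    MemLp.of_le_mul hu (hβc.comp_aestronglyMeasurable hu.1) (Eventually.of_forall fun p => hβ _)
  have hBi : Integrable (fun p => B (u p)) (phaseMeasure d) := by
    refine Integrable.mono' ((integrable_mul_of_memLp_two hu hu).const_mul C)
      (hBc.comp_aestronglyMeasurable hu.1) (Eventually.of_forall fun p => hB _)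
  -- Invariance under the flow moves the difference from `β(u)` to `u`. Convexity then bounds the
  -- integrand by `B(u ∘ flow) - B(u)`, whose integral is zero.
  have hsign : ∀ τ, ∫ p, u p * (β (u (flow τ p)) - β (u p)) ∂(phaseMeasure d) ≤ 0 := by
    intro τ
    have e1 : ∫ p, u p * (β (u (flow τ p)) - β (u p)) ∂(phaseMeasure d) =
        ∫ p, (u (flow (-τ) p) - u p) * β (u p) ∂(phaseMeasure d) := by
      simp_rw [mul_sub, sub_mul]
      rw [integral_sub (integrable_mul_of_memLp_two hu (memLp_flow hv τ))
        (integrable_mul_of_memLp_two hu hv),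
        integral_sub (integrable_mul_of_memLp_two (memLp_flow hu (-τ)) hv)
        (integrable_mul_of_memLp_two hu hv),
        ← integral_flow τ (fun p => u (flow (-τ) p) * β (u p))]
      simp_rw [flow_neg_flow]
    rw [e1]
    have hBi' : Integrable (fun p => B (u (flow (-τ) p))) (phaseMeasure d) :=
      (measurePreserving_flow (-τ)).integrable_comp_of_integrable hBi
    calc ∫ p, (u (flow (-τ) p) - u p) * β (u p) ∂(phaseMeasure d)
        ≤ ∫ p, (B (u (flow (-τ) p)) - B (u p)) ∂(phaseMeasure d) := by
          refine integral_mono (integrable_mul_of_memLp_two ((memLp_flow hu (-τ)).sub hu) hv)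
            (hBi'.sub hBi) fun p => hconv _ _
      _ = 0 := by
          rw [integral_sub hBi' hBi, integral_flow (-τ) (fun p => B (u p)), sub_self]
  set c := ∫ p, w p * β (u p) ∂(phaseMeasure d) with hc
  by_contra hne
  set W := (eLpNorm w 2 (phaseMeasure d)).toReal with hW
  have hW0 : 0 ≤ W := ENNReal.toReal_nonneg
  have hη : 0 < |c| / (2 * (W + 1)) := by positivity
  have ht := (ENNReal.tendsto_toReal ENNReal.zero_ne_top).comp (tendsto_eLpNorm_flow_sub hv)
  obtain ⟨r0, hr0, hr⟩ := Metric.tendsto_nhds_nhds.1 ht _ hη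
  have hM : ∀ r, |r| ≤ r0 / 2 → (eLpNorm (fun p => β (u (flow r p)) - β (u p)) 2
      (phaseMeasure d)).toReal ≤ |c| / (2 * (W + 1)) := by
    intro r hr'
    have := hr (x := r) (by rw [dist_zero_right, Real.norm_eq_abs]; linarith)
    simp only [Function.comp_apply, ENNReal.toReal_zero, dist_zero_right] at this
    exact (le_abs_self _).trans this.le
  -- The sign information holds for both signs of `τ`. Taking `τ` of sign opposite to `c`
  -- contradicts the first-order expansion, whose error is at most `|τ| |c| / 2`.
  have hfin : ∀ τ, |τ| = r0 / 2 → |τ| * |c| = -(τ * c) → False := by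
    intro τ hτ hτc
    have h1 := h.abs_integral_flow_le hu hw hv (τ := τ) (M := |c| / (2 * (W + 1)))
      (fun r hr' => hM r (hr'.trans hτ.le))
    have h2 := hsign τ
    have h3 : W * (|c| / (2 * (W + 1))) ≤ |c| / 2 := by
      rw [mul_div_assoc', div_le_div_iff₀ (by positivity) (by norm_num)]
      nlinarith [abs_nonneg c]
    have h4 := neg_le_of_abs_le h1
    have h5 : 0 < |τ| := by rw [hτ]; positivity
    have h6 : |τ| * (W * (|c| / (2 * (W + 1)))) ≤ |τ| * (|c| / 2) :=
      mul_le_mul_of_nonneg_left h3 h5.le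
    have h7 : 0 < |τ| * |c| := mul_pos h5 (abs_pos.2 hne)
    rw [← hc] at h4
    linarith
  rcases lt_or_gt_of_ne hne with hneg | hpos
  · refine hfin (r0 / 2) (abs_of_pos (by positivity)) ?_
    rw [abs_of_pos (show (0 : ℝ) < r0 / 2 by positivity), abs_of_neg hneg]
    ring
  · refine hfin (-(r0 / 2)) (by rw [abs_neg]; exact abs_of_pos (by positivity)) ?_
    rw [abs_neg, abs_of_pos (show (0 : ℝ) < r0 / 2 by positivity), abs_of_pos hpos]
    ring

end WeakTransport

/-! ### The collision operator of a bounded symmetric kernel. -/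

section BoundedKernel

variable {d : ℕ}

/-- A bounded, symmetric, nonnegative and measurable scattering kernel. -/
structure IsScatteringKernel (k : Pos d → Dir d → Dir d → ℝ) (M : ℝ) : Prop where
  measurable : Measurable fun q : Pos d × (Dir d × Dir d) => k q.1 q.2.1 q.2.2
  nonneg : ∀ x a b, 0 ≤ k x a b
  le : ∀ x a b, k x a b ≤ M
  symm : ∀ x a b, k x a b = k x b a

variable {k : Pos d → Dir d → Dir d → ℝ} {M : ℝ}

/-- The bilinear form `1/2 ∭ k (u - u') (φ - φ')` of a scattering kernel. -/
noncomputable def scatterForm (k : Pos d → Dir d → Dir d → ℝ) (u φ : Phase d → ℝ) : ℝ :=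
  1 / 2 * ∫ q, k q.1 q.2.1 q.2.2 * jump u q * jump φ q ∂(pairMeasure d)

lemma IsScatteringKernel.memLp_mul_jump (hk : IsScatteringKernel k M) {u : Phase d → ℝ}
    (hu : MemLp u 2 (phaseMeasure d)) :
    MemLp (fun q => k q.1 q.2.1 q.2.2 * jump u q) 2 (pairMeasure d) :=
  memLp_two_mul_of_bound (memLp_jump hu) hk.measurable.aestronglyMeasurable
    fun q => by rw [abs_of_nonneg (hk.nonneg _ _ _)]; exact hk.le _ _ _

lemma collision_eq (k : Pos d → Dir d → Dir d → ℝ) (u : Phase d → ℝ) (p : Phase d) :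
    collision k u p = -∫ b, k p.1 p.2 b * jump u (p.1, (p.2, b)) ∂(dirMeasure d) := by
  rw [collision, ← integral_neg]
  refine integral_congr_ae (Eventually.of_forall fun b => ?_)
  simp only [jump]
  ring

lemma IsScatteringKernel.memLp_collision (hk : IsScatteringKernel k M) {u : Phase d → ℝ}
    (hu : MemLp u 2 (phaseMeasure d)) : MemLp (collision k u) 2 (phaseMeasure d) := by
  rw [show collision k u = -fun p : Phase d =>
    ∫ b, k p.1 p.2 b * jump u (p.1, (p.2, b)) ∂(dirMeasure d) from funext (collision_eq k u)]
  exact (memLp_integral_pair (hk.memLp_mul_jump hu)).neg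

/-- Exchanging the two directions leaves `k` unchanged and reverses the jump of `u`. Averaging the
two resulting expressions yields the symmetric form. -/
lemma IsScatteringKernel.integral_collision_mul (hk : IsScatteringKernel k M)
    {u φ : Phase d → ℝ} (hu : MemLp u 2 (phaseMeasure d)) (hφ : MemLp φ 2 (phaseMeasure d)) :
    ∫ p, collision k u p * φ p ∂(phaseMeasure d) = -scatterForm k u φ := by
  have m := hk.memLp_mul_jump hu
  have m1 := memLp_pair_fst hφ
  have m2 := memLp_pair_snd hφ
  have i1 := integrable_mul_of_memLp_two m m1
  have i2 := integrable_mul_of_memLp_two m m2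
  have e1 : ∫ p, collision k u p * φ p ∂(phaseMeasure d) =
      -∫ q, k q.1 q.2.1 q.2.2 * jump u q * φ (q.1, q.2.1) ∂(pairMeasure d) := by
    rw [integral_pairMeasure i1, ← integral_neg]
    refine integral_congr_ae (Eventually.of_forall fun p => ?_)
    simp only
    rw [collision_eq, neg_mul, integral_mul_const]
  have e2 : ∫ q, k q.1 q.2.1 q.2.2 * jump u q * φ (q.1, q.2.2) ∂(pairMeasure d) =
      -∫ q, k q.1 q.2.1 q.2.2 * jump u q * φ (q.1, q.2.1) ∂(pairMeasure d) := by
    rw [← integral_pair_swap, ← integral_neg]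
    refine integral_congr_ae (Eventually.of_forall fun q => ?_)
    simp only [jump, Prod.fst_swap, Prod.snd_swap]
    rw [hk.symm]
    ring
  have e3 : ∫ q, k q.1 q.2.1 q.2.2 * jump u q * jump φ q ∂(pairMeasure d) =
      ∫ q, k q.1 q.2.1 q.2.2 * jump u q * φ (q.1, q.2.1) ∂(pairMeasure d) -
      ∫ q, k q.1 q.2.1 q.2.2 * jump u q * φ (q.1, q.2.2) ∂(pairMeasure d) := by
    rw [← integral_sub i1 i2]
    refine integral_congr_ae (Eventually.of_forall fun q => ?_)
    simp only [jump]
    ring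
  rw [e1, scatterForm, e3, e2]
  ring

lemma scatterForm_comm (k : Pos d → Dir d → Dir d → ℝ) (u φ : Phase d → ℝ) :
    scatterForm k u φ = scatterForm k φ u := by
  unfold scatterForm
  congr 2
  funext q
  ring

/-- The hypothesis says that `φ` increases with `u`; it is made for `φ = β(u)` with `β` monotone. -/
lemma IsScatteringKernel.scatterForm_nonneg (hk : IsScatteringKernel k M) {u φ : Phase d → ℝ}
    (h : ∀ p q, 0 ≤ (u p - u q) * (φ p - φ q)) : 0 ≤ scatterForm k u φ := by
  refine mul_nonneg (by norm_num) (integral_nonneg fun q => ?_)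
  simp only [Pi.zero_apply, jump, mul_assoc]
  exact mul_nonneg (hk.nonneg _ _ _) (h _ _)

/-- Splitting the integral needs integrable fibres, which square integrability provides only for
almost every point. -/
lemma IsScatteringKernel.collision_add (hk : IsScatteringKernel k M) {u v : Phase d → ℝ}
    (hu : MemLp u 2 (phaseMeasure d)) (hv : MemLp v 2 (phaseMeasure d)) :
    collision k (u + v) =ᵐ[phaseMeasure d] collision k u + collision k v := by
  have m := (hk.memLp_mul_jump hu).comp_measurePreserving measurePreserving_pair_assoc
  have m' := (hk.memLp_mul_jump hv).comp_measurePreserving measurePreserving_pair_assoc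
  have sq : ∀ {w : Phase d → ℝ}, MemLp w 2 (phaseMeasure d) →
      ∀ᵐ p ∂(phaseMeasure d),
        Integrable (fun b => k p.1 p.2 b * jump w (p.1, (p.2, b))) (dirMeasure d) := by
    intro w hw
    have m := (hk.memLp_mul_jump hw).comp_measurePreserving measurePreserving_pair_assoc
    have i := integrable_mul_of_memLp_two m m
    filter_upwards [i.prod_right_ae, m.1.prodMk_left] with p hp hm
    have : MemLp (fun b => k p.1 p.2 b * jump w (p.1, (p.2, b))) 2 (dirMeasure d) := by
      refine (memLp_two_iff_integrable_sq hm).2 ?_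
      simpa [sq] using hp
    exact this.integrable (by norm_num)
  filter_upwards [sq hu, sq hv] with p h1 h2
  rw [Pi.add_apply, collision_eq, collision_eq, collision_eq, ← neg_add, ← integral_add h1 h2]
  congr 1
  refine integral_congr_ae (Eventually.of_forall fun b => ?_)
  simp only [jump, Pi.add_apply]
  ring

lemma collision_smul (c : ℝ) (u : Phase d → ℝ) : collision k (c • u) = c • collision k u := by
  funext p
  rw [Pi.smul_apply, smul_eq_mul, collision, collision, ← integral_const_mul]
  refine integral_congr_ae (Eventually.of_forall fun b => ?_)
  simp only [Pi.smul_apply, smul_eq_mul]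
  ring

end BoundedKernel

/-! ### The radiative transfer equation: estimates and existence. -/

section RTE

variable {d : ℕ} {k : Pos d → Dir d → Dir d → ℝ} {M : ℝ} {lam : Pos d → ℝ} {c : ℝ}

/-- The absorption coefficient is measurable and lies between positive constants. -/
structure IsAbsorption (lam : Pos d → ℝ) (c : ℝ) : Prop where
  pos : 0 < c
  continuous : Continuous lam
  ge : ∀ x, c ≤ lam x
  le : ∀ x, lam x ≤ c⁻¹

lemma IsAbsorption.memLp_mul (hl : IsAbsorption lam c) {X : Type*} [MeasurableSpace X]
    {μ : Measure X} {π : X → Pos d} (hπ : Measurable π) {u : X → ℝ} (hu : MemLp u 2 μ) :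
    MemLp (fun p => lam (π p) * u p) 2 μ := by
  refine memLp_two_mul_of_bound hu (hl.continuous.measurable.comp hπ).aestronglyMeasurable
    (M := c⁻¹) fun p => ?_
  rw [abs_of_nonneg (hl.pos.le.trans (hl.ge _))]
  exact hl.le _

lemma IsRTESolution.sub (hk : IsScatteringKernel k M) {f g u v : Phase d → ℝ}
    (hu : IsRTESolution lam k f u) (hv : IsRTESolution lam k g v) :
    IsRTESolution lam k (f - g) (u - v) := by
  obtain ⟨mu, w, mw, hw, eq1⟩ := hu
  obtain ⟨mv, z, mz, hz, eq2⟩ := hv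
  refine ⟨mu.sub mv, w - z, mw.sub mz, fun φ hφ => ?_, ?_⟩
  · have h1 := hw φ hφ
    have h2 := hz φ hφ
    have t := hφ.memLp_transport 2
    have o := hφ.memLp 2
    simp only [Pi.sub_apply, sub_mul]
    rw [integral_sub (integrable_mul_of_memLp_two mu t) (integrable_mul_of_memLp_two mv t),
      integral_sub (integrable_mul_of_memLp_two mw o) (integrable_mul_of_memLp_two mz o), h1, h2]
    ring
  · have e := hk.collision_add mu ((mv.const_smul (-1 : ℝ)))
    have e' : u - v = u + (-1 : ℝ) • v := by simp [sub_eq_add_neg]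
    filter_upwards [eq1, eq2, e] with p h1 h2 h3
    rw [e', h3, Pi.add_apply, collision_smul]
    simp only [Pi.add_apply, Pi.smul_apply, smul_eq_mul, Pi.sub_apply]
    linarith

/-- Testing the radiative transfer equation with `β(u)`. -/
lemma IsRTESolution.integral_comp (hl : IsAbsorption lam c) (hk : IsScatteringKernel k M)
    {f u : Phase d → ℝ} (hf : MemLp f 2 (phaseMeasure d)) (h : IsRTESolution lam k f u)
    {B β : ℝ → ℝ} (hβc : Continuous β) (hBc : Continuous B) {C : ℝ} (hβ : ∀ a, |β a| ≤ C * |a|)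
    (hB : ∀ a, |B a| ≤ C * (a * a)) (hconv : ∀ a b, (a - b) * β b ≤ B a - B b) :
    ∫ p, lam p.1 * u p * β (u p) ∂(phaseMeasure d) + scatterForm k u (fun p => β (u p)) =
      ∫ p, f p * β (u p) ∂(phaseMeasure d) := by
  obtain ⟨mu, w, mw, hw, eq1⟩ := h
  have hv : MemLp (fun p => β (u p)) 2 (phaseMeasure d) :=
    MemLp.of_le_mul mu (hβc.comp_aestronglyMeasurable mu.1) (Eventually.of_forall fun p => hβ _)
  have h0 := hw.integral_mul_comp_eq_zero mu mw hβc hBc hβ hB hconv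
  have ml := hl.memLp_mul measurable_fst mu
  have h1 : ∫ p, w p * β (u p) ∂(phaseMeasure d) =
      ∫ p, collision k u p * β (u p) ∂(phaseMeasure d) + ∫ p, f p * β (u p) ∂(phaseMeasure d)
      - ∫ p, lam p.1 * u p * β (u p) ∂(phaseMeasure d) := by
    have l3 := integral_lin_comb_three (integrable_mul_of_memLp_two (hk.memLp_collision mu) hv)
      (integrable_mul_of_memLp_two hf hv) (integrable_mul_of_memLp_two ml hv) 1 1 (-1)
    refine Eq.trans (integral_congr_ae ?_) (l3.trans (by ring))
    filter_upwards [eq1] with p hp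
    rw [show w p = collision k u p + f p - lam p.1 * u p by linarith]
    ring
  rw [h0, hk.integral_collision_mul mu hv] at h1
  linarith

/-- The case `β(a) = a`, with primitive `a² / 2`. -/
lemma IsRTESolution.energy (hl : IsAbsorption lam c) (hk : IsScatteringKernel k M)
    {f u : Phase d → ℝ} (hf : MemLp f 2 (phaseMeasure d)) (h : IsRTESolution lam k f u) :
    ∫ p, lam p.1 * u p * u p ∂(phaseMeasure d) + scatterForm k u u =
      ∫ p, f p * u p ∂(phaseMeasure d) := by
  refine h.integral_comp hl hk hf (B := fun a => a * a / 2) (β := fun a => a) (C := 1)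
    continuous_id (by fun_prop) (fun a => by simp) (fun a => ?_) (fun a b => ?_)
  · rw [abs_of_nonneg (by nlinarith [mul_self_nonneg a])]
    nlinarith [mul_self_nonneg a]
  · nlinarith [mul_self_nonneg (a - b)]

lemma IsRTESolution.eLpNorm_two_le (hl : IsAbsorption lam c) (hk : IsScatteringKernel k M)
    {f u : Phase d → ℝ} (hf : MemLp f 2 (phaseMeasure d)) (h : IsRTESolution lam k f u) :
    (eLpNorm u 2 (phaseMeasure d)).toReal ≤ c⁻¹ * (eLpNorm f 2 (phaseMeasure d)).toReal := by
  have e := h.energy hl hk hf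
  have hs : 0 ≤ scatterForm k u u := hk.scatterForm_nonneg fun p q => mul_self_nonneg _
  have mu := h.1
  have h1 : c * (eLpNorm u 2 (phaseMeasure d)).toReal ^ 2 ≤
      ∫ p, lam p.1 * u p * u p ∂(phaseMeasure d) := by
    rw [← integral_sq_eq mu, ← integral_const_mul]
    refine integral_mono ((integrable_mul_of_memLp_two mu mu).const_mul c)
      (integrable_mul_of_memLp_two (hl.memLp_mul measurable_fst mu) mu) fun p => ?_
    simp only
    nlinarith [hl.ge p.1, mul_self_nonneg (u p)]
  have h2 := (le_abs_self _).trans (abs_integral_mul_le hf mu)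
  set U := (eLpNorm u 2 (phaseMeasure d)).toReal
  have hU : 0 ≤ U := ENNReal.toReal_nonneg
  have hc := hl.pos
  rcases hU.eq_or_lt with h0 | h0
  · rw [← h0]; positivity
  · rw [inv_mul_eq_div, le_div_iff₀ hc]
    nlinarith

/-- The `L¹` bound for the radiative transfer equation. -/
lemma IsRTESolution.eLpNorm_one_le (hl : IsAbsorption lam c) (hk : IsScatteringKernel k M)
    {f u : Phase d → ℝ} (hf : MemLp f 2 (phaseMeasure d)) (hf1 : Integrable f (phaseMeasure d))
    (h : IsRTESolution lam k f u) :
    eLpNorm u 1 (phaseMeasure d) ≤ ENNReal.ofReal c⁻¹ * eLpNorm f 1 (phaseMeasure d) := by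
  have mu := h.1
  have hc := hl.pos
  -- The sign function is smoothed to `a / √(a² + δ²)`, with convex primitive `√(a² + δ²) - δ`. Both
  -- have the growth required by `integral_comp`, with constant `δ⁻¹`, while the resulting bound
  -- does not depend on `δ`.
  have key : ∀ δ : ℝ, 0 < δ →
      ∫⁻ p, ENNReal.ofReal (u p * (u p / √(u p * u p + δ * δ))) ∂(phaseMeasure d) ≤
        ENNReal.ofReal c⁻¹ * eLpNorm f 1 (phaseMeasure d) := by
    intro δ hδ
    set β : ℝ → ℝ := fun a => a / √(a * a + δ * δ) with hβdef
    have hs : ∀ a : ℝ, δ ≤ √(a * a + δ * δ) := fun a =>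
      Real.le_sqrt_of_sq_le (by nlinarith [mul_self_nonneg a])
    have hs0 : ∀ a : ℝ, 0 < √(a * a + δ * δ) := fun a => hδ.trans_le (hs a)
    have hsq : ∀ a : ℝ, √(a * a + δ * δ) * √(a * a + δ * δ) = a * a + δ * δ := fun a =>
      Real.mul_self_sqrt (add_nonneg (mul_self_nonneg a) (mul_self_nonneg δ))
    have hβc : Continuous β := by
      refine continuous_id.div (by fun_prop) fun a => (hs0 a).ne'
    have hβ : ∀ a, |β a| ≤ δ⁻¹ * |a| := by
      intro a
      rw [hβdef]
      simp only
      rw [abs_div, abs_of_pos (hs0 a), div_eq_inv_mul]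
      gcongr
      exact hs a
    have hB : ∀ a : ℝ, |√(a * a + δ * δ) - δ| ≤ δ⁻¹ * (a * a) := by
      intro a
      rw [abs_of_nonneg (sub_nonneg.2 (hs a)), inv_mul_eq_div, le_div_iff₀ hδ]
      nlinarith [hs a, hsq a]
    have hconv : ∀ a b : ℝ, (a - b) * β b ≤ (√(a * a + δ * δ) - δ) - (√(b * b + δ * δ) - δ) := by
      intro a b
      rw [hβdef]
      simp only
      rw [mul_div_assoc', div_le_iff₀ (hs0 b)]
      -- Cauchy–Schwarz for the vectors `(a, δ)` and `(b, δ)`; it expresses the convexity of `√(a² +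
      -- δ²)`.
      have : a * b + δ * δ ≤ √(a * a + δ * δ) * √(b * b + δ * δ) := by
        refine le_of_abs_le (abs_le_of_sq_le_sq ?_
        (mul_nonneg (Real.sqrt_nonneg _) (Real.sqrt_nonneg _)))
        rw [mul_pow, sq √(a * a + δ * δ), sq √(b * b + δ * δ), hsq, hsq]
        nlinarith [sq_nonneg (a * δ - b * δ)]
      nlinarith [hsq b]
    have e := h.integral_comp hl hk hf hβc (by fun_prop) hβ hB hconv
    have hv : MemLp (fun p => β (u p)) 2 (phaseMeasure d) :=
      MemLp.of_le_mul mu (hβc.comp_aestronglyMeasurable mu.1) (Eventually.of_forall fun p => hβ _)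
    have hsf : 0 ≤ scatterForm k u (fun p => β (u p)) := by
      refine hk.scatterForm_nonneg fun p q => ?_
      have h1 := hconv (u p) (u q)
      have h2 := hconv (u q) (u p)
      nlinarith
    have hb1 : ∀ a, |β a| ≤ 1 := by
      intro a
      rw [hβdef]
      simp only
      rw [abs_div, abs_of_pos (hs0 a), div_le_one (hs0 a)]
      exact Real.abs_le_sqrt (by nlinarith [mul_self_nonneg δ])
    have hpos : ∀ a, 0 ≤ a * β a := by
      intro a
      rw [hβdef]
      simp only
      rw [mul_div_assoc']
      exact div_nonneg (mul_self_nonneg a) (hs0 a).le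
    have i1 := integrable_mul_of_memLp_two mu hv
    have h1 : c * ∫ p, u p * β (u p) ∂(phaseMeasure d) ≤
        ∫ p, lam p.1 * u p * β (u p) ∂(phaseMeasure d) := by
      rw [← integral_const_mul]
      refine integral_mono (i1.const_mul c)
        (integrable_mul_of_memLp_two (hl.memLp_mul measurable_fst mu) hv) fun p => ?_
      simp only
      nlinarith [hl.ge p.1, hpos (u p)]
    have h2 : ∫ p, f p * β (u p) ∂(phaseMeasure d) ≤ ∫ p, ‖f p‖ ∂(phaseMeasure d) := by
      refine integral_mono (integrable_mul_of_memLp_two hf hv) hf1.norm fun p => ?_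
      simp only
      refine (le_abs_self _).trans ?_
      rw [abs_mul, Real.norm_eq_abs]
      nlinarith [abs_nonneg (f p), hb1 (u p)]
    have h3 : ∫ p, u p * β (u p) ∂(phaseMeasure d) ≤ c⁻¹ * ∫ p, ‖f p‖ ∂(phaseMeasure d) := by
      rw [inv_mul_eq_div, le_div_iff₀ hc]
      linarith
    rw [← ofReal_integral_eq_lintegral_ofReal i1 (Eventually.of_forall fun p => hpos _)]
    refine (ENNReal.ofReal_le_ofReal h3).trans ?_
    rw [ENNReal.ofReal_mul (by positivity), ofReal_integral_norm_eq_lintegral_enorm hf1,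
      eLpNorm_one_eq_lintegral_enorm]
  have hlim : ∀ a : ℝ, Tendsto (fun n : ℕ => ENNReal.ofReal (a * (a / √(a * a +
      (1 / ((n : ℝ) + 1)) * (1 / ((n : ℝ) + 1)))))) atTop (𝓝 ‖a‖ₑ) := by
    intro a
    have e : ‖a‖ₑ = ENNReal.ofReal (a * (a / √(a * a + 0 * 0))) := by
      rw [← ofReal_norm, Real.norm_eq_abs]
      congr 1
      rw [mul_zero, add_zero, Real.sqrt_mul_self_eq_abs]
      rcases eq_or_ne a 0 with rfl | ha
      · simp
      · rw [mul_div_assoc', eq_div_iff (abs_ne_zero.2 ha), abs_mul_abs_self]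
    rw [e]
    refine (ENNReal.continuous_ofReal.tendsto _).comp ?_
    rcases eq_or_ne a 0 with rfl | ha
    · simp
    · have t := tendsto_one_div_add_atTop_nhds_zero_nat (𝕜 := ℝ)
      have t2 := ((t.mul t).const_add (a * a)).sqrt
      refine (tendsto_const_nhds.div t2 ?_).const_mul a
      rw [mul_zero, add_zero, Real.sqrt_mul_self_eq_abs]
      exact abs_ne_zero.2 ha
  rw [eLpNorm_one_eq_lintegral_enorm]
  have hmeas : ∀ n : ℕ, AEMeasurable (fun p => ENNReal.ofReal (u p * (u p / √(u p * u p +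
      (1 / ((n : ℝ) + 1)) * (1 / ((n : ℝ) + 1)))))) (phaseMeasure d) := by
    intro n
    have := mu.1.aemeasurable
    fun_prop
  -- Fatou as `δ = 1 / (n + 1)` tends to `0`.
  calc ∫⁻ p, ‖u p‖ₑ ∂(phaseMeasure d) = ∫⁻ p, liminf (fun n : ℕ => ENNReal.ofReal (u p *
        (u p / √(u p * u p + (1 / ((n : ℝ) + 1)) * (1 / ((n : ℝ) + 1)))))) atTop
          ∂(phaseMeasure d) :=
        lintegral_congr fun p => (hlim (u p)).liminf_eq.symm
    _ ≤ liminf (fun n : ℕ => ∫⁻ p, ENNReal.ofReal (u p *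
        (u p / √(u p * u p + (1 / ((n : ℝ) + 1)) * (1 / ((n : ℝ) + 1)))))
          ∂(phaseMeasure d)) atTop := lintegral_liminf_le' hmeas
    _ ≤ _ := by
        refine liminf_le_of_frequently_le' (Frequently.of_forall fun n => ?_)
        exact key _ (by positivity)

/-- The weak form of the radiative transfer equation. -/
lemma IsRTESolution.weak_form (hl : IsAbsorption lam c) (hk : IsScatteringKernel k M)
    {f u : Phase d → ℝ} (hf : MemLp f 2 (phaseMeasure d)) (h : IsRTESolution lam k f u)
    {φ : Pos d × Pos d → ℝ} (hφ : IsTest φ) :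
    -∫ p, u p * transport φ p ∂(phaseMeasure d) +
      ∫ p, lam p.1 * u p * onPhase φ p ∂(phaseMeasure d) + scatterForm k u (onPhase φ) =
      ∫ p, f p * onPhase φ p ∂(phaseMeasure d) := by
  obtain ⟨mu, w, mw, hw, eq1⟩ := h
  have hv := hφ.memLp 2
  have ml := hl.memLp_mul measurable_fst mu
  rw [hw φ hφ]
  have h1 : ∫ p, w p * onPhase φ p ∂(phaseMeasure d) =
      ∫ p, collision k u p * onPhase φ p ∂(phaseMeasure d) + ∫ p, f p * onPhase φ p ∂(phaseMeasure d)
      - ∫ p, lam p.1 * u p * onPhase φ p ∂(phaseMeasure d) := by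
    have l3 := integral_lin_comb_three (integrable_mul_of_memLp_two (hk.memLp_collision mu) hv)
      (integrable_mul_of_memLp_two hf hv) (integrable_mul_of_memLp_two ml hv) 1 1 (-1)
    refine Eq.trans (integral_congr_ae ?_) (l3.trans (by ring))
    filter_upwards [eq1] with p hp
    rw [show w p = collision k u p + f p - lam p.1 * u p by linarith]
    ring
  rw [hk.integral_collision_mul mu hv] at h1
  linarith

/-- Test functions as a real vector space. -/
def testSpace (d : ℕ) : Submodule ℝ (Pos d × Pos d → ℝ) where
  carrier := {φ | IsTest φ}
  add_mem' := fun h1 h2 => h1.add h2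
  zero_mem' := IsTest.zero
  smul_mem' := fun c _ h => h.smul c

/-- Lions' lemma with `S` the formal adjoint `-θ·∇ + lam - I`, the collision operator being
self-adjoint. Coercivity holds because transport contributes nothing and collisions contribute with
a good sign. The resulting identity says that `I(u) + f - lam u` is the weak transport derivative of
`u`. -/
lemma exists_isRTESolution (hl : IsAbsorption lam c) (hk : IsScatteringKernel k M)
    {f : Phase d → ℝ} (hf : MemLp f 2 (phaseMeasure d)) : ∃ u, IsRTESolution lam k f u := by
  let H := Lp ℝ 2 (phaseMeasure d)
  -- The formal adjoint applied to a test function.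
  let s : (Pos d × Pos d → ℝ) → Phase d → ℝ := fun φ p =>
    -transport φ p + lam p.1 * onPhase φ p - collision k (onPhase φ) p
  have hs : ∀ φ, IsTest φ → MemLp (s φ) 2 (phaseMeasure d) := fun φ hφ =>
    ((hφ.memLp_transport 2).neg.add (hl.memLp_mul measurable_fst (hφ.memLp 2))).sub
      (hk.memLp_collision (hφ.memLp 2))
  have hadd : ∀ φ ψ, IsTest φ → IsTest ψ → s (φ + ψ) =ᵐ[phaseMeasure d] s φ + s ψ := by
    intro φ ψ hφ hψ
    filter_upwards [hk.collision_add (hφ.memLp 2) (hψ.memLp 2)] with p hp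
    have e : onPhase (φ + ψ) = onPhase φ + onPhase ψ := rfl
    simp only [s, e, Pi.add_apply, transport_add hφ hψ, hp]
    ring
  have hsmul : ∀ (a : ℝ) φ, IsTest φ → s (a • φ) = a • s φ := by
    intro a φ hφ
    funext p
    have e : onPhase (a • φ) = a • onPhase φ := rfl
    simp only [s, e, Pi.smul_apply, transport_smul a hφ, collision_smul, smul_eq_mul]
    ring
  let S : testSpace d →ₗ[ℝ] H :=
    { toFun := fun φ => (hs φ.1 φ.2).toLp (s φ.1)
      map_add' := fun φ ψ => by
        rw [← MemLp.toLp_add]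
        exact MemLp.toLp_congr _ _ (hadd φ.1 ψ.1 φ.2 ψ.2)
      map_smul' := fun a φ => by
        rw [RingHom.id_apply, ← MemLp.toLp_const_smul]
        exact MemLp.toLp_congr _ _ (Eventually.of_forall fun p => congrFun (hsmul a φ.1 φ.2) p) }
  let J : testSpace d →ₗ[ℝ] H :=
    { toFun := fun φ => (φ.2.memLp 2).toLp (onPhase φ.1)
      map_add' := fun φ ψ => by
        rw [← MemLp.toLp_add]
        rfl
      map_smul' := fun a φ => by
        rw [RingHom.id_apply, ← MemLp.toLp_const_smul]
        rfl }
  have hco : ∀ φ, c * ‖J φ‖ ^ 2 ≤ inner ℝ (S φ) (J φ) := by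
    rintro ⟨φ, hφ⟩
    have hφ' : IsTest φ := hφ
    have m := hφ'.memLp 2
    change c * ‖(hφ'.memLp 2).toLp (onPhase φ)‖ ^ 2 ≤
      inner ℝ ((hs φ hφ).toLp (s φ)) ((hφ'.memLp 2).toLp (onPhase φ))
    rw [← integral_mul_eq_inner, ← real_inner_self_eq_norm_sq, ← integral_mul_eq_inner]
    have e : ∫ p, s φ p * onPhase φ p ∂(phaseMeasure d) =
        -∫ p, onPhase φ p * transport φ p ∂(phaseMeasure d) +
        ∫ p, lam p.1 * onPhase φ p * onPhase φ p ∂(phaseMeasure d) -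
        ∫ p, collision k (onPhase φ) p * onPhase φ p ∂(phaseMeasure d) := by
      have i1 := integrable_mul_of_memLp_two m (hφ'.memLp_transport 2)
      have i2 := integrable_mul_of_memLp_two (hl.memLp_mul measurable_fst m) m
      have i3 := integrable_mul_of_memLp_two (hk.memLp_collision m) m
      have l3 := integral_lin_comb_three i1 i2 i3 (-1) 1 (-1)
      refine Eq.trans (integral_congr_ae (Eventually.of_forall fun p => ?_)) (l3.trans (by ring))
      simp only [s]
      ring
    rw [e, integral_test_mul_transport hφ', hk.integral_collision_mul m m]
    have hp : 0 ≤ scatterForm k (onPhase φ) (onPhase φ) :=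
      hk.scatterForm_nonneg fun p q => mul_self_nonneg _
    have h1 : c * ∫ p, onPhase φ p * onPhase φ p ∂(phaseMeasure d) ≤
        ∫ p, lam p.1 * onPhase φ p * onPhase φ p ∂(phaseMeasure d) := by
      rw [← integral_const_mul]
      refine integral_mono ((integrable_mul_of_memLp_two m m).const_mul c)
        (integrable_mul_of_memLp_two (hl.memLp_mul measurable_fst m) m) fun p => ?_
      simp only
      nlinarith [hl.ge p.1, mul_self_nonneg (onPhase φ p)]
    linarith
  obtain ⟨u, hu⟩ := exists_of_coercive_on_tests S J hl.pos hco (hf.toLp f)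
  have mu : MemLp u 2 (phaseMeasure d) := Lp.memLp u
  have mw : MemLp (fun p => collision k u p + f p - lam p.1 * u p) 2 (phaseMeasure d) :=
    ((hk.memLp_collision mu).add hf).sub (hl.memLp_mul measurable_fst mu)
  refine ⟨u, mu, _, mw, fun φ hφ => ?_, Eventually.of_forall fun p => by ring⟩
  have h := hu ⟨φ, hφ⟩
  have m := hφ.memLp 2
  have e : u = mu.toLp u := (Lp.toLp_coeFn u mu).symm
  rw [e] at h
  change inner ℝ (mu.toLp u) ((hs φ hφ).toLp (s φ)) = inner ℝ (hf.toLp f) (m.toLp (onPhase φ)) at h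
  rw [← integral_mul_eq_inner, ← integral_mul_eq_inner] at h
  have i1 := integrable_mul_of_memLp_two mu (hφ.memLp_transport 2)
  have i2 := integrable_mul_of_memLp_two (hl.memLp_mul measurable_fst mu) m
  have i3 := integrable_mul_of_memLp_two (hk.memLp_collision m) mu
  have i4 := integrable_mul_of_memLp_two (hk.memLp_collision mu) m
  have i5 := integrable_mul_of_memLp_two hf m
  have e1 : ∫ p, u p * s φ p ∂(phaseMeasure d) =
      -∫ p, u p * transport φ p ∂(phaseMeasure d) +
      ∫ p, lam p.1 * u p * onPhase φ p ∂(phaseMeasure d) -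
      ∫ p, collision k (onPhase φ) p * u p ∂(phaseMeasure d) := by
    have l3 := integral_lin_comb_three i1 i2 i3 (-1) 1 (-1)
    refine Eq.trans (integral_congr_ae (Eventually.of_forall fun p => ?_)) (l3.trans (by ring))
    simp only [s]
    ring
  have e2 : ∫ p, (collision k u p + f p - lam p.1 * u p) * onPhase φ p ∂(phaseMeasure d) =
      ∫ p, collision k u p * onPhase φ p ∂(phaseMeasure d) +
      ∫ p, f p * onPhase φ p ∂(phaseMeasure d) -
      ∫ p, lam p.1 * u p * onPhase φ p ∂(phaseMeasure d) := by
    have l3 := integral_lin_comb_three i4 i5 i2 1 1 (-1)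
    refine Eq.trans (integral_congr_ae (Eventually.of_forall fun p => ?_)) (l3.trans (by ring))
    simp only
    ring
  rw [e2, hk.integral_collision_mul mu m]
  rw [e1, hk.integral_collision_mul m mu, scatterForm_comm k (onPhase φ) u] at h
  linarith

end RTE

/-! ### Near-identity perturbations of the sphere. -/

section SphereGeometry

variable {d : ℕ}

/-- The direction of a nonzero vector; `θ₀` is the value at `0`. -/
noncomputable def dirOf (θ₀ : Dir d) (y : Pos d) : Dir d :=
  ⟨if y = 0 then (θ₀ : Pos d) else ‖y‖⁻¹ • y, by
    by_cases h : y = 0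
    · simp [h]
    · simp [h, norm_smul]⟩

lemma dirOf_coe (θ₀ : Dir d) {y : Pos d} (h : y ≠ 0) : (dirOf θ₀ y : Pos d) = ‖y‖⁻¹ • y := by
  simp [dirOf, h]

lemma norm_smul_dirOf (θ₀ : Dir d) {y : Pos d} (h : y ≠ 0) : ‖y‖ • (dirOf θ₀ y : Pos d) = y := by
  rw [dirOf_coe θ₀ h, smul_smul, mul_inv_cancel₀ (norm_ne_zero_iff.2 h), one_smul]

lemma measurable_dirOf (θ₀ : Dir d) : Measurable (dirOf θ₀ : Pos d → Dir d) := by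
  refine Measurable.subtype_mk ?_
  exact Measurable.ite (measurableSet_singleton (0 : Pos d)) measurable_const (by fun_prop)

lemma norm_dir (θ : Dir d) : ‖(θ : Pos d)‖ = 1 := by simp

/-- The perturbation `θ ↦ (θ - z) / |θ - z|` of the identity of the sphere. -/
noncomputable def sphereShift (z : Pos d) (θ : Dir d) : Dir d := dirOf θ ((θ : Pos d) - z)

lemma dir_sub_ne_zero {z : Pos d} (hz : ‖z‖ ≤ 1 / 4) (θ : Dir d) : (θ : Pos d) - z ≠ 0 := by
  intro h
  have := norm_dir θ
  rw [sub_eq_zero.1 h] at this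
  linarith

lemma dirOf_sub_eq (θ₀ : Dir d) {z : Pos d} (hz : ‖z‖ ≤ 1 / 4) (θ : Dir d) :
    dirOf θ₀ ((θ : Pos d) - z) = sphereShift z θ := by
  apply Subtype.ext
  rw [sphereShift, dirOf_coe _ (dir_sub_ne_zero hz θ), dirOf_coe _ (dir_sub_ne_zero hz θ)]

lemma measurable_sphereShift :
    Measurable fun p : Pos d × Dir d => sphereShift p.1 p.2 := by
  refine Measurable.subtype_mk ?_
  refine Measurable.ite ?_ (by fun_prop) (by fun_prop)
  have : Measurable fun p : Pos d × Dir d => (p.2 : Pos d) - p.1 := by fun_prop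
  exact this (measurableSet_singleton (0 : Pos d))

lemma norm_dir_sub_bounds {z : Pos d} (hz : ‖z‖ ≤ 1 / 4) (θ : Dir d) :
    3 / 4 ≤ ‖(θ : Pos d) - z‖ ∧ ‖(θ : Pos d) - z‖ ≤ 5 / 4 := by
  have h1 := norm_sub_norm_le (θ : Pos d) z
  have h2 := norm_sub_le (θ : Pos d) z
  rw [norm_dir] at h1 h2
  constructor <;> linarith

lemma sphereShift_zero (θ : Dir d) : sphereShift 0 θ = θ := by
  apply Subtype.ext
  rw [sphereShift, dirOf_coe _ (dir_sub_ne_zero (by simp) θ), sub_zero, norm_dir]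
  simp

lemma dist_sphereShift_le {z : Pos d} (hz : ‖z‖ ≤ 1 / 4) (θ : Dir d) :
    dist (sphereShift z θ) θ ≤ 2 * ‖z‖ := by
  have hne := dir_sub_ne_zero hz θ
  have hb := norm_dir_sub_bounds hz θ
  rw [Subtype.dist_eq, dist_eq_norm]
  set a := (θ : Pos d) - z with ha
  have e : (sphereShift z θ : Pos d) - θ = (1 - ‖a‖) • (sphereShift z θ : Pos d) - z := by
    rw [sub_smul, one_smul, sphereShift, norm_smul_dirOf θ hne]
    simp only [ha]
    abel
  rw [e]
  refine (norm_sub_le _ _).trans ?_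
  rw [norm_smul, norm_dir, mul_one, Real.norm_eq_abs]
  have h1 : |1 - ‖a‖| ≤ ‖z‖ := by
    have := abs_norm_sub_norm_le (θ : Pos d) a
    rw [norm_dir] at this
    simpa [ha] using this
  linarith

lemma norm_dir_sub_sq (θ θ' : Dir d) :
    ‖(θ : Pos d) - θ'‖ ^ 2 = 2 * (1 - inner ℝ (θ : Pos d) (θ' : Pos d)) := by
  rw [norm_sub_sq_real, norm_dir, norm_dir]
  ring

lemma one_sub_inner_nonneg (θ θ' : Dir d) : 0 ≤ 1 - inner ℝ (θ : Pos d) (θ' : Pos d) := by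
  have := norm_dir_sub_sq θ θ'
  nlinarith [sq_nonneg ‖(θ : Pos d) - θ'‖]

/-- With `a`, `a'` the lengths of `θ - z`, `θ' - z`, both in `[3/4, 5/4]`, one has `|θ - θ'|² = (a -
a')² + 2 a a' (1 - t')`. Moreover `|a - a'| ≤ |θ - θ'| / 3`, because `(a - a')(a + a') = -2 (θ -
θ')·z`, `|z| ≤ 1/4` and `a + a' ≥ 3/2`. Hence the angular kernel changes at most by a bounded
factor. -/
lemma one_sub_inner_sphereShift {z : Pos d} (hz : ‖z‖ ≤ 1 / 4) (θ θ' : Dir d) :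
    1 - inner ℝ (θ : Pos d) (θ' : Pos d) ≤
      2 * (1 - inner ℝ (sphereShift z θ : Pos d) (sphereShift z θ' : Pos d)) ∧
    1 - inner ℝ (sphereShift z θ : Pos d) (sphereShift z θ' : Pos d) ≤
      2 * (1 - inner ℝ (θ : Pos d) (θ' : Pos d)) := by
  have b := norm_dir_sub_bounds hz θ
  have b' := norm_dir_sub_bounds hz θ'
  have e := norm_smul_dirOf θ (dir_sub_ne_zero hz θ)
  have e' := norm_smul_dirOf θ' (dir_sub_ne_zero hz θ')
  set a := ‖(θ : Pos d) - z‖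
  set a' := ‖(θ' : Pos d) - z‖
  change a • (sphereShift z θ : Pos d) = _ at e
  change a' • (sphereShift z θ' : Pos d) = _ at e'
  set t := inner ℝ (θ : Pos d) (θ' : Pos d)
  set t' := inner ℝ (sphereShift z θ : Pos d) (sphereShift z θ' : Pos d)
  have h1 : ‖(θ : Pos d) - θ'‖ ^ 2 = (a - a') ^ 2 + 2 * (a * a') * (1 - t') := by
    have : (θ : Pos d) - θ' = a • (sphereShift z θ : Pos d) - a' • (sphereShift z θ' : Pos d) := by
      rw [e, e']; abel
    rw [this, norm_sub_sq_real, norm_smul, norm_smul, norm_dir, norm_dir, real_inner_smul_left,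
      real_inner_smul_right, mul_one, mul_one, Real.norm_eq_abs, Real.norm_eq_abs, sq_abs, sq_abs]
    ring
  have h2 : |a - a'| ≤ 1 / 3 * ‖(θ : Pos d) - θ'‖ := by
    have s1 : a ^ 2 = 1 - 2 * inner ℝ (θ : Pos d) z + ‖z‖ ^ 2 := by
      rw [norm_sub_sq_real, norm_dir]; ring
    have s2 : a' ^ 2 = 1 - 2 * inner ℝ (θ' : Pos d) z + ‖z‖ ^ 2 := by
      rw [norm_sub_sq_real, norm_dir]; ring
    have s3 : (a - a') * (a + a') = -2 * inner ℝ ((θ : Pos d) - θ') z := by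
      rw [inner_sub_left]; linarith [s1, s2, sq (a), sq (a')]
    have s4 := abs_real_inner_le_norm ((θ : Pos d) - θ') z
    have s5 : |a - a'| * (a + a') ≤ 2 * (‖(θ : Pos d) - θ'‖ * ‖z‖) := by
      rw [← abs_of_pos (show 0 < a + a' by linarith), ← abs_mul, s3, abs_mul]
      norm_num
      linarith
    have s6 : ‖(θ : Pos d) - θ'‖ * ‖z‖ ≤ ‖(θ : Pos d) - θ'‖ * (1 / 4) := by gcongr
    nlinarith [abs_nonneg (a - a')]
  have h3 : (a - a') ^ 2 ≤ 1 / 9 * ‖(θ : Pos d) - θ'‖ ^ 2 := by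
    rw [← sq_abs (a - a')]
    nlinarith [abs_nonneg (a - a'), norm_nonneg ((θ : Pos d) - θ')]
  have h4 : a * a' ≤ 25 / 16 := by nlinarith
  have h5 : 0 ≤ 1 - t' := one_sub_inner_nonneg _ _
  have h6 := norm_dir_sub_sq θ θ'
  have h7 : a * a' * (1 - t') ≤ 25 / 16 * (1 - t') := by gcongr
  rw [h6] at h1 h3
  have h8 : t = inner ℝ (θ : Pos d) (θ' : Pos d) := rfl
  rw [← h8] at h1 h3
  have h9 : 9 / 16 ≤ a * a' := by nlinarith
  have h10 : 9 / 16 * (1 - t') ≤ a * a' * (1 - t') := by gcongr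
  have h11 := sq_nonneg (a - a')
  constructor <;> nlinarith

-- Surface measure is, up to the factor `d`, the volume of the cone over a set. The map `y ↦ y - |y|
-- z` sends the cone over the preimage of `A` into `5/4` times the cone over `A`. As a small
-- Lipschitz perturbation of the identity it shrinks volumes by at most a factor `1/2`, so no
-- Jacobian on the sphere has to be computed.
open Pointwise in
lemma exists_map_sphereShift_le (d : ℕ) : ∃ δ : ℝ, 0 < δ ∧ δ ≤ 1 / 4 ∧ ∃ c : ℝ≥0,
    ∀ z : Pos d, ‖z‖ ≤ δ → (dirMeasure d).map (sphereShift z) ≤ c • dirMeasure d := by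
  have h := mul_le_addHaar_image_of_lt_det (volume : Measure (Pos d))
    (ContinuousLinearMap.id ℝ (Pos d)) (m := 1 / 2) (by
      simp only [ContinuousLinearMap.det, ContinuousLinearMap.coe_id, LinearMap.det_id, abs_one,
        ENNReal.ofReal_one]
      rw [← ENNReal.coe_one, ENNReal.coe_lt_coe, ← NNReal.coe_lt_coe]
      norm_num)
  obtain ⟨δ, hδ, hδ0⟩ := (h.and self_mem_nhdsWithin).exists
  have hδ0' : (0 : ℝ) < δ := hδ0
  refine ⟨min δ (1 / 4), by positivity, min_le_right _ _,
    2 * (5 / 4) ^ (Module.finrank ℝ (Pos d)), fun z hz => ?_⟩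
  have hzδ : ‖z‖ ≤ δ := hz.trans (min_le_left _ _)
  have hz4 : ‖z‖ ≤ 1 / 4 := hz.trans (min_le_right _ _)
  have hm : Measurable (sphereShift z : Dir d → Dir d) :=
    measurable_sphereShift.comp (measurable_const.prodMk measurable_id)
  refine Measure.le_iff.2 fun A hA => ?_
  rw [Measure.map_apply hm hA, Measure.smul_apply, Measure.toSphere_apply' _ (hm hA),
    Measure.toSphere_apply' _ hA]
  set S := Ioo (0 : ℝ) 1 • (Subtype.val '' (sphereShift z ⁻¹' A) : Set (Pos d)) with hS
  set S' := Ioo (0 : ℝ) 1 • (Subtype.val '' A : Set (Pos d)) with hS'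
  set f : Pos d → Pos d := fun y => y - ‖y‖ • z with hf
  have happ : ApproximatesLinearOn f (ContinuousLinearMap.id ℝ (Pos d)) S δ := by
    intro x _ y _
    have : f x - f y - (ContinuousLinearMap.id ℝ (Pos d)) (x - y) = -((‖x‖ - ‖y‖) • z) := by
      simp only [hf, ContinuousLinearMap.id_apply, sub_smul]
      abel
    rw [this, norm_neg, norm_smul, mul_comm]
    exact mul_le_mul hzδ (abs_norm_sub_norm_le x y) (norm_nonneg _) δ.2
  have h1 := hδ S f happ
  have h2 : f '' S ⊆ (5 / 4 : ℝ) • S' := by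
    rintro _ ⟨_, ⟨r, hr, _, ⟨θ, hθ, rfl⟩, rfl⟩, rfl⟩
    have hb := norm_dir_sub_bounds hz4 θ
    refine Set.mem_smul_set.2 ⟨(r * ‖(θ : Pos d) - z‖ * (4 / 5)) • (sphereShift z θ : Pos d),
      Set.smul_mem_smul ⟨?_, ?_⟩ ⟨_, hθ, rfl⟩, ?_⟩
    · have := hr.1
      have : 0 < ‖(θ : Pos d) - z‖ := by linarith
      positivity
    · have h1 := hr.1
      have h2 := hr.2
      nlinarith
    · have e := norm_smul_dirOf θ (dir_sub_ne_zero hz4 θ)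
      change ‖(θ : Pos d) - z‖ • (sphereShift z θ : Pos d) = _ at e
      simp only [hf, norm_smul, norm_dir, mul_one, Real.norm_eq_abs, abs_of_pos hr.1]
      rw [smul_smul, show 5 / 4 * (r * ‖(θ : Pos d) - z‖ * (4 / 5)) = r * ‖(θ : Pos d) - z‖ by ring,
        mul_smul, e, smul_sub]
  have h3 := h1.trans (measure_mono h2)
  rw [Measure.addHaar_smul] at h3
  have h4 : volume S ≤ 2 * (ENNReal.ofReal |(5 / 4 : ℝ) ^ Module.finrank ℝ (Pos d)| * volume S') := by
    have h5 : volume S = 2 * (((1 / 2 : ℝ≥0) : ℝ≥0∞) * volume S) := by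
      have h7 : (2 : ℝ≥0∞) * ((1 / 2 : ℝ≥0) : ℝ≥0∞) = 1 := by
        have : ((2 : ℝ≥0) : ℝ≥0∞) * ((1 / 2 : ℝ≥0) : ℝ≥0∞) = 1 := by
          rw [← ENNReal.coe_mul]
          norm_num
        exact this
      rw [← mul_assoc, h7, one_mul]
    rw [h5]
    gcongr
  have h6 : ENNReal.ofReal |(5 / 4 : ℝ) ^ Module.finrank ℝ (Pos d)| =
      (((5 / 4 : ℝ≥0) ^ Module.finrank ℝ (Pos d) : ℝ≥0) : ℝ≥0∞) := by
    rw [abs_of_pos (by positivity), ENNReal.ofReal, Real.toNNReal_pow (by norm_num)]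
    congr 2
    apply NNReal.eq
    rw [Real.coe_toNNReal _ (by norm_num)]
    norm_num
  rw [h6] at h4
  rw [ENNReal.smul_def, smul_eq_mul]
  calc (Module.finrank ℝ (Pos d) : ℝ≥0∞) * volume S
      ≤ (Module.finrank ℝ (Pos d) : ℝ≥0∞) *
        (2 * ((((5 / 4 : ℝ≥0) ^ Module.finrank ℝ (Pos d) : ℝ≥0) : ℝ≥0∞) * volume S')) := by gcongr
    _ = _ := by
      push_cast
      ring

-- Apart from the origin, the part in the ball of radius `2` of the preimage of `A` lies in twice
-- the cone over `A`. This controls radial extensions off the sphere.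
open Pointwise in
lemma map_dirOf_le (θ₀ : Dir d) :
    ((volume : Measure (Pos d)).restrict (Metric.ball 0 2)).map (dirOf θ₀) ≤
      ((2 : ℝ≥0) ^ Module.finrank ℝ (Pos d)) • dirMeasure d := by
  have hne : (θ₀ : Pos d) ≠ 0 := by
    intro h
    have := norm_dir θ₀
    rw [h, norm_zero] at this
    norm_num at this
  have : Nontrivial (Pos d) := ⟨⟨θ₀, 0, hne⟩⟩
  refine Measure.le_iff.2 fun A hA => ?_
  rw [Measure.map_apply (measurable_dirOf θ₀) hA,
    Measure.restrict_apply (measurable_dirOf θ₀ hA), Measure.smul_apply,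
    Measure.toSphere_apply' _ hA]
  set S' := Ioo (0 : ℝ) 1 • (Subtype.val '' A : Set (Pos d)) with hS'
  have h1 : dirOf θ₀ ⁻¹' A ∩ Metric.ball 0 2 ⊆ {0} ∪ (2 : ℝ) • S' := by
    rintro y ⟨hy, hy2⟩
    rcases eq_or_ne y 0 with h0 | h0
    · exact Or.inl h0
    · refine Or.inr (Set.mem_smul_set.2 ⟨(‖y‖ / 2) • (dirOf θ₀ y : Pos d),
        Set.smul_mem_smul ⟨?_, ?_⟩ ⟨_, hy, rfl⟩, ?_⟩)
      · have := norm_pos_iff.2 h0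
        positivity
      · have : ‖y‖ < 2 := by simpa using hy2
        linarith
      · rw [smul_smul, mul_div_cancel₀ _ (by norm_num : (2 : ℝ) ≠ 0), norm_smul_dirOf θ₀ h0]
  refine (measure_mono h1).trans ((measure_union_le _ _).trans ?_)
  rw [measure_singleton, zero_add, Measure.addHaar_smul, abs_of_pos (by positivity),
    ENNReal.ofReal_pow (by norm_num), ENNReal.ofReal_ofNat, ENNReal.smul_def, smul_eq_mul]
  push_cast
  gcongr
  refine le_mul_of_one_le_left zero_le ?_
  exact_mod_cast Nat.one_le_iff_ne_zero.2 (Module.finrank_pos (R := ℝ) (M := Pos d)).ne'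

end SphereGeometry

/-! ### Averages over a family of maps. -/

section Averages

variable {X Z : Type*} [MeasurableSpace X] [MeasurableSpace Z] {μ : Measure X} [SFinite μ]
  {ρ : Measure Z} [IsFiniteMeasure ρ]

lemma map_uncurry_le {T : Z → X → X} (hT : Measurable fun q : Z × X => T q.1 q.2) {c : ℝ≥0}
    (h : ∀ᵐ z ∂ρ, μ.map (T z) ≤ c • μ) :
    (ρ.prod μ).map (fun q => T q.1 q.2) ≤ ((ρ univ).toNNReal * c) • μ := by
  refine Measure.le_iff.2 fun A hA => ?_
  rw [Measure.map_apply hT hA, Measure.prod_apply (hT hA)]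
  calc ∫⁻ z, μ (Prod.mk z ⁻¹' ((fun q : Z × X => T q.1 q.2) ⁻¹' A)) ∂ρ
      ≤ ∫⁻ _, c * μ A ∂ρ := by
        refine lintegral_mono_ae ?_
        filter_upwards [h] with z hz
        have := hz A
        rw [Measure.map_apply (show Measurable (T z) from hT.comp measurable_prodMk_left) hA] at this
        exact this
    _ = _ := by
        rw [lintegral_const, Measure.smul_apply, ENNReal.smul_def, smul_eq_mul, ENNReal.coe_mul,
          ENNReal.coe_toNNReal (measure_ne_top _ _)]
        ring

lemma memLp_uncurry_comp {T : Z → X → X} (hT : Measurable fun q : Z × X => T q.1 q.2) {c : ℝ≥0}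
    (h : ∀ᵐ z ∂ρ, μ.map (T z) ≤ c • μ) {f : X → ℝ} (hf : MemLp f 2 μ) :
    MemLp (fun q : Z × X => f (T q.1 q.2)) 2 (ρ.prod μ) :=
  (memLp_comp_of_map_le hT (map_uncurry_le hT h) hf).1

lemma memLp_snd {f : X → ℝ} (hf : MemLp f 2 μ) :
    MemLp (fun q : Z × X => f q.2) 2 (ρ.prod μ) :=
  memLp_uncurry_comp (T := fun _ x => x) measurable_snd (c := 1)
    (Eventually.of_forall fun _ => by rw [one_smul]; exact Measure.map_id.le) hf

/-- Averages of pairings are pairings with averages. -/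
lemma integral_average_mul {F : Z × X → ℝ} (hF : MemLp F 2 (ρ.prod μ)) {G : X → ℝ}
    (hG : MemLp G 2 μ) {a : Z → ℝ} (ha : Measurable a) {A : ℝ} (hA : ∀ z, |a z| ≤ A) :
    Integrable (fun z => a z * ∫ x, G x * F (z, x) ∂μ) ρ ∧
      ∫ z, a z * ∫ x, G x * F (z, x) ∂μ ∂ρ = ∫ x, G x * ∫ z, a z * F (z, x) ∂ρ ∂μ := by
  have h1 : MemLp (fun q : Z × X => a q.1 * F q) 2 (ρ.prod μ) :=
    memLp_two_mul_of_bound hF (ha.comp measurable_fst).aestronglyMeasurable fun q => hA q.1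
  have h2 : Integrable (fun q : Z × X => G q.2 * (a q.1 * F q)) (ρ.prod μ) :=
    integrable_mul_of_memLp_two (memLp_snd hG) h1
  have e : ∀ z, a z * ∫ x, G x * F (z, x) ∂μ = ∫ x, G x * (a z * F (z, x)) ∂μ := by
    intro z
    rw [← integral_const_mul]
    congr 1
    funext x
    ring
  simp_rw [e]
  refine ⟨h2.integral_prod_left, ?_⟩
  rw [integral_integral_swap h2]
  simp_rw [integral_const_mul]

end Averages

/-! ### The weighted jump and its behaviour under sphere shifts. -/

section FracJump

variable {d : ℕ}

/-- The angular difference weighted with the square root of the kernel, so that the energy of `u`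
is half the square of the `L²` norm of `fracJump s u`. -/
noncomputable def fracJump (s : ℝ) (u : Phase d → ℝ) (q : Pos d × (Dir d × Dir d)) : ℝ :=
  √(angKernel s q.2.1 q.2.2) * jump u q

lemma fracLapConst_pos {d : ℕ} (hd : 2 ≤ d) {s : ℝ} (h0 : 0 < s) (h1 : s < 1) :
    0 < fracLapConst ((d : ℝ) - 1) s := by
  have hd' : (2 : ℝ) ≤ d := by exact_mod_cast hd
  have g1 : 0 < Real.Gamma (((d : ℝ) - 1) / 2 + s) := Real.Gamma_pos_of_pos (by linarith)
  have g2 : 0 < Real.Gamma (1 - s) := Real.Gamma_pos_of_pos (by linarith)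
  have := Real.pi_pos
  unfold fracLapConst
  positivity

/-- The constant in `angKernel`. -/
noncomputable def angConst (d : ℕ) (s : ℝ) : ℝ :=
  fracLapConst ((d : ℝ) - 1) s * 2 ^ (s - ((d : ℝ) - 1) / 2)

lemma angConst_pos {d : ℕ} (hd : 2 ≤ d) {s : ℝ} (h0 : 0 < s) (h1 : s < 1) : 0 < angConst d s :=
  mul_pos (fracLapConst_pos hd h0 h1) (by positivity)

lemma angExp_pos {d : ℕ} (hd : 2 ≤ d) {s : ℝ} (h0 : 0 < s) : 0 < ((d : ℝ) - 1) / 2 + s := by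
  have hd' : (2 : ℝ) ≤ d := by exact_mod_cast hd
  linarith

lemma angKernel_eq (s : ℝ) (a b : Dir d) : angKernel s a b =
    angConst d s / (1 - inner ℝ (a : Pos d) (b : Pos d)) ^ (((d : ℝ) - 1) / 2 + s) := by
  rw [angKernel, angConst, real_inner_comm]

lemma angKernel_nonneg (hd : 2 ≤ d) {s : ℝ} (h0 : 0 < s) (h1 : s < 1) (a b : Dir d) :
    0 ≤ angKernel s a b := by
  rw [angKernel_eq]
  exact div_nonneg (angConst_pos hd h0 h1).le (Real.rpow_nonneg (one_sub_inner_nonneg a b) _)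

lemma measurable_angKernel (s : ℝ) :
    Measurable fun q : Dir d × Dir d => angKernel s q.1 q.2 := by
  unfold angKernel
  fun_prop

lemma one_sub_inner_pos {a b : Dir d} (h : a ≠ b) :
    0 < 1 - inner ℝ (a : Pos d) (b : Pos d) := by
  have h1 := norm_dir_sub_sq a b
  have h2 : 0 < ‖(a : Pos d) - b‖ := norm_pos_iff.2 (sub_ne_zero.2 fun h' => h (Subtype.ext h'))
  nlinarith [pow_pos h2 2]

lemma angKernel_pos (hd : 2 ≤ d) {s : ℝ} (h0 : 0 < s) (h1 : s < 1) {a b : Dir d} (h : a ≠ b) :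
    0 < angKernel s a b := by
  rw [angKernel_eq]
  exact div_pos (angConst_pos hd h0 h1) (Real.rpow_pos_of_pos (one_sub_inner_pos h) _)

lemma aestronglyMeasurable_fracJump (s : ℝ) {u : Phase d → ℝ}
    (hu : AEStronglyMeasurable u (phaseMeasure d)) :
    AEStronglyMeasurable (fracJump s u) (pairMeasure d) :=
  (Measurable.aestronglyMeasurable
    ((measurable_angKernel s).comp measurable_snd).sqrt).mul (aestronglyMeasurable_jump hu)

lemma fracJump_sub (s : ℝ) (u v : Phase d → ℝ) :
    fracJump s (u - v) = fracJump s u - fracJump s v := by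
  funext q
  simp only [fracJump, jump, Pi.sub_apply]
  ring

/-- The ratio of the square roots of the kernel before and after `sphereShift`. -/
noncomputable def shiftRatio (s : ℝ) (z : Pos d) (q : Dir d × Dir d) : ℝ :=
  √(angKernel s q.1 q.2) / √(angKernel s (sphereShift z q.1) (sphereShift z q.2))

lemma measurable_shiftRatio (s : ℝ) :
    Measurable fun r : Pos d × (Dir d × Dir d) => shiftRatio s r.1 r.2 := by
  unfold shiftRatio
  have h1 : Measurable fun r : Pos d × (Dir d × Dir d) => sphereShift r.1 r.2.1 :=
    measurable_sphereShift.comp (by fun_prop : Measurable fun r : Pos d × (Dir d × Dir d) =>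
      (r.1, r.2.1))
  have h2 : Measurable fun r : Pos d × (Dir d × Dir d) => sphereShift r.1 r.2.2 :=
    measurable_sphereShift.comp (by fun_prop : Measurable fun r : Pos d × (Dir d × Dir d) =>
      (r.1, r.2.2))
  have h3 := (measurable_angKernel (d := d) s).comp (h1.prodMk h2)
  have h4 : Measurable fun r : Pos d × (Dir d × Dir d) => angKernel s r.2.1 r.2.2 :=
    (measurable_angKernel (d := d) s).comp measurable_snd
  exact h4.sqrt.div h3.sqrt

lemma sphereShift_ne (z : Pos d) (hz : ‖z‖ ≤ 1 / 4) {a b : Dir d} (h : a ≠ b) :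
    sphereShift z a ≠ sphereShift z b := by
  intro h'
  have h1 := (one_sub_inner_sphereShift hz a b).1
  have h2 := one_sub_inner_pos h
  rw [h', real_inner_self_eq_norm_sq, norm_dir] at h1
  linarith

lemma shiftRatio_mul (hd : 2 ≤ d) {s : ℝ} (h0 : 0 < s) (h1 : s < 1) {z : Pos d} (hz : ‖z‖ ≤ 1 / 4)
    {a b : Dir d} (h : a ≠ b) :
    √(angKernel s a b) =
      shiftRatio s z (a, b) * √(angKernel s (sphereShift z a) (sphereShift z b)) := by
  rw [shiftRatio, div_mul_cancel₀]
  exact (Real.sqrt_pos.2 (angKernel_pos hd h0 h1 (sphereShift_ne z hz h))).ne'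

/-- Off the diagonal, `1 - t' ≤ 2 (1 - t)` raised to the kernel's exponent. On the diagonal the
kernel is `0`, by division by zero. -/
lemma abs_shiftRatio_le (hd : 2 ≤ d) {s : ℝ} (h0 : 0 < s) (h1 : s < 1) {z : Pos d}
    (hz : ‖z‖ ≤ 1 / 4) (q : Dir d × Dir d) :
    |shiftRatio s z q| ≤ √(2 ^ (((d : ℝ) - 1) / 2 + s)) := by
  obtain ⟨a, b⟩ := q
  rw [shiftRatio, abs_of_nonneg (div_nonneg (Real.sqrt_nonneg _) (Real.sqrt_nonneg _))]
  have hp := angExp_pos hd h0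
  rcases eq_or_ne a b with rfl | hab
  · have : angKernel s a a = 0 := by
      rw [angKernel_eq, real_inner_self_eq_norm_sq, norm_dir]
      simp [Real.zero_rpow hp.ne']
    simp [this]
  · have k2 := angKernel_pos hd h0 h1 (sphereShift_ne z hz hab)
    rw [div_le_iff₀ (Real.sqrt_pos.2 k2), ← Real.sqrt_mul (by positivity)]
    refine Real.sqrt_le_sqrt ?_
    simp only
    rw [angKernel_eq, angKernel_eq]
    have p1 := one_sub_inner_pos hab
    have p2 := one_sub_inner_pos (sphereShift_ne z hz hab)
    have hle := (one_sub_inner_sphereShift hz a b).2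
    have hc := angConst_pos hd h0 h1
    rw [mul_div_assoc', div_le_div_iff₀ (Real.rpow_pos_of_pos p1 _) (Real.rpow_pos_of_pos p2 _)]
    have h3 := Real.rpow_le_rpow p2.le hle hp.le
    rw [Real.mul_rpow (by norm_num) p1.le] at h3
    nlinarith

lemma tendsto_shiftRatio (hd : 2 ≤ d) {s : ℝ} (h0 : 0 < s) (h1 : s < 1) {a b : Dir d}
    (h : a ≠ b) : Tendsto (fun z => shiftRatio s z (a, b)) (𝓝 0) (𝓝 1) := by
  have ht : ∀ θ : Dir d, Tendsto (fun z => (sphereShift z θ : Pos d)) (𝓝 0) (𝓝 (θ : Pos d)) := by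
    intro θ
    rw [tendsto_iff_dist_tendsto_zero]
    have h2 : Tendsto (fun z : Pos d => 2 * ‖z‖) (𝓝 0) (𝓝 0) := by
      have := (continuous_norm (E := Pos d)).tendsto 0 |>.const_mul 2
      simpa using this
    refine squeeze_zero' (Eventually.of_forall fun _ => dist_nonneg) ?_ h2
    filter_upwards [Metric.closedBall_mem_nhds (0 : Pos d) (by norm_num : (0 : ℝ) < 1 / 4)] with z hz
    have := dist_sphereShift_le (z := z) (by simpa using hz) θ
    rwa [Subtype.dist_eq] at this
  have hK : Tendsto (fun z => angKernel s (sphereShift z a) (sphereShift z b)) (𝓝 0)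
      (𝓝 (angKernel s a b)) := by
    simp only [angKernel_eq]
    have hin := ((ht a).inner (𝕜 := ℝ) (ht b)).const_sub 1
    refine tendsto_const_nhds.div (hin.rpow_const (Or.inl (one_sub_inner_pos h).ne')) ?_
    exact (Real.rpow_pos_of_pos (one_sub_inner_pos h) _).ne'
  have hpos := Real.sqrt_pos.2 (angKernel_pos hd h0 h1 h)
  have h2 : Tendsto (fun z => shiftRatio s z (a, b)) (𝓝 0)
      (𝓝 (√(angKernel s a b) / √(angKernel s a b))) :=
    tendsto_const_nhds.div hK.sqrt hpos.ne'
  rwa [div_self hpos.ne'] at h2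

end FracJump

/-! ### Shifts of phase space. -/

section PhaseShift

variable {d : ℕ}

/-- The perturbation `(x, θ) ↦ (x - z', Φ_z θ)` of the identity of phase space. -/
noncomputable def phaseShift (ζ : Pos d × Pos d) (p : Phase d) : Phase d :=
  (p.1 - ζ.1, sphereShift ζ.2 p.2)

/-- The version of `phaseShift` with two directions. -/
noncomputable def pairShift (ζ : Pos d × Pos d) (q : Pos d × (Dir d × Dir d)) :
    Pos d × (Dir d × Dir d) :=
  (q.1 - ζ.1, (sphereShift ζ.2 q.2.1, sphereShift ζ.2 q.2.2))

lemma measurable_phaseShift :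
    Measurable fun r : (Pos d × Pos d) × Phase d => phaseShift r.1 r.2 := by
  unfold phaseShift
  have h1 : Measurable fun r : (Pos d × Pos d) × Phase d => sphereShift r.1.2 r.2.2 :=
    measurable_sphereShift.comp (by fun_prop : Measurable fun r : (Pos d × Pos d) × Phase d =>
      (r.1.2, r.2.2))
  exact Measurable.prodMk (by fun_prop) h1

lemma measurable_pairShift :
    Measurable fun r : (Pos d × Pos d) × (Pos d × (Dir d × Dir d)) => pairShift r.1 r.2 := by
  unfold pairShift
  have h1 : Measurable fun r : (Pos d × Pos d) × (Pos d × (Dir d × Dir d)) =>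
      sphereShift r.1.2 r.2.2.1 :=
    measurable_sphereShift.comp (by fun_prop :
      Measurable fun r : (Pos d × Pos d) × (Pos d × (Dir d × Dir d)) => (r.1.2, r.2.2.1))
  have h2 : Measurable fun r : (Pos d × Pos d) × (Pos d × (Dir d × Dir d)) =>
      sphereShift r.1.2 r.2.2.2 :=
    measurable_sphereShift.comp (by fun_prop :
      Measurable fun r : (Pos d × Pos d) × (Pos d × (Dir d × Dir d)) => (r.1.2, r.2.2.2))
  exact Measurable.prodMk (by fun_prop) (h1.prodMk h2)

lemma smul_prod_nnreal {α β : Type*} [MeasurableSpace α] [MeasurableSpace β] (c c' : ℝ≥0)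
    (μ : Measure α) (ν : Measure β) [SFinite μ] [SFinite ν] :
    (c • μ).prod (c' • ν) = (c * c') • μ.prod ν := by
  change ((c : ℝ≥0∞) • μ).prod ((c' : ℝ≥0∞) • ν) = _
  rw [Measure.prod_smul_left, Measure.prod_smul_right, smul_smul, ← ENNReal.coe_mul]
  rfl

lemma map_sub_right_volume (z : Pos d) :
    (volume : Measure (Pos d)).map (fun x => x - z) = volume :=
  (measurePreserving_sub_right volume z).map_eq

lemma measurable_sphereShift_right (z : Pos d) : Measurable (sphereShift z : Dir d → Dir d) :=
  measurable_sphereShift.comp (measurable_const.prodMk measurable_id)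

lemma map_phaseShift_le {c : ℝ≥0} {ζ : Pos d × Pos d}
    (h : (dirMeasure d).map (sphereShift ζ.2) ≤ c • dirMeasure d) :
    (phaseMeasure d).map (phaseShift ζ) ≤ c • phaseMeasure d := by
  have e : (phaseShift ζ : Phase d → Phase d) =
      Prod.map (fun x => x - ζ.1) (sphereShift ζ.2) := rfl
  rw [e, ← Measure.map_prod_map _ _ (by fun_prop) (measurable_sphereShift_right _),
    map_sub_right_volume]
  refine (Measure.prod_mono le_rfl h).trans (le_of_eq ?_)
  have := smul_prod_nnreal 1 c (volume : Measure (Pos d)) (dirMeasure d)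
  rwa [one_smul, one_mul] at this

lemma map_pairShift_le {c : ℝ≥0} {ζ : Pos d × Pos d}
    (h : (dirMeasure d).map (sphereShift ζ.2) ≤ c • dirMeasure d) :
    (pairMeasure d).map (pairShift ζ) ≤ (c * c) • pairMeasure d := by
  have e : (pairShift ζ : Pos d × (Dir d × Dir d) → _) =
      Prod.map (fun x => x - ζ.1) (Prod.map (sphereShift ζ.2) (sphereShift ζ.2)) := rfl
  have hm := measurable_sphereShift_right (d := d) ζ.2
  rw [e, ← Measure.map_prod_map _ _ (by fun_prop) (hm.prodMap hm),
    ← Measure.map_prod_map _ _ hm hm, map_sub_right_volume]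
  refine (Measure.prod_mono le_rfl (Measure.prod_mono h h)).trans (le_of_eq ?_)
  rw [smul_prod_nnreal]
  have := smul_prod_nnreal 1 (c * c) (volume : Measure (Pos d))
    ((dirMeasure d).prod (dirMeasure d))
  rwa [one_smul, one_mul] at this

lemma phaseShift_zero (p : Phase d) : phaseShift 0 p = p := by
  simp [phaseShift, sphereShift_zero]

lemma dist_phaseShift_le {ζ : Pos d × Pos d} (h : ‖ζ‖ ≤ 1 / 4) (p : Phase d) :
    dist (phaseShift ζ p) p ≤ 2 * ‖ζ‖ := by
  have h1 := norm_fst_le ζ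
  have h2 := norm_snd_le ζ
  have h3 := dist_sphereShift_le (h2.trans h) p.2
  rw [Prod.dist_eq]
  refine max_le ?_ ?_
  · simp only [phaseShift, dist_self_sub_left]
    linarith [norm_nonneg ζ]
  · exact h3.trans (by linarith)

lemma dist_pairShift_le {ζ : Pos d × Pos d} (h : ‖ζ‖ ≤ 1 / 4) (q : Pos d × (Dir d × Dir d)) :
    dist (pairShift ζ q) q ≤ 2 * ‖ζ‖ := by
  have h1 := norm_fst_le ζ
  have h2 := norm_snd_le ζ
  have h3 := dist_sphereShift_le (h2.trans h) q.2.1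
  have h4 := dist_sphereShift_le (h2.trans h) q.2.2
  rw [Prod.dist_eq, Prod.dist_eq]
  refine max_le ?_ (max_le (h3.trans (by linarith)) (h4.trans (by linarith)))
  simp only [pairShift, dist_self_sub_left]
  linarith [norm_nonneg ζ]

/-- The jump of a shifted function is the shifted jump, and `shiftRatio` corrects the kernel; on the
diagonal both sides vanish. Weighted jumps of averages of shifts are thereby averages of shifted
weighted jumps. -/
lemma fracJump_phaseShift (hd : 2 ≤ d) {s : ℝ} (h0 : 0 < s) (h1 : s < 1) {ζ : Pos d × Pos d}
    (h : ‖ζ‖ ≤ 1 / 4) (v : Phase d → ℝ) (q : Pos d × (Dir d × Dir d)) :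
    fracJump s (fun p => v (phaseShift ζ p)) q =
      shiftRatio s ζ.2 q.2 * fracJump s v (pairShift ζ q) := by
  obtain ⟨x, a, b⟩ := q
  rcases eq_or_ne a b with rfl | hab
  · simp [fracJump, jump, pairShift]
  · have := shiftRatio_mul hd h0 h1 ((norm_snd_le ζ).trans h) hab
    simp only [fracJump, jump, pairShift, phaseShift]
    rw [this]
    ring

end PhaseShift

/-! ### Weak density of test functions in the energy space. -/

section Density

variable {d : ℕ}

lemma nonempty_dir (hd : 2 ≤ d) : Nonempty (Dir d) :=
  ⟨⟨EuclideanSpace.single ⟨0, by omega⟩ 1, by simp⟩⟩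

lemma memLp_phaseShift {c : ℝ≥0} {ζ : Pos d × Pos d}
    (h : (dirMeasure d).map (sphereShift ζ.2) ≤ c • dirMeasure d) {v : Phase d → ℝ}
    (hv : MemLp v 2 (phaseMeasure d)) :
    MemLp (fun p => v (phaseShift ζ p)) 2 (phaseMeasure d) :=
  (memLp_comp_of_map_le (measurable_phaseShift.comp measurable_prodMk_left)
    (map_phaseShift_le h) hv).1

lemma memLp_pairShift {c : ℝ≥0} {ζ : Pos d × Pos d}
    (h : (dirMeasure d).map (sphereShift ζ.2) ≤ c • dirMeasure d)
    {w : Pos d × (Dir d × Dir d) → ℝ} (hw : MemLp w 2 (pairMeasure d)) :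
    MemLp (fun p => w (pairShift ζ p)) 2 (pairMeasure d) :=
  (memLp_comp_of_map_le (measurable_pairShift.comp measurable_prodMk_left)
    (map_pairShift_le h) hw).1

lemma tendsto_two_mul_norm {E : Type*} [NormedAddCommGroup E] :
    Tendsto (fun ζ : E => 2 * ‖ζ‖) (𝓝 0) (𝓝 0) := by
  have := ((continuous_norm (E := E)).tendsto 0).const_mul 2
  simpa using this

/-- Pairings with shifted functions depend continuously on the shift at `0`. -/
lemma continuousAt_pairing_shift (hd : 2 ≤ d) {s : ℝ} (h0 : 0 < s) (h1 : s < 1) {δ : ℝ}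
    (hδ : 0 < δ) (hδ4 : δ ≤ 1 / 4) {c : ℝ≥0}
    (hc : ∀ z : Pos d, ‖z‖ ≤ δ → (dirMeasure d).map (sphereShift z) ≤ c • dirMeasure d)
    {G₁ : Phase d → ℝ} {G₂ : Pos d × (Dir d × Dir d) → ℝ} (hG₁ : MemLp G₁ 2 (phaseMeasure d))
    (hG₂ : MemLp G₂ 2 (pairMeasure d)) {v : Phase d → ℝ} (hv : MemLp v 2 (phaseMeasure d))
    (hDv : MemLp (fracJump s v) 2 (pairMeasure d)) :
    ContinuousAt (fun ζ : Pos d × Pos d => ∫ p, G₁ p * v (phaseShift ζ p) ∂(phaseMeasure d) +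
      ∫ q, G₂ q * (shiftRatio s ζ.2 q.2 * fracJump s v (pairShift ζ q)) ∂(pairMeasure d)) 0 := by
  have hball : ∀ᶠ ζ : Pos d × Pos d in 𝓝 0, ‖ζ‖ ≤ δ := by
    filter_upwards [Metric.closedBall_mem_nhds (0 : Pos d × Pos d) hδ] with ζ hζ
    simpa using hζ
  have hcζ : ∀ {ζ : Pos d × Pos d}, ‖ζ‖ ≤ δ →
      (dirMeasure d).map (sphereShift ζ.2) ≤ c • dirMeasure d :=
    fun hζ => hc _ ((norm_snd_le _).trans hζ)
  refine ContinuousAt.add ?_ ?_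
  · have t1 : Tendsto (fun ζ : Pos d × Pos d =>
        eLpNorm (fun p => v (phaseShift ζ p) - v p) 2 (phaseMeasure d)) (𝓝 0) (𝓝 0) := by
      refine tendsto_eLpNorm_comp_sub (c := c) ?_ tendsto_two_mul_norm ?_ hv
      · filter_upwards [hball] with ζ hζ
        exact ⟨measurable_phaseShift.comp measurable_prodMk_left, map_phaseShift_le (hcζ hζ)⟩
      · filter_upwards [hball] with ζ hζ
        exact dist_phaseShift_le (hζ.trans hδ4)
    have := tendsto_integral_mul_of_tendsto_eLpNorm (F := fun ζ p => v (phaseShift ζ p))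
      (hball.mono fun ζ hζ => memLp_phaseShift (hcζ hζ) hv) hv hG₁ t1
    rw [ContinuousAt]
    simp only [phaseShift_zero]
    simpa only [mul_comm] using this
  · set w := fracJump s v with hw
    have t2 : Tendsto (fun ζ : Pos d × Pos d =>
        eLpNorm (fun q => w (pairShift ζ q) - w q) 2 (pairMeasure d)) (𝓝 0) (𝓝 0) := by
      refine tendsto_eLpNorm_comp_sub (c := c * c) ?_ tendsto_two_mul_norm ?_ hDv
      · filter_upwards [hball] with ζ hζ
        exact ⟨measurable_pairShift.comp measurable_prodMk_left, map_pairShift_le (hcζ hζ)⟩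
      · filter_upwards [hball] with ζ hζ
        exact dist_pairShift_le (hζ.trans hδ4)
    set A := √(2 ^ (((d : ℝ) - 1) / 2 + s)) with hA
    have hbd : ∀ {ζ : Pos d × Pos d}, ‖ζ‖ ≤ δ → ∀ q : Pos d × (Dir d × Dir d),
        |shiftRatio s ζ.2 q.2| ≤ A :=
      fun hζ q => abs_shiftRatio_le hd h0 h1 ((norm_snd_le _).trans (hζ.trans hδ4)) q.2
    have hms : ∀ ζ : Pos d × Pos d, AEStronglyMeasurable
        (fun q : Pos d × (Dir d × Dir d) => shiftRatio s ζ.2 q.2) (pairMeasure d) := fun ζ =>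
      ((measurable_shiftRatio s).comp (by fun_prop :
        Measurable fun q : Pos d × (Dir d × Dir d) => (ζ.2, q.2))).aestronglyMeasurable
    have hmem : ∀ {ζ : Pos d × Pos d}, ‖ζ‖ ≤ δ →
        MemLp (fun q : Pos d × (Dir d × Dir d) => shiftRatio s ζ.2 q.2 * G₂ q) 2 (pairMeasure d) :=
      fun {ζ} hζ => memLp_two_mul_of_bound hG₂ (hms ζ) (hbd hζ)
    -- The ratio tends to `1` only pointwise. Attached to `G₂` it gives a bounded family whose
    -- pairing with `w` converges by domination, and it then meets the strongly convergent `w ∘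
    -- pairShift`.
    have hweak : Tendsto (fun ζ : Pos d × Pos d =>
        ∫ q, (shiftRatio s ζ.2 q.2 * G₂ q) * w q ∂(pairMeasure d)) (𝓝 0)
        (𝓝 (∫ q, G₂ q * w q ∂(pairMeasure d))) := by
      refine tendsto_integral_filter_of_dominated_convergence (fun q => A * |G₂ q * w q|)
        (Eventually.of_forall fun ζ => ((hms ζ).mul hG₂.1).mul hDv.1) ?_
        ((integrable_mul_of_memLp_two hG₂ hDv).abs.const_mul A) ?_
      · filter_upwards [hball] with ζ hζ
        refine Eventually.of_forall fun q => ?_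
        rw [mul_assoc, norm_mul]
        exact mul_le_mul_of_nonneg_right (hbd hζ q) (norm_nonneg _)
      · refine Eventually.of_forall fun q => ?_
        obtain ⟨x, a, b⟩ := q
        rcases eq_or_ne a b with rfl | hab
        · simp [hw, fracJump, jump]
        · have h3 : Tendsto (fun ζ : Pos d × Pos d => shiftRatio s ζ.2 (a, b)) (𝓝 0) (𝓝 1) :=
            (tendsto_shiftRatio hd h0 h1 hab).comp (continuous_snd.tendsto' 0 0 rfl)
          have h4 := (h3.mul_const (G₂ (x, (a, b)))).mul_const (w (x, (a, b)))
          rwa [one_mul] at h4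
    have := tendsto_integral_mul_of_weak_of_strong (l := 𝓝 (0 : Pos d × Pos d))
      (F := fun ζ q => shiftRatio s ζ.2 q.2 * G₂ q) (G := fun ζ q => w (pairShift ζ q))
      (C := (ENNReal.ofReal A * eLpNorm G₂ 2 (pairMeasure d)).toNNReal)
      (hball.mono fun ζ hζ => hmem hζ) (hball.mono fun ζ hζ => by
        rw [ENNReal.coe_toNNReal (ENNReal.mul_ne_top ENNReal.ofReal_ne_top hG₂.2.ne)]
        exact eLpNorm_two_mul_le_of_bound (hbd hζ))
      (hball.mono fun ζ hζ => memLp_pairShift (hcζ hζ) hDv) hDv hweak t2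
    rw [ContinuousAt]
    have e0 : ∫ q, G₂ q * (shiftRatio s (0 : Pos d × Pos d).2 q.2 * w (pairShift 0 q))
        ∂(pairMeasure d) = ∫ q, G₂ q * w q ∂(pairMeasure d) := by
      refine integral_congr_ae (Eventually.of_forall fun q => ?_)
      simp only
      rw [hw, ← fracJump_phaseShift hd h0 h1 (by simp) v q]
      simp only [phaseShift_zero]
    rw [e0]
    refine this.congr fun ζ => integral_congr_ae (Eventually.of_forall fun q => ?_)
    simp only
    ring

lemma integrable_radial_extension (θ₀ : Dir d) {v : Phase d → ℝ}
    (hv : Integrable v (phaseMeasure d)) :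
    Integrable ((univ ×ˢ Metric.ball (0 : Pos d) 2).indicator
      (fun z : Pos d × Pos d => v (z.1, dirOf θ₀ z.2)))
      ((volume : Measure (Pos d)).prod (volume : Measure (Pos d))) := by
  rw [integrable_indicator_iff (MeasurableSet.univ.prod Metric.isOpen_ball.measurableSet),
    IntegrableOn, ← Measure.prod_restrict, Measure.restrict_univ]
  have hm : Measurable fun z : Pos d × Pos d => ((z.1, dirOf θ₀ z.2) : Phase d) :=
    measurable_fst.prodMk ((measurable_dirOf θ₀).comp measurable_snd)
  have hle : ((volume : Measure (Pos d)).prod (volume.restrict (Metric.ball (0 : Pos d) 2))).map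
      (fun z : Pos d × Pos d => ((z.1, dirOf θ₀ z.2) : Phase d)) ≤
      ((2 : ℝ≥0) ^ Module.finrank ℝ (Pos d)) • phaseMeasure d := by
    have e : (fun z : Pos d × Pos d => ((z.1, dirOf θ₀ z.2) : Phase d)) =
        Prod.map id (dirOf θ₀) := rfl
    rw [e, ← Measure.map_prod_map _ _ measurable_id (measurable_dirOf θ₀), Measure.map_id]
    refine (Measure.prod_mono le_rfl (map_dirOf_le θ₀)).trans (le_of_eq ?_)
    have := smul_prod_nnreal 1 ((2 : ℝ≥0) ^ Module.finrank ℝ (Pos d)) (volume : Measure (Pos d))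
      (dirMeasure d)
    rwa [one_smul, one_mul] at this
  have h1 : Integrable v (((volume : Measure (Pos d)).prod
      (volume.restrict (Metric.ball (0 : Pos d) 2))).map
      (fun z : Pos d × Pos d => ((z.1, dirOf θ₀ z.2) : Phase d))) :=
    Integrable.of_measure_le_smul (c := (((2 : ℝ≥0) ^ Module.finrank ℝ (Pos d) : ℝ≥0) : ℝ≥0∞))
      ENNReal.coe_ne_top hle hv
  exact h1.comp_measurable hm

/-- Convolving the radial extension of `v` with a bump in `ℝ^d × ℝ^d` gives a genuine test function.
On phase space it is the bump average of `v ∘ phaseShift ζ`, and its weighted jump is an average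
too. By Fubini the hypothesis says that bump averages of the pairing with the shifted `v` vanish,
and the pairing is continuous at `ζ = 0`. Bounded support in `x` makes the extension integrable and
compactly supported. -/
lemma pairing_eq_zero_of_bounded_support (hd : 2 ≤ d) {s : ℝ} (h0 : 0 < s) (h1 : s < 1)
    {G₁ : Phase d → ℝ} {G₂ : Pos d × (Dir d × Dir d) → ℝ} (hG₁ : MemLp G₁ 2 (phaseMeasure d))
    (hG₂ : MemLp G₂ 2 (pairMeasure d))
    (h : ∀ φ, IsTest φ → ∫ p, G₁ p * onPhase φ p ∂(phaseMeasure d) +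
      ∫ q, G₂ q * fracJump s (onPhase φ) q ∂(pairMeasure d) = 0)
    {v : Phase d → ℝ} (hv : MemLp v 2 (phaseMeasure d))
    (hDv : MemLp (fracJump s v) 2 (pairMeasure d)) {R : ℝ} (hR : ∀ p, R < ‖p.1‖ → v p = 0) :
    ∫ p, G₁ p * v p ∂(phaseMeasure d) + ∫ q, G₂ q * fracJump s v q ∂(pairMeasure d) = 0 := by
  obtain ⟨θ₀⟩ := nonempty_dir hd
  obtain ⟨δ, hδ, hδ4, c, hc⟩ := exists_map_sphereShift_le d
  have hcont := continuousAt_pairing_shift hd h0 h1 hδ hδ4 hc hG₁ hG₂ hv hDv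
  have hv1 : Integrable v (phaseMeasure d) := by
    have hsub : Function.support v ⊆ Metric.closedBall 0 R ×ˢ univ := by
      intro p hp
      by_contra hp'
      refine hp (hR p ?_)
      simpa using hp'
    have hfin : phaseMeasure d (Metric.closedBall 0 R ×ˢ univ) < ⊤ :=
      ((isCompact_closedBall (0 : Pos d) R).prod isCompact_univ).measure_lt_top
    rw [← integrableOn_iff_integrable_of_support_subset hsub]
    have : IsFiniteMeasure ((phaseMeasure d).restrict (Metric.closedBall 0 R ×ˢ univ)) :=
      ⟨by rwa [Measure.restrict_apply_univ]⟩
    exact (hv.restrict _).integrable (by norm_num)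
  set ρ : Measure (Pos d × Pos d) := (volume : Measure (Pos d)).prod (volume : Measure (Pos d))
    with hρ
  have hρneg : ρ.IsNegInvariant := by
    refine ⟨?_⟩
    have e : (Neg.neg : Pos d × Pos d → Pos d × Pos d) = Prod.map Neg.neg Neg.neg := rfl
    rw [Measure.neg, e, hρ, ← Measure.map_prod_map _ _ measurable_neg measurable_neg,
      Measure.map_neg_eq_self]
  -- Homogeneous extension of degree `0` in the second variable, cut at radius `2`. The cut is never
  -- felt: shifts of size at most `1/4` move the sphere into radius at most `5/4`.
  set V : Pos d × Pos d → ℝ := (univ ×ˢ Metric.ball (0 : Pos d) 2).indicator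
      (fun z : Pos d × Pos d => v (z.1, dirOf θ₀ z.2)) with hV
  have hVi : Integrable V ρ := integrable_radial_extension θ₀ hv1
  have hVl : LocallyIntegrable V ρ := hVi.locallyIntegrable
  have hVc : HasCompactSupport V := by
    refine HasCompactSupport.intro ((isCompact_closedBall (0 : Pos d) R).prod
      (isCompact_closedBall (0 : Pos d) 2)) fun z hz => ?_
    by_cases hz2 : z ∈ (univ : Set (Pos d)) ×ˢ Metric.ball (0 : Pos d) 2
    · rw [hV, indicator_of_mem hz2]
      refine hR _ ?_
      by_contra hle
      refine hz ⟨by simpa using hle, ?_⟩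
      have : ‖z.2‖ < 2 := by simpa using hz2.2
      simpa using this.le
    · rw [hV, indicator_of_notMem hz2]
  have key := eq_zero_of_bump_averages (μ := ρ) hcont hδ fun φ hφ => ?_
  · have e0 : ∀ q : Pos d × (Dir d × Dir d),
        shiftRatio s (0 : Pos d × Pos d).2 q.2 * fracJump s v (pairShift 0 q) = fracJump s v q := by
      intro q
      rw [← fracJump_phaseShift hd h0 h1 (by simp) v q]
      simp only [phaseShift_zero]
    simpa only [phaseShift_zero, e0] using key
  set a : Pos d × Pos d → ℝ := φ.normed ρ with ha
  have hac : Continuous a := φ.continuous_normed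
  obtain ⟨A, hA⟩ := hac.bounded_above_of_compact_support φ.hasCompactSupport_normed
  have haS : Function.support a ⊆ Metric.ball 0 δ := by
    rw [ha, φ.support_normed_eq]
    exact Metric.ball_subset_ball hφ.le
  set ρ' := ρ.restrict (Metric.ball 0 δ) with hρ'
  have : IsFiniteMeasure ρ' := ⟨by
    rw [hρ', Measure.restrict_apply_univ]
    exact Metric.isBounded_ball.measure_lt_top⟩
  have hmem : ∀ᵐ ζ ∂ρ', ‖ζ‖ ≤ δ := by
    filter_upwards [ae_restrict_mem Metric.isOpen_ball.measurableSet] with ζ hζ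
    have : ‖ζ‖ < δ := by simpa using hζ
    exact this.le
  have hcζ : ∀ᵐ ζ ∂ρ', (dirMeasure d).map (sphereShift ζ.2) ≤ c • dirMeasure d :=
    hmem.mono fun ζ hζ => hc _ ((norm_snd_le _).trans hζ)
  have m1 : MemLp (fun r : (Pos d × Pos d) × Phase d => v (phaseShift r.1 r.2)) 2
      (ρ'.prod (phaseMeasure d)) :=
    memLp_uncurry_comp measurable_phaseShift (hcζ.mono fun ζ hζ => map_phaseShift_le hζ) hv
  have m2 : MemLp (fun r : (Pos d × Pos d) × (Pos d × (Dir d × Dir d)) =>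
      shiftRatio s r.1.2 r.2.2 * fracJump s v (pairShift r.1 r.2)) 2
      (ρ'.prod (pairMeasure d)) := by
    refine memLp_two_mul_of_ae_bound (M := √(2 ^ (((d : ℝ) - 1) / 2 + s)))
      (memLp_uncurry_comp measurable_pairShift (hcζ.mono fun ζ hζ => map_pairShift_le hζ) hDv)
      (((measurable_shiftRatio s).comp (by fun_prop : Measurable
        fun r : (Pos d × Pos d) × (Pos d × (Dir d × Dir d)) => (r.1.2, r.2.2))).aestronglyMeasurable)
      ?_
    filter_upwards [Measure.quasiMeasurePreserving_fst.ae hmem] with r hr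
    exact abs_shiftRatio_le hd h0 h1 ((norm_snd_le _).trans (hr.trans hδ4)) _
  obtain ⟨i1, e1⟩ := integral_average_mul m1 hG₁ hac.measurable hA
  obtain ⟨i2, e2⟩ := integral_average_mul m2 hG₂ hac.measurable hA
  set P : Pos d × Pos d → ℝ := fun ζ => ∫ p, G₁ p * v (phaseShift ζ p) ∂(phaseMeasure d) +
      ∫ q, G₂ q * (shiftRatio s ζ.2 q.2 * fracJump s v (pairShift ζ q)) ∂(pairMeasure d) with hP
  have hsupp : Function.support (fun ζ => a ζ * P ζ) ⊆ Metric.ball 0 δ :=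
    (Function.support_mul_subset_left a P).trans haS
  have hint : Integrable (fun ζ => a ζ * P ζ) ρ' := by
    simp only [hP, mul_add]
    exact i1.add i2
  refine ⟨(integrableOn_iff_integrable_of_support_subset hsupp).1 hint, ?_⟩
  have hres : ∀ F : Pos d × Pos d → ℝ, Function.support F ⊆ Metric.ball 0 δ →
      ∫ ζ, F ζ ∂ρ = ∫ ζ, F ζ ∂ρ' := fun F hF =>
    (setIntegral_eq_integral_of_forall_compl_eq_zero fun ζ hζ => by
      by_contra hne; exact hζ (hF hne)).symm
  rw [hres _ hsupp]
  simp only [hP, mul_add]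
  rw [integral_add i1 i2, e1, e2]
  set ψ : Pos d × Pos d → ℝ := convolution a V (ContinuousLinearMap.lsmul ℝ ℝ) ρ with hψ
  have hψt : IsTest ψ :=
    ⟨φ.hasCompactSupport_normed.contDiff_convolution_left _ φ.contDiff_normed hVl,
      φ.hasCompactSupport_normed.convolution _ hVc⟩
  -- Translating a radial extension and restricting to the sphere is exactly composition with
  -- `phaseShift`.
  have hVv : ∀ (p : Phase d) (ζ : Pos d × Pos d), ‖ζ‖ ≤ δ →
      V ((p.1, (p.2 : Pos d)) - ζ) = v (phaseShift ζ p) := by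
    intro p ζ hζ
    have h4 : ‖ζ.2‖ ≤ 1 / 4 := (norm_snd_le _).trans (hζ.trans hδ4)
    have hin : (p.1, (p.2 : Pos d)) - ζ ∈ (univ : Set (Pos d)) ×ˢ Metric.ball (0 : Pos d) 2 := by
      refine ⟨mem_univ _, ?_⟩
      have := (norm_dir_sub_bounds h4 p.2).2
      simp only [Prod.snd_sub, mem_ball_zero_iff]
      linarith
    rw [hV, indicator_of_mem hin]
    simp only [phaseShift, Prod.fst_sub, Prod.snd_sub, dirOf_sub_eq θ₀ h4]
  have hψv : ∀ p : Phase d, Integrable (fun ζ => a ζ * v (phaseShift ζ p)) ρ' ∧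
      onPhase ψ p = ∫ ζ, a ζ * v (phaseShift ζ p) ∂ρ' := by
    intro p
    have hex : Integrable (fun ζ => a ζ * V ((p.1, (p.2 : Pos d)) - ζ)) ρ :=
      φ.hasCompactSupport_normed.convolutionExists_left (ContinuousLinearMap.lsmul ℝ ℝ) hac hVl _
    have hcongr : (fun ζ => a ζ * V ((p.1, (p.2 : Pos d)) - ζ)) =ᵐ[ρ']
        fun ζ => a ζ * v (phaseShift ζ p) := by
      filter_upwards [hmem] with ζ hζ
      rw [hVv p ζ hζ]
    refine ⟨(hex.restrict (s := Metric.ball 0 δ)).congr hcongr, ?_⟩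
    have e3 : onPhase ψ p = ∫ ζ, a ζ * V ((p.1, (p.2 : Pos d)) - ζ) ∂ρ := rfl
    rw [e3, hres _ ((Function.support_mul_subset_left a _).trans haS)]
    exact integral_congr_ae hcongr
  have hψw : ∀ q : Pos d × (Dir d × Dir d), fracJump s (onPhase ψ) q =
      ∫ ζ, a ζ * (shiftRatio s ζ.2 q.2 * fracJump s v (pairShift ζ q)) ∂ρ' := by
    intro q
    have e4 : fracJump s (onPhase ψ) q =
        √(angKernel s q.2.1 q.2.2) * ((∫ ζ, a ζ * v (phaseShift ζ (q.1, q.2.1)) ∂ρ') -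
          ∫ ζ, a ζ * v (phaseShift ζ (q.1, q.2.2)) ∂ρ') := by
      rw [fracJump, jump, (hψv _).2, (hψv _).2]
    rw [e4, ← integral_sub (hψv _).1 (hψv _).1, ← integral_const_mul]
    refine integral_congr_ae ?_
    filter_upwards [hmem] with ζ hζ
    rw [← fracJump_phaseShift hd h0 h1 (hζ.trans hδ4) v q]
    simp only [fracJump, jump]
    ring
  simp only [← hψw, ← (hψv _).2]
  exact h ψ hψt

/-- Test functions are weakly dense in the energy space. -/
theorem pairing_eq_zero_of_test (hd : 2 ≤ d) {s : ℝ} (h0 : 0 < s) (h1 : s < 1)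
    {G₁ : Phase d → ℝ} {G₂ : Pos d × (Dir d × Dir d) → ℝ} (hG₁ : MemLp G₁ 2 (phaseMeasure d))
    (hG₂ : MemLp G₂ 2 (pairMeasure d))
    (h : ∀ φ, IsTest φ → ∫ p, G₁ p * onPhase φ p ∂(phaseMeasure d) +
      ∫ q, G₂ q * fracJump s (onPhase φ) q ∂(pairMeasure d) = 0)
    {v : Phase d → ℝ} (hv : MemLp v 2 (phaseMeasure d))
    (hDv : MemLp (fracJump s v) 2 (pairMeasure d)) :
    ∫ p, G₁ p * v p ∂(phaseMeasure d) + ∫ q, G₂ q * fracJump s v q ∂(pairMeasure d) = 0 := by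
  -- A sharp cut-off suffices: it depends on `x` alone, so it commutes with the angular jump, and
  -- the bounded-support case asks for no smoothness.
  let χ : ℕ → Pos d → ℝ := fun n => (Metric.closedBall 0 (n : ℝ)).indicator 1
  have hχm : ∀ n, Measurable (χ n) := fun n =>
    measurable_one.indicator Metric.isClosed_closedBall.measurableSet
  have hχ1 : ∀ n x, |χ n x| ≤ 1 := by
    intro n x
    by_cases hx : x ∈ Metric.closedBall (0 : Pos d) n
    · simp [χ, indicator_of_mem hx]
    · simp [χ, indicator_of_notMem hx]
  have hχlim : ∀ x, Tendsto (fun n => χ n x) atTop (𝓝 1) := by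
    intro x
    obtain ⟨N, hN⟩ := exists_nat_ge ‖x‖
    refine tendsto_const_nhds.congr' ?_
    filter_upwards [eventually_ge_atTop N] with n hn
    have : x ∈ Metric.closedBall (0 : Pos d) n := by
      have : (N : ℝ) ≤ n := by exact_mod_cast hn
      simpa using hN.trans this
    simp [χ, indicator_of_mem this]
  have hfj : ∀ n, fracJump s (fun p => χ n p.1 * v p) = fun q => χ n q.1 * fracJump s v q := by
    intro n
    funext q
    simp only [fracJump, jump]
    ring
  have hz : ∀ n, ∫ p, G₁ p * (χ n p.1 * v p) ∂(phaseMeasure d) +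
      ∫ q, G₂ q * (χ n q.1 * fracJump s v q) ∂(pairMeasure d) = 0 := by
    intro n
    have hv' : MemLp (fun p : Phase d => χ n p.1 * v p) 2 (phaseMeasure d) :=
      memLp_two_mul_of_bound hv ((hχm n).comp measurable_fst).aestronglyMeasurable fun p => hχ1 n _
    have hw' : MemLp (fracJump s (fun p => χ n p.1 * v p)) 2 (pairMeasure d) := by
      rw [hfj]
      exact memLp_two_mul_of_bound hDv ((hχm n).comp measurable_fst).aestronglyMeasurable
        fun p => hχ1 n _
    have := pairing_eq_zero_of_bounded_support hd h0 h1 hG₁ hG₂ h hv' hw' (R := n) fun p hp => by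
      have : p.1 ∉ Metric.closedBall (0 : Pos d) n := by simpa using hp
      simp [χ, indicator_of_notMem this]
    rwa [hfj] at this
  have hlim : ∀ {X : Type} [MeasurableSpace X] {μ : Measure X} {π : X → Pos d} {F G : X → ℝ},
      Measurable π → MemLp F 2 μ → MemLp G 2 μ →
      Tendsto (fun n => ∫ x, G x * (χ n (π x) * F x) ∂μ) atTop (𝓝 (∫ x, G x * F x ∂μ)) := by
    intro X _ μ π F G hπ hF hG
    refine tendsto_integral_of_dominated_convergence (fun x => |G x * F x|)
      (fun n => hG.1.mul (((hχm n).comp hπ).aestronglyMeasurable.mul hF.1))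
      (integrable_mul_of_memLp_two hG hF).abs (fun n => Eventually.of_forall fun x => ?_)
      (Eventually.of_forall fun x => ?_)
    · rw [Real.norm_eq_abs, mul_left_comm, abs_mul]
      exact mul_le_of_le_one_left (abs_nonneg _) (hχ1 n _)
    · have := ((hχlim (π x)).mul_const (F x)).const_mul (G x)
      rwa [one_mul] at this
  have t := (hlim measurable_fst hv hG₁).add (hlim measurable_fst hDv hG₂)
  simp only [hz] at t
  exact tendsto_nhds_unique t tendsto_const_nhds |>.symm ▸ rfl

end Density

/-! ### Translations in the position variable. -/

section Translation

variable {d : ℕ}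

/-- Translation in the position variable. -/
def xShift {Y : Type*} (z : Pos d) (p : Pos d × Y) : Pos d × Y := (p.1 + z, p.2)

lemma xShift_zero {Y : Type*} (p : Pos d × Y) : xShift 0 p = p := by simp [xShift]

lemma xShift_neg_xShift {Y : Type*} (z : Pos d) (p : Pos d × Y) : xShift (-z) (xShift z p) = p := by
  simp [xShift]

lemma xShift_xShift_neg {Y : Type*} (z : Pos d) (p : Pos d × Y) : xShift z (xShift (-z) p) = p := by
  simp [xShift]

variable {Y : Type*} [MeasurableSpace Y] {ν : Measure Y} [SFinite ν]

lemma measurable_xShift : Measurable fun r : Pos d × (Pos d × Y) => xShift r.1 r.2 := by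
  unfold xShift; fun_prop

lemma measurePreserving_xShift (z : Pos d) : MeasurePreserving (xShift z : Pos d × Y → Pos d × Y)
    ((volume : Measure (Pos d)).prod ν) ((volume : Measure (Pos d)).prod ν) :=
  (measurePreserving_add_right volume z).prod (MeasurePreserving.id ν)

lemma integral_xShift (z : Pos d) (F : Pos d × Y → ℝ) :
    ∫ p, F (xShift z p) ∂((volume : Measure (Pos d)).prod ν) =
      ∫ p, F p ∂((volume : Measure (Pos d)).prod ν) := by
  let e : Pos d × Y ≃ᵐ Pos d × Y :=
    { toFun := xShift z
      invFun := xShift (-z)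
      left_inv := xShift_neg_xShift z
      right_inv := xShift_xShift_neg z
      measurable_toFun := measurable_xShift.comp measurable_prodMk_left
      measurable_invFun := measurable_xShift.comp measurable_prodMk_left }
  exact (measurePreserving_xShift z).integral_comp e.measurableEmbedding F

lemma memLp_xShift_uncurry {ρ : Measure (Pos d)} [IsFiniteMeasure ρ] {F : Pos d × Y → ℝ}
    (hF : MemLp F 2 ((volume : Measure (Pos d)).prod ν)) :
    MemLp (fun r : Pos d × (Pos d × Y) => F (xShift r.1 r.2)) 2
      (ρ.prod ((volume : Measure (Pos d)).prod ν)) :=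
  memLp_uncurry_comp measurable_xShift (c := 1) (Eventually.of_forall fun z => by
    rw [one_smul, (measurePreserving_xShift z).map_eq]) hF

lemma memLp_xShift_neg_uncurry {ρ : Measure (Pos d)} [IsFiniteMeasure ρ] {F : Pos d × Y → ℝ}
    (hF : MemLp F 2 ((volume : Measure (Pos d)).prod ν)) :
    MemLp (fun r : Pos d × (Pos d × Y) => F (xShift (-r.1) r.2)) 2
      (ρ.prod ((volume : Measure (Pos d)).prod ν)) :=
  memLp_uncurry_comp (T := fun z p => xShift (-z) p) (measurable_xShift.comp
    (by fun_prop : Measurable fun r : Pos d × (Pos d × Y) => (-r.1, r.2))) (c := 1)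
    (Eventually.of_forall fun z => by
      rw [one_smul, (measurePreserving_xShift (-z)).map_eq]) hF

lemma memLp_integral_left {X Z : Type*} [MeasurableSpace X] [MeasurableSpace Z] {μ : Measure X}
    [SFinite μ] {ρ : Measure Z} [IsFiniteMeasure ρ] {F : Z × X → ℝ} (hF : MemLp F 2 (ρ.prod μ)) :
    MemLp (fun x => ∫ z, F (z, x) ∂ρ) 2 μ :=
  memLp_two_integral_right (F := fun p : X × Z => F (p.2, p.1))
    (hF.comp_measurePreserving Measure.measurePreserving_swap)

lemma continuousAt_pairing_xShift {Y : Type*} [MetricSpace Y] [CompactSpace Y] [MeasurableSpace Y]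
    [BorelSpace Y] {ν : Measure Y} [SFinite ν] [((volume : Measure (Pos d)).prod ν).Regular]
    {F G : Pos d × Y → ℝ} (hF : MemLp F 2 ((volume : Measure (Pos d)).prod ν))
    (hG : MemLp G 2 ((volume : Measure (Pos d)).prod ν)) :
    ContinuousAt (fun z : Pos d =>
      ∫ p, G p * F (xShift z p) ∂((volume : Measure (Pos d)).prod ν)) 0 := by
  have t : Tendsto (fun z : Pos d => eLpNorm (fun p => F (xShift z p) - F p) 2
      ((volume : Measure (Pos d)).prod ν)) (𝓝 0) (𝓝 0) := by
    refine tendsto_eLpNorm_comp_sub (c := 1) (δ := fun z => 2 * ‖z‖) (Eventually.of_forall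
      fun z => ⟨(measurePreserving_xShift (ν := ν) z).measurable, by
        rw [one_smul, (measurePreserving_xShift z).map_eq]⟩) tendsto_two_mul_norm
      (Eventually.of_forall fun z p => ?_) hF
    rw [Prod.dist_eq]
    simp only [xShift, dist_self, dist_self_add_left]
    exact max_le (by linarith [norm_nonneg z]) (by positivity)
  have := tendsto_integral_mul_of_tendsto_eLpNorm (F := fun z p => F (xShift z p))
    (Eventually.of_forall fun z => hF.comp_measurePreserving (measurePreserving_xShift z)) hF hG t
  rw [ContinuousAt]
  simp only [xShift_zero]
  simpa only [mul_comm] using this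

end Translation

/-! ### Mollification in the position variable. -/

section Mollification

variable {d : ℕ}

/-- The translated test function. -/
def shiftTest (z : Pos d) (φ : Pos d × Pos d → ℝ) (y : Pos d × Pos d) : ℝ := φ (y.1 - z, y.2)

lemma IsTest.shiftTest {φ : Pos d × Pos d → ℝ} (hφ : IsTest φ) (z : Pos d) :
    IsTest (shiftTest z φ) := by
  refine ⟨?_, ?_⟩
  · have : ContDiff ℝ ∞ fun y : Pos d × Pos d => (y.1 - z, y.2) := by fun_prop
    exact hφ.1.comp this
  · exact hφ.2.comp_homeomorph ((Homeomorph.subRight z).prodCongr (Homeomorph.refl _))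

lemma onPhase_shiftTest (z : Pos d) (φ : Pos d × Pos d → ℝ) (p : Phase d) :
    onPhase (shiftTest z φ) p = onPhase φ (xShift (-z) p) := by
  simp [onPhase, shiftTest, xShift, sub_eq_add_neg]

lemma transport_shiftTest (z : Pos d) (φ : Pos d × Pos d → ℝ) (p : Phase d) :
    transport (shiftTest z φ) p = transport φ (xShift (-z) p) := by
  unfold transport shiftTest xShift
  simp only [← sub_eq_add_neg]
  rw [fderiv_comp_sub (f := fun y => φ (y, (p.2 : Pos d)))]

lemma fracJump_shiftTest (s : ℝ) (z : Pos d) (φ : Pos d × Pos d → ℝ)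
    (q : Pos d × (Dir d × Dir d)) :
    fracJump s (onPhase (shiftTest z φ)) q = fracJump s (onPhase φ) (xShift (-z) q) := by
  simp only [fracJump, jump, onPhase_shiftTest]
  rfl

/-- Differentiating `φ(x - z, θ)` in `x` is minus differentiating in `z`, so integration by parts
puts the derivative on the mollifier. -/
lemma integral_mul_transport_sub {r : Pos d → ℝ} (hr : ContDiff ℝ ∞ r) (hrc : HasCompactSupport r)
    {φ : Pos d × Pos d → ℝ} (hφ : IsTest φ) (p : Phase d) :
    ∫ z, r z * transport φ (xShift (-z) p) =
      ∫ z, fderiv ℝ r z (p.2 : Pos d) * onPhase φ (xShift (-z) p) := by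
  obtain ⟨x, θ⟩ := p
  set g : Pos d → ℝ := fun z => φ (x - z, (θ : Pos d)) with hg
  have hgd : ∀ z, HasFDerivAt g (-((fderiv ℝ φ (x - z, (θ : Pos d))).comp
      (ContinuousLinearMap.inl ℝ (Pos d) (Pos d)))) z := by
    intro z
    have h1 := hasFDerivAt_slice hφ (x - z) θ
    have h2 : HasFDerivAt (fun z : Pos d => x - z) (-ContinuousLinearMap.id ℝ (Pos d)) z :=
      (hasFDerivAt_id z).const_sub x
    have := h1.comp z h2
    rwa [ContinuousLinearMap.comp_neg, ContinuousLinearMap.comp_id] at this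
  have hgt : ∀ z, fderiv ℝ g z (θ : Pos d) = -transport φ (xShift (-z) (x, θ)) := by
    intro z
    rw [(hgd z).fderiv, transport_eq hφ]
    simp [onPhase, transportExt, xShift, sub_eq_add_neg]
  have hgc : Continuous g := continuous_iff_continuousAt.2 fun z => (hgd z).continuousAt
  have htc : Continuous fun z => fderiv ℝ g z (θ : Pos d) := by
    have h3 : Continuous fun z : Pos d => transportExt φ (x - z, (θ : Pos d)) :=
      hφ.transportExt.1.continuous.comp (by fun_prop)
    refine h3.neg.congr fun z => ?_
    rw [hgt, transport_eq hφ]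
    simp [onPhase, xShift, sub_eq_add_neg]
  have hrd : Continuous fun z => fderiv ℝ r z (θ : Pos d) :=
    (hr.continuous_fderiv (by simp)).clm_apply continuous_const
  have hrdc : HasCompactSupport fun z => fderiv ℝ r z (θ : Pos d) :=
    hrc.fderiv_apply ℝ (θ : Pos d)
  have i1 : Integrable (fun z => fderiv ℝ r z (θ : Pos d) * g z) :=
    (hrd.mul hgc).integrable_of_hasCompactSupport hrdc.mul_right
  have i2 : Integrable (fun z => r z * fderiv ℝ g z (θ : Pos d)) :=
    (hr.continuous.mul htc).integrable_of_hasCompactSupport hrc.mul_right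
  have i3 : Integrable (fun z => r z * g z) :=
    (hr.continuous.mul hgc).integrable_of_hasCompactSupport hrc.mul_right
  have := integral_mul_fderiv_eq_neg_fderiv_mul_of_integrable i1 i2 i3
    (fun z _ => (hr.differentiable (by simp)).differentiableAt)
    (fun z _ => (hgd z).differentiableAt)
  simp only [hgt, mul_neg, integral_neg, neg_inj] at this
  rw [this]
  refine integral_congr_ae (Eventually.of_forall fun z => ?_)
  simp [hg, onPhase, xShift, sub_eq_add_neg]

end Mollification

/-! ### Uniqueness of energy solutions. -/

section EnergySolution

variable {d : ℕ}

/-- The weak formulation of the fractional Fokker–Planck equation in the energy space. -/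
structure IsEnergySolution (s ε : ℝ) (lam σ : Pos d → ℝ) (f u : Phase d → ℝ) : Prop where
  memLp : MemLp u 2 (phaseMeasure d)
  memLp_fracJump : MemLp (fracJump s u) 2 (pairMeasure d)
  weak : ∀ φ : Pos d × Pos d → ℝ, IsTest φ →
    -∫ p, u p * transport φ p ∂(phaseMeasure d) +
      ∫ p, lam p.1 * u p * onPhase φ p ∂(phaseMeasure d) +
      ε ^ (2 * s) / 2 * ∫ q, σ q.1 * fracJump s u q * fracJump s (onPhase φ) q ∂(pairMeasure d) =
    ∫ p, f p * onPhase φ p ∂(phaseMeasure d)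

lemma integral_odd_eq_zero {A : Pos d → ℝ} (h : ∀ z, A (-z) = -A z) : ∫ z, A z = 0 := by
  have h1 := integral_neg_eq_self A (volume : Measure (Pos d))
  simp only [h, integral_neg] at h1
  linarith

/-- Test with translates `φ(x - z, θ)` and average in `z` against an even bump `r`. The transport
term becomes the pairing of `φ` with `U1 = ∫ (θ·∇r)(z) u(x + z, θ) dz`, which is in `L²`, so density
allows `φ = u`. Then `U1` drops out by oddness. What remains is the `r`-average of the pairings of
`u` and of its weighted jump with the translates of `lam u` and of `σ` times the jump; translating
these products as a whole leaves no commutator. All bump averages vanish, hence so does the value at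
zero translation, which is a positive quadratic form in `u`. -/
lemma IsEnergySolution.ae_eq_zero (hd : 2 ≤ d) {s : ℝ} (h0 : 0 < s) (h1 : s < 1) {ε : ℝ}
    (hε : 0 < ε) {lam σ : Pos d → ℝ} {c c' : ℝ} (hl : IsAbsorption lam c) (hσ : IsAbsorption σ c')
    {u : Phase d → ℝ} (hu : IsEnergySolution s ε lam σ 0 u) (hD : ∀ φ : Pos d × Pos d → ℝ,
      IsTest φ → MemLp (fracJump s (onPhase φ)) 2 (pairMeasure d)) :
    u =ᵐ[phaseMeasure d] 0 := by
  obtain ⟨mu, mD, hw⟩ := hu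
  set e : ℝ := ε ^ (2 * s) / 2 with he
  have he0 : 0 < e := by positivity
  set L : Phase d → ℝ := fun p => lam p.1 * u p with hL
  have mL : MemLp L 2 (phaseMeasure d) := hl.memLp_mul measurable_fst mu
  set S : Pos d × (Dir d × Dir d) → ℝ := fun q => σ q.1 * fracJump s u q with hS
  have mS : MemLp S 2 (pairMeasure d) := hσ.memLp_mul measurable_fst mD
  have hcont : ContinuousAt (fun z : Pos d =>
      ∫ p, u p * L (xShift z p) ∂(phaseMeasure d) +
      e * ∫ q, fracJump s u q * S (xShift z q) ∂(pairMeasure d)) 0 :=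
    (continuousAt_pairing_xShift mL mu).add ((continuousAt_pairing_xShift mS mD).const_mul e)
  have key := eq_zero_of_bump_averages (μ := (volume : Measure (Pos d))) hcont one_pos
    fun b hb => ?_
  · simp only [xShift_zero] at key
    have n1 : 0 ≤ ∫ q, fracJump s u q * S q ∂(pairMeasure d) := by
      refine integral_nonneg fun q => ?_
      simp only [hS, Pi.zero_apply]
      have := hσ.pos.le.trans (hσ.ge q.1)
      nlinarith [mul_nonneg this (mul_self_nonneg (fracJump s u q))]
    have e1 : ∫ p, u p * L p ∂(phaseMeasure d) =
        ∫ p, lam p.1 * u p * u p ∂(phaseMeasure d) := by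
      refine integral_congr_ae (Eventually.of_forall fun p => ?_)
      simp only [hL]
      ring
    refine ae_eq_zero_of_integral_weight_mul_sq hl.pos mu (w := fun p => lam p.1)
      (fun p => hl.ge p.1) (integrable_mul_of_memLp_two mL mu) ?_
    rw [← e1]
    nlinarith
  set r : Pos d → ℝ := b.normed volume with hr
  have hrs : ContDiff ℝ ∞ r := b.contDiff_normed
  have hrc : HasCompactSupport r := b.hasCompactSupport_normed
  have hre : ∀ z, r (-z) = r z := fun z => b.normed_neg z
  set w : Pos d → Dir d → ℝ := fun z θ => fderiv ℝ r z (θ : Pos d) with hwdef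
  -- The derivative of the even function `r` is odd.
  have hwodd : ∀ z θ, w (-z) θ = -w z θ := by
    intro z θ
    have h3 : (fun z => r (-z)) = r := funext hre
    have h4 : fderiv ℝ (fun z => r (-z)) z = -fderiv ℝ r (-z) := by
      have h5 := ((hrs.differentiable (by simp)).differentiableAt (x := -z)).hasFDerivAt.comp z
        (hasFDerivAt_id z).neg
      rw [ContinuousLinearMap.comp_neg, ContinuousLinearMap.comp_id] at h5
      exact h5.fderiv
    rw [h3] at h4
    simp only [hwdef]
    rw [h4]
    simp
  have hwcont : Continuous fun q : Pos d × Dir d => w q.1 q.2 := by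
    have := hrs.continuous_fderiv (by simp)
    simp only [hwdef]
    fun_prop
  obtain ⟨A, hA⟩ := hrs.continuous.bounded_above_of_compact_support hrc
  obtain ⟨M, hM⟩ := (hrs.continuous_fderiv (by simp)).bounded_above_of_compact_support
    (hrc.fderiv ℝ)
  have hwM : ∀ z θ, |w z θ| ≤ M := by
    intro z θ
    have := (fderiv ℝ r z).le_opNorm (θ : Pos d)
    rw [norm_dir, mul_one] at this
    exact this.trans (hM z)
  have hrS : ∀ z, z ∉ Metric.ball (0 : Pos d) 1 → r z = 0 := by
    intro z hz
    rw [← Function.notMem_support, hr, b.support_normed_eq]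
    exact fun h => hz (Metric.ball_subset_ball hb.le h)
  have hwS : ∀ z, z ∉ Metric.ball (0 : Pos d) 1 → ∀ θ, w z θ = 0 := by
    intro z hz θ
    have h3 : z ∉ tsupport r := by
      rw [hr, b.tsupport_normed_eq]
      exact fun h => hz (Metric.closedBall_subset_ball hb h)
    have h4 : fderiv ℝ r z = 0 := by
      by_contra hne
      exact h3 (support_fderiv_subset ℝ hne)
    simp [hwdef, h4]
  set ρ := (volume : Measure (Pos d)).restrict (Metric.ball 0 1) with hρ
  have : IsFiniteMeasure ρ := ⟨by
    rw [hρ, Measure.restrict_apply_univ]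
    exact Metric.isBounded_ball.measure_lt_top⟩
  have hres : ∀ F : Pos d → ℝ, (∀ z, z ∉ Metric.ball (0 : Pos d) 1 → F z = 0) →
      ∫ z, F z = ∫ z, F z ∂ρ := fun F hF =>
    (setIntegral_eq_integral_of_forall_compl_eq_zero hF).symm
  have mF1 : MemLp (fun q : Pos d × Phase d => w q.1 q.2.2 * u (xShift q.1 q.2)) 2
      (ρ.prod (phaseMeasure d)) :=
    memLp_two_mul_of_bound (memLp_xShift_uncurry mu)
      (hwcont.comp (by fun_prop : Continuous fun q : Pos d × Phase d =>
        (q.1, q.2.2))).aestronglyMeasurable fun q => hwM _ _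
  have mF2 := memLp_xShift_uncurry (ρ := ρ) mL
  have mF3 := memLp_xShift_uncurry (ρ := ρ) mS
  have hrmul : ∀ {X : Type} [MeasurableSpace X] {μ : Measure X} [SFinite μ] {F : Pos d × X → ℝ},
      MemLp F 2 (ρ.prod μ) → MemLp (fun q => r q.1 * F q) 2 (ρ.prod μ) := fun hF =>
    memLp_two_mul_of_bound hF
      (hrs.continuous.measurable.comp measurable_fst).aestronglyMeasurable fun q => hA _
  set U1 : Phase d → ℝ := fun p => ∫ z, w z p.2 * u (xShift z p) ∂ρ with hU1
  set U2 : Phase d → ℝ := fun p => ∫ z, r z * L (xShift z p) ∂ρ with hU2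
  set U3 : Pos d × (Dir d × Dir d) → ℝ := fun q => ∫ z, r z * S (xShift z q) ∂ρ with hU3
  have mU1 : MemLp U1 2 (phaseMeasure d) := memLp_integral_left mF1
  have mU2 : MemLp U2 2 (phaseMeasure d) := memLp_integral_left (hrmul mF2)
  have mU3 : MemLp U3 2 (pairMeasure d) := memLp_integral_left (hrmul mF3)
  have a1 : ∀ v, MemLp v 2 (phaseMeasure d) →
      Integrable (fun z => ∫ p, v p * (w z p.2 * u (xShift z p)) ∂(phaseMeasure d)) ρ ∧
      ∫ z, ∫ p, v p * (w z p.2 * u (xShift z p)) ∂(phaseMeasure d) ∂ρ =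
        ∫ p, v p * U1 p ∂(phaseMeasure d) := by
    intro v hv
    have := integral_average_mul mF1 hv (a := fun _ => 1) measurable_const (A := 1) (by simp)
    simpa only [one_mul] using this
  have a2 : ∀ v, MemLp v 2 (phaseMeasure d) →
      Integrable (fun z => r z * ∫ p, v p * L (xShift z p) ∂(phaseMeasure d)) ρ ∧
      ∫ z, r z * ∫ p, v p * L (xShift z p) ∂(phaseMeasure d) ∂ρ =
        ∫ p, v p * U2 p ∂(phaseMeasure d) := fun v hv =>
    integral_average_mul mF2 hv hrs.continuous.measurable hA
  have a3 : ∀ v, MemLp v 2 (pairMeasure d) →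
      Integrable (fun z => r z * ∫ p, v p * S (xShift z p) ∂(pairMeasure d)) ρ ∧
      ∫ z, r z * ∫ p, v p * S (xShift z p) ∂(pairMeasure d) ∂ρ =
        ∫ p, v p * U3 p ∂(pairMeasure d) := fun v hv =>
    integral_average_mul mF3 hv hrs.continuous.measurable hA
  have htest : ∀ φ, IsTest φ → ∫ p, (U2 p - U1 p) * onPhase φ p ∂(phaseMeasure d) +
      ∫ q, (e * U3 q) * fracJump s (onPhase φ) q ∂(pairMeasure d) = 0 := by
    intro φ hφ
    have mφ := hφ.memLp 2
    have mt := hφ.memLp_transport 2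
    have mDφ := hD φ hφ
    have b1 := integral_average_mul (memLp_xShift_neg_uncurry (ρ := ρ) mt) mu
      hrs.continuous.measurable hA
    -- Moves the transport derivative onto `r`, then the translation from `φ` onto `u`.
    have b1' : ∫ p, u p * ∫ z, r z * transport φ (xShift (-z) p) ∂ρ ∂(phaseMeasure d) =
        ∫ p, onPhase φ p * U1 p ∂(phaseMeasure d) := by
      have mG : MemLp (fun q : Pos d × Phase d => w q.1 q.2.2 * onPhase φ (xShift (-q.1) q.2)) 2
          (ρ.prod (phaseMeasure d)) :=
        memLp_two_mul_of_bound (memLp_xShift_neg_uncurry mφ)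
          (hwcont.comp (by fun_prop : Continuous fun q : Pos d × Phase d =>
            (q.1, q.2.2))).aestronglyMeasurable fun q => hwM _ _
      have b2 := (integral_average_mul mG mu (a := fun _ => 1) measurable_const (A := 1)
        (by simp)).2
      simp only [one_mul] at b2
      rw [← (a1 _ mφ).2]
      have e2 : ∀ p : Phase d, ∫ z, r z * transport φ (xShift (-z) p) ∂ρ =
          ∫ z, w z p.2 * onPhase φ (xShift (-z) p) ∂ρ := by
        intro p
        rw [← hres _ fun z hz => by rw [hrS z hz, zero_mul],
          ← hres _ fun z hz => by rw [hwS z hz, zero_mul], integral_mul_transport_sub hrs hrc hφ p]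
      simp only [e2]
      rw [← b2]
      refine integral_congr_ae (Eventually.of_forall fun z => ?_)
      simp only
      rw [← integral_xShift z]
      refine integral_congr_ae (Eventually.of_forall fun p => ?_)
      simp only [xShift_neg_xShift]
      simp only [xShift]
      ring
    have hz : ∀ z, r z * -(∫ p, u p * transport φ (xShift (-z) p) ∂(phaseMeasure d)) +
        r z * (∫ p, onPhase φ p * L (xShift z p) ∂(phaseMeasure d)) +
        e * (r z * ∫ q, fracJump s (onPhase φ) q * S (xShift z q) ∂(pairMeasure d)) = 0 := by
      intro z
      have h3 := hw _ (hφ.shiftTest z)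
      simp only [transport_shiftTest, onPhase_shiftTest, fracJump_shiftTest, Pi.zero_apply,
        zero_mul, integral_zero] at h3
      rw [← integral_xShift z (fun p => lam p.1 * u p * onPhase φ (xShift (-z) p)),
        ← integral_xShift z (fun q => σ q.1 * fracJump s u q *
          fracJump s (onPhase φ) (xShift (-z) q))] at h3
      simp only [xShift_neg_xShift] at h3
      have c1 : ∫ p, onPhase φ p * L (xShift z p) ∂(phaseMeasure d) =
          ∫ p, lam (xShift z p).1 * u (xShift z p) * onPhase φ p ∂(phaseMeasure d) := by
        congr 1; funext p; simp only [hL]; ring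
      have c2 : ∫ q, fracJump s (onPhase φ) q * S (xShift z q) ∂(pairMeasure d) =
          ∫ q, σ (xShift z q).1 * fracJump s u (xShift z q) * fracJump s (onPhase φ) q
            ∂(pairMeasure d) := by
        congr 1; funext p; simp only [hS]; ring
      rw [c1, c2]
      linear_combination r z * h3
    have hz' : ∫ z, (-1 * (r z * ∫ p, u p * transport φ (xShift (-z) p) ∂(phaseMeasure d)) +
        1 * (r z * ∫ p, onPhase φ p * L (xShift z p) ∂(phaseMeasure d)) +
        e * (r z * ∫ q, fracJump s (onPhase φ) q * S (xShift z q) ∂(pairMeasure d))) ∂ρ = 0 := by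
      refine integral_eq_zero_of_ae (Eventually.of_forall fun z => ?_)
      simp only [Pi.zero_apply]
      linarith [hz z]
    rw [integral_lin_comb_three b1.1 (a2 _ mφ).1 (a3 _ mDφ).1, b1.2, b1', (a2 _ mφ).2,
      (a3 _ mDφ).2] at hz'
    have l3 := integral_lin_comb_three (integrable_mul_of_memLp_two mU2 mφ)
      (integrable_mul_of_memLp_two mU1 mφ) (integrable_mul_of_memLp_two mU1 mφ) 1 (-1) 0
    have e3 : ∫ p, (U2 p - U1 p) * onPhase φ p ∂(phaseMeasure d) =
        ∫ p, onPhase φ p * U2 p ∂(phaseMeasure d) - ∫ p, onPhase φ p * U1 p ∂(phaseMeasure d) := by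
      simp only [mul_comm (onPhase φ _)]
      refine Eq.trans (integral_congr_ae (Eventually.of_forall fun p => ?_)) (l3.trans (by ring))
      simp only
      ring
    have e4 : ∫ q, (e * U3 q) * fracJump s (onPhase φ) q ∂(pairMeasure d) =
        e * ∫ q, fracJump s (onPhase φ) q * U3 q ∂(pairMeasure d) := by
      rw [← integral_const_mul]
      congr 1; funext q; ring
    rw [e3, e4]
    linarith
  have hfin := pairing_eq_zero_of_test hd h0 h1 (mU2.sub mU1) (mU3.const_mul e) htest mu mD
  -- Translating the integration variable exchanges the two factors `u`, so as a function of `z` the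
  -- pairing inherits the oddness of `w`.
  have hU1u : ∫ p, u p * U1 p ∂(phaseMeasure d) = 0 := by
    rw [← (a1 u mu).2, ← hres _ fun z hz => by simp [hwS z hz]]
    refine integral_odd_eq_zero fun z => ?_
    rw [← integral_xShift z, ← integral_neg]
    refine integral_congr_ae (Eventually.of_forall fun p => ?_)
    simp only [xShift_neg_xShift]
    rw [hwodd]
    simp only [xShift]
    ring
  have hsum : ∀ z, r z * (∫ p, u p * L (xShift z p) ∂(phaseMeasure d) +
      e * ∫ q, fracJump s u q * S (xShift z q) ∂(pairMeasure d)) =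
      1 * (r z * ∫ p, u p * L (xShift z p) ∂(phaseMeasure d)) +
      e * (r z * ∫ q, fracJump s u q * S (xShift z q) ∂(pairMeasure d)) +
      0 * (r z * ∫ p, u p * L (xShift z p) ∂(phaseMeasure d)) := fun z => by ring
  have hsupp : ∀ z, z ∉ Metric.ball (0 : Pos d) 1 → r z * (∫ p, u p * L (xShift z p)
      ∂(phaseMeasure d) + e * ∫ q, fracJump s u q * S (xShift z q) ∂(pairMeasure d)) = 0 :=
    fun z hz => by rw [hrS z hz, zero_mul]
  refine ⟨?_, ?_⟩
  · refine (integrableOn_iff_integrable_of_support_subset (s := Metric.ball 0 1)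
      fun z hz => ?_).1 ?_
    · by_contra hz'
      exact hz (hsupp z hz')
    · change Integrable _ ρ
      simp only [mul_add]
      refine (a2 u mu).1.add (((a3 _ mD).1.const_mul e).congr (Eventually.of_forall fun z => ?_))
      simp only
      ring
  · rw [hres _ hsupp]
    simp only [hsum]
    rw [integral_lin_comb_three (a2 u mu).1 (a3 _ mD).1 (a2 u mu).1, (a2 u mu).2, (a3 _ mD).2]
    have l3 := integral_lin_comb_three (integrable_mul_of_memLp_two mU2 mu)
      (integrable_mul_of_memLp_two mU1 mu) (integrable_mul_of_memLp_two mU1 mu) 1 (-1) 0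
    have e3 : ∫ p, (U2 - U1) p * u p ∂(phaseMeasure d) =
        ∫ p, u p * U2 p ∂(phaseMeasure d) - ∫ p, u p * U1 p ∂(phaseMeasure d) := by
      simp only [mul_comm (u _)]
      refine Eq.trans (integral_congr_ae (Eventually.of_forall fun p => ?_)) (l3.trans (by ring))
      simp only [Pi.sub_apply]
      ring
    have e4 : ∫ q, (e * U3 q) * fracJump s u q ∂(pairMeasure d) =
        e * ∫ q, fracJump s u q * U3 q ∂(pairMeasure d) := by
      rw [← integral_const_mul]
      congr 1; funext q; ring
    rw [e3, e4, hU1u] at hfin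
    linarith

end EnergySolution

/-! ### Test functions have finite angular energy. -/

section SingularIntegral

variable {d : ℕ}

-- The cone over a cap of radius `r` is covered by about `1 / r` balls of radius `2 r` centred along
-- its axis, with total volume of order `r ^ (d - 1)`. The restriction `r ≤ 4` allows the number of
-- balls to be bounded by `5 / r`.
open scoped Pointwise in
lemma exists_dirMeasure_cap_le (hd : 2 ≤ d) : ∃ C : ℝ≥0, ∀ (a : Dir d) (r : ℝ), 0 < r → r ≤ 4 →
    dirMeasure d {b | ‖(a : Pos d) - b‖ < r} ≤ C * ENNReal.ofReal (r ^ (d - 1)) := by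
  have : Nonempty (Fin d) := ⟨⟨0, by omega⟩⟩
  set V : ℝ≥0 := ((volume : Measure (Pos d)) (Metric.ball 0 1)).toNNReal with hV
  have hV' : (volume : Measure (Pos d)) (Metric.ball 0 1) = V :=
    (ENNReal.coe_toNNReal Metric.isBounded_ball.measure_lt_top.ne).symm
  refine ⟨d * (5 * 2 ^ d) * V, fun a r hr hr4 => ?_⟩
  have hm : MeasurableSet {b : Dir d | ‖(a : Pos d) - b‖ < r} :=
    measurableSet_lt (by fun_prop) measurable_const
  rw [dirMeasure, Measure.toSphere_apply' _ hm, finrank_euclideanSpace, Fintype.card_fin]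
  set N : ℕ := ⌈1 / r⌉₊ with hN
  have hN0 : 0 < N := Nat.ceil_pos.2 (by positivity)
  have hN0' : (0 : ℝ) < N := by exact_mod_cast hN0
  have hN1 : 1 / (N : ℝ) ≤ r := by
    rw [div_le_iff₀ hN0', ← div_le_iff₀' hr]
    exact Nat.le_ceil _
  have hN2 : (N : ℝ) ≤ 5 / r := by
    have h1 : (N : ℝ) < 1 / r + 1 := Nat.ceil_lt_add_one (by positivity)
    have h2 : 1 ≤ 4 / r := by rwa [le_div_iff₀ hr, one_mul]
    have h3 : 5 / r = 1 / r + 4 / r := by ring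
    linarith
  have hsub : Ioo (0 : ℝ) 1 • ((↑) '' {b : Dir d | ‖(a : Pos d) - b‖ < r} : Set (Pos d)) ⊆
      ⋃ j ∈ Finset.range N, Metric.ball (((j : ℝ) / N) • (a : Pos d)) (2 * r) := by
    rintro _ ⟨t, ⟨ht0, ht1⟩, _, ⟨b, hb, rfl⟩, rfl⟩
    have hb' : ‖(b : Pos d) - a‖ < r := by rw [norm_sub_rev]; exact hb
    simp only [mem_iUnion, Finset.mem_range, Metric.mem_ball, dist_eq_norm]
    have htN : 0 ≤ t * N := by positivity
    refine ⟨⌊t * N⌋₊, (Nat.floor_lt htN).2 (by nlinarith), ?_⟩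
    have e : t • (b : Pos d) - ((⌊t * N⌋₊ : ℝ) / N) • (a : Pos d) =
        t • ((b : Pos d) - a) + (t - (⌊t * N⌋₊ : ℝ) / N) • (a : Pos d) := by
      rw [smul_sub, sub_smul]; abel
    have h1 : |t - (⌊t * N⌋₊ : ℝ) / N| ≤ r := by
      refine le_trans ?_ hN1
      have e2 : t - (⌊t * N⌋₊ : ℝ) / N = (t * N - ⌊t * N⌋₊) / N := by field_simp
      have h2 := Nat.floor_le htN
      have h3 := (Nat.lt_floor_add_one (t * N)).le
      rw [e2, abs_of_nonneg (div_nonneg (by linarith) hN0'.le)]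
      gcongr
      linarith
    show ‖t • (b : Pos d) - _‖ < _
    rw [e]
    refine (norm_add_le _ _).trans_lt ?_
    rw [norm_smul, norm_smul, norm_dir, mul_one, Real.norm_eq_abs, Real.norm_eq_abs,
      abs_of_pos ht0]
    nlinarith [norm_nonneg ((b : Pos d) - a)]
  have hball : ∀ x : Pos d, (volume : Measure (Pos d)) (Metric.ball x (2 * r)) =
      ENNReal.ofReal ((2 * r) ^ d) * V := by
    intro x
    rw [Measure.addHaar_ball _ _ (by positivity), finrank_euclideanSpace, Fintype.card_fin, hV']
  calc (d : ℝ≥0∞) * volume (Ioo (0 : ℝ) 1 • ((↑) '' {b : Dir d | ‖(a : Pos d) - b‖ < r} :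
        Set (Pos d)))
      ≤ d * ∑ j ∈ Finset.range N, volume (Metric.ball (((j : ℝ) / N) • (a : Pos d)) (2 * r)) := by
        gcongr
        exact (measure_mono hsub).trans (measure_biUnion_finset_le _ _)
    _ = d * (ENNReal.ofReal N * (ENNReal.ofReal ((2 * r) ^ d) * V)) := by
        simp only [hball, Finset.sum_const, Finset.card_range, nsmul_eq_mul, ENNReal.ofReal_natCast]
    _ ≤ d * (ENNReal.ofReal (5 / r) * (ENNReal.ofReal ((2 * r) ^ d) * V)) := by
        gcongr
    _ = ((d * (5 * 2 ^ d) * V : ℝ≥0) : ℝ≥0∞) * ENNReal.ofReal (r ^ (d - 1)) := by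
        rw [← mul_assoc (ENNReal.ofReal (5 / r)), ← ENNReal.ofReal_mul (by positivity)]
        have e : 5 / r * (2 * r) ^ d = (5 * 2 ^ d) * r ^ (d - 1) := by
          obtain ⟨n, rfl⟩ : ∃ n, d = n + 1 := ⟨d - 1, by omega⟩
          rw [Nat.add_sub_cancel, mul_pow, pow_succ r]
          field_simp
        rw [e, ENNReal.ofReal_mul (by positivity)]
        have e2 : ENNReal.ofReal (5 * 2 ^ d) = ((5 * 2 ^ d : ℝ≥0) : ℝ≥0∞) := by
          rw [← ENNReal.ofReal_coe_nnreal]; push_cast; rfl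
        rw [e2]
        push_cast
        ring

/-- The singular integral that controls the energy of Lipschitz functions. -/
lemma exists_lintegral_singular_le (hd : 2 ≤ d) {s : ℝ} (h1 : s < 1) :
    ∃ C : ℝ≥0, ∀ a : Dir d, ∫⁻ b : Dir d, ENNReal.ofReal
      (‖(a : Pos d) - b‖ ^ (2 - 2 * s) / ‖(a : Pos d) - b‖ ^ (d - 1)) ∂(dirMeasure d) ≤ C := by
  obtain ⟨C, hC⟩ := exists_dirMeasure_cap_le hd
  have hγ : 0 < 2 - 2 * s := by linarith
  -- Dyadic shells: on `2⁻ⁿ < |a - b| ≤ 2 · 2⁻ⁿ` the integrand is at most `c n`, with the numerator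
  -- taken at the outer radius and the denominator at the inner one. The cap `S n a` contains the
  -- shell, and the resulting series is geometric of ratio `2^{-(2 - 2s)}`.
  set c : ℕ → ℝ := fun n => (2 * (2⁻¹ : ℝ) ^ n) ^ (2 - 2 * s) / ((2⁻¹ : ℝ) ^ n) ^ (d - 1) with hc
  set S : ℕ → Dir d → Set (Dir d) := fun n a => {b | ‖(a : Pos d) - b‖ < 4 * (2⁻¹ : ℝ) ^ n} with hS
  have hc0 : ∀ n, 0 ≤ c n := fun n => by simp only [hc]; positivity
  have hpt : ∀ a b : Dir d, ENNReal.ofReal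
      (‖(a : Pos d) - b‖ ^ (2 - 2 * s) / ‖(a : Pos d) - b‖ ^ (d - 1)) ≤
      ∑' n, (S n a).indicator (fun _ => ENNReal.ofReal (c n)) b := by
    intro a b
    rcases (norm_nonneg ((a : Pos d) - b)).eq_or_lt with h | h
    · rw [← h, Real.zero_rpow hγ.ne']; simp
    have h2 : ‖(a : Pos d) - b‖ ≤ 2 := by
      refine (norm_sub_le _ _).trans ?_
      rw [norm_dir, norm_dir]; norm_num
    obtain ⟨n, hn1, hn2⟩ := exists_nat_pow_near_of_lt_one (x := ‖(a : Pos d) - b‖ / 2)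
      (y := (2⁻¹ : ℝ)) (by positivity) (by linarith) (by norm_num) (by norm_num)
    have hn1' : (2⁻¹ : ℝ) ^ n < ‖(a : Pos d) - b‖ := by
      rw [pow_succ] at hn1; linarith
    have hn2' : ‖(a : Pos d) - b‖ ≤ 2 * (2⁻¹ : ℝ) ^ n := by linarith
    refine le_trans ?_ (ENNReal.le_tsum n)
    rw [indicator_of_mem (by
      have : (0 : ℝ) < (2⁻¹ : ℝ) ^ n := by positivity
      show ‖(a : Pos d) - b‖ < _
      linarith)]
    refine ENNReal.ofReal_le_ofReal ?_
    simp only [hc]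
    gcongr
  have hterm : ∀ n, c n * (4 * (2⁻¹ : ℝ) ^ n) ^ (d - 1) =
      2 ^ (2 - 2 * s) * 4 ^ (d - 1) * ((2⁻¹ : ℝ) ^ (2 - 2 * s)) ^ n := by
    intro n
    have h3 : ((2⁻¹ : ℝ) ^ n) ^ (d - 1) ≠ 0 := by positivity
    simp only [hc]
    rw [Real.mul_rpow (by norm_num) (by positivity), mul_pow, ← Real.rpow_natCast, ← Real.rpow_mul
      (by norm_num), mul_comm (n : ℝ), Real.rpow_mul (by norm_num), Real.rpow_natCast]
    field_simp
  have hq : (2⁻¹ : ℝ) ^ (2 - 2 * s) < 1 := Real.rpow_lt_one (by norm_num) (by norm_num) hγ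
  have hsum : Summable fun n => c n * (4 * (2⁻¹ : ℝ) ^ n) ^ (d - 1) := by
    simp only [hterm]
    exact (summable_geometric_of_lt_one (by positivity) hq).mul_left _
  refine ⟨C * (∑' n, c n * (4 * (2⁻¹ : ℝ) ^ n) ^ (d - 1)).toNNReal, fun a => ?_⟩
  have hSm : ∀ n, MeasurableSet (S n a) := fun n => measurableSet_lt (by fun_prop) measurable_const
  calc _ ≤ ∫⁻ b, ∑' n, (S n a).indicator (fun _ => ENNReal.ofReal (c n)) b ∂(dirMeasure d) :=
        lintegral_mono fun b => hpt a b
    _ = ∑' n, ENNReal.ofReal (c n) * dirMeasure d (S n a) := by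
        rw [lintegral_tsum fun n => (measurable_const.indicator (hSm n)).aemeasurable]
        congr 1; funext n
        rw [lintegral_indicator (hSm n), setLIntegral_const]
    _ ≤ ∑' n, C * ENNReal.ofReal (c n * (4 * (2⁻¹ : ℝ) ^ n) ^ (d - 1)) := by
        refine ENNReal.tsum_le_tsum fun n => ?_
        rw [ENNReal.ofReal_mul (hc0 n), mul_left_comm]
        gcongr
        refine hC a _ (by positivity) ?_
        have : (2⁻¹ : ℝ) ^ n ≤ 1 := pow_le_one₀ (by norm_num) (by norm_num)
        linarith
    _ = _ := by
        rw [ENNReal.tsum_mul_left, ← ENNReal.ofReal_tsum_of_nonneg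
          (fun n => mul_nonneg (hc0 n) (by positivity)) hsum]
        push_cast
        rfl

lemma angKernel_eq_norm (hd : 2 ≤ d) {s : ℝ} (h0 : 0 < s) (a b : Dir d) :
    angKernel s a b = angConst d s * 2 ^ (((d : ℝ) - 1) / 2 + s) /
      (‖(a : Pos d) - b‖ ^ (d - 1) * ‖(a : Pos d) - b‖ ^ (2 * s)) := by
  have hp := angExp_pos hd h0
  have h := norm_dir_sub_sq a b
  rw [angKernel_eq]
  set n := ‖(a : Pos d) - b‖ with hn
  have e : 1 - inner ℝ (a : Pos d) (b : Pos d) = n ^ 2 / 2 := by linarith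
  rw [e]
  rcases (norm_nonneg ((a : Pos d) - b)).eq_or_lt with h' | h'
  · rw [← hn] at h'
    rw [← h', zero_pow two_ne_zero, zero_div, Real.zero_rpow hp.ne', zero_pow (by omega)]
    simp
  · rw [← hn] at h'
    have e2 : n ^ (d - 1) * n ^ (2 * s) = (n ^ 2) ^ (((d : ℝ) - 1) / 2 + s) := by
      rw [← Real.rpow_natCast n 2, ← Real.rpow_mul h'.le, ← Real.rpow_natCast n (d - 1),
        ← Real.rpow_add h', Nat.cast_sub (by omega)]
      congr 1
      push_cast
      ring
    rw [e2, Real.div_rpow (by positivity) (by norm_num)]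
    field_simp

lemma lipschitz_jump_le {φ : Pos d × Pos d → ℝ} {L : ℝ≥0} (hL : LipschitzWith L φ)
    (q : Pos d × (Dir d × Dir d)) :
    |jump (onPhase φ) q| ≤ L * ‖(q.2.1 : Pos d) - q.2.2‖ := by
  have := hL.dist_le_mul (q.1, (q.2.1 : Pos d)) (q.1, (q.2.2 : Pos d))
  rwa [Real.dist_eq, Prod.dist_eq, dist_self, max_eq_right dist_nonneg, dist_eq_norm] at this

/-- The Lipschitz bound gives two powers of `|θ - θ'|` against the kernel's order `d - 1 + 2s`; the
rest is integrable because `s < 1`. The support is bounded in `x`. -/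
lemma IsTest.memLp_fracJump (hd : 2 ≤ d) {s : ℝ} (h0 : 0 < s) (h1 : s < 1)
    {φ : Pos d × Pos d → ℝ} (hφ : IsTest φ) :
    MemLp (fracJump s (onPhase φ)) 2 (pairMeasure d) := by
  have hm := aestronglyMeasurable_fracJump s (hφ.memLp 2).1
  obtain ⟨L, hL⟩ := hφ.exists_lipschitz
  obtain ⟨M, R, -, -, -, hR⟩ := hφ.exists_bound
  obtain ⟨C, hC⟩ := exists_lintegral_singular_le hd h1
  have hcK := angConst_pos hd h0 h1
  set A : ℝ := angConst d s * 2 ^ (((d : ℝ) - 1) / 2 + s) * L ^ 2 with hA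
  have hA0 : 0 ≤ A := by positivity
  set w : Dir d × Dir d → ℝ≥0∞ := fun q => ENNReal.ofReal
    (‖(q.1 : Pos d) - q.2‖ ^ (2 - 2 * s) / ‖(q.1 : Pos d) - q.2‖ ^ (d - 1)) with hw
  have hwm : Measurable w := by simp only [hw]; fun_prop
  rw [memLp_two_iff_lintegral hm]
  have hpt : ∀ q : Pos d × (Dir d × Dir d), ENNReal.ofReal (fracJump s (onPhase φ) q ^ 2) ≤
      (Metric.closedBall (0 : Pos d) R).indicator (fun _ => ENNReal.ofReal A) q.1 * w q.2 := by
    intro q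
    by_cases hq : q.1 ∈ Metric.closedBall (0 : Pos d) R
    · rw [indicator_of_mem hq, hw, ← ENNReal.ofReal_mul hA0]
      refine ENNReal.ofReal_le_ofReal ?_
      rw [fracJump, mul_pow, Real.sq_sqrt (angKernel_nonneg hd h0 h1 _ _), angKernel_eq_norm hd h0,
        ← sq_abs (jump _ _)]
      have hj := pow_le_pow_left₀ (abs_nonneg _) (lipschitz_jump_le hL q) 2
      set n := ‖(q.2.1 : Pos d) - q.2.2‖ with hn
      rcases (norm_nonneg ((q.2.1 : Pos d) - q.2.2)).eq_or_lt with h' | h'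
      · rw [← hn] at h'
        rw [← h'] at hj ⊢
        have h5 : |jump (onPhase φ) q| ^ 2 = 0 := le_antisymm (by simpa using hj) (by positivity)
        rw [h5, mul_zero]
        positivity
      · rw [← hn] at h'
        calc _ ≤ angConst d s * 2 ^ (((d : ℝ) - 1) / 2 + s) / (n ^ (d - 1) * n ^ (2 * s)) *
              (L * n) ^ 2 := by gcongr
          _ = _ := by
            have e : n ^ (2 - 2 * s) = n ^ 2 / n ^ (2 * s) := by
              rw [Real.rpow_sub h']; norm_num
            rw [e, hA]
            field_simp
    · have : R < ‖q.1‖ := by simpa using hq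
      have h6 : jump (onPhase φ) q = 0 := by
        simp only [jump, onPhase]
        rw [hR (q.1, (q.2.1 : Pos d)) this, hR (q.1, (q.2.2 : Pos d)) this, sub_zero]
      rw [fracJump, h6]
      simp
  refine (lintegral_mono hpt).trans_lt ?_
  have hBm : MeasurableSet (Metric.closedBall (0 : Pos d) R) :=
    Metric.isClosed_closedBall.measurableSet
  have e1 := lintegral_prod_mul (μ := (volume : Measure (Pos d)))
    (ν := (dirMeasure d).prod (dirMeasure d))
    (f := (Metric.closedBall (0 : Pos d) R).indicator fun _ => ENNReal.ofReal A)
    (measurable_const.indicator hBm).aemeasurable hwm.aemeasurable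
  rw [e1, lintegral_indicator hBm, setLIntegral_const, lintegral_prod _ hwm.aemeasurable]
  refine ENNReal.mul_lt_top (ENNReal.mul_lt_top ENNReal.ofReal_lt_top
    Metric.isBounded_closedBall.measure_lt_top) ?_
  refine (lintegral_mono fun a => hC a).trans_lt ?_
  rw [lintegral_const]
  exact ENNReal.mul_lt_top ENNReal.coe_lt_top (measure_lt_top _ _)

end SingularIntegral

/-! ### The Henyey–Greenstein kernel as `g → 1`. -/

section HenyeyGreenstein

variable {d : ℕ}

lemma hg_denominator (g : ℝ) (a b : Dir d) :
    1 + g ^ 2 - 2 * g * inner ℝ (a : Pos d) (b : Pos d) =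
      (1 - g) ^ 2 + 2 * g * (1 - inner ℝ (a : Pos d) (b : Pos d)) := by ring

lemma eq_mul_diffCoeff (hd : 2 ≤ d) {s : ℝ} (h0 : 0 < s) (h1 : s < 1) (m : ℝ) (b : Pos d → ℝ)
    (x : Pos d) :
    b x = fracLapConst ((d : ℝ) - 1) s / 2 ^ (m - 2 * s) * diffCoeff s m b x := by
  have := fracLapConst_pos hd h0 h1
  have h2 : (0 : ℝ) < 2 ^ (m - 2 * s) := by positivity
  rw [diffCoeff]
  field_simp

/-- The limit of the Henyey-Greenstein kernel is the kernel of the fractional diffusion. -/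
lemma diffCoeff_mul_angKernel (hd : 2 ≤ d) {s : ℝ} (h0 : 0 < s) (h1 : s < 1) (m : ℝ)
    (b : Pos d → ℝ) (x : Pos d) (θ θ' : Dir d) :
    diffCoeff s m b x * angKernel s θ θ' = 2 ^ m * b x /
      (2 * (1 - inner ℝ (θ : Pos d) (θ' : Pos d))) ^ (((d : ℝ) - 1) / 2 + s) := by
  have := fracLapConst_pos hd h0 h1
  rw [Real.mul_rpow (by norm_num) (one_sub_inner_nonneg _ _), angKernel_eq, diffCoeff, angConst]
  have e : (2 : ℝ) ^ (m - 2 * s) * 2 ^ (s - ((d : ℝ) - 1) / 2) =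
      2 ^ m / 2 ^ (((d : ℝ) - 1) / 2 + s) := by
    rw [← Real.rpow_add two_pos, ← Real.rpow_sub two_pos]
    congr 1
    ring
  rw [mul_div_assoc', ← div_div, mul_div_right_comm (2 ^ m), ← e]
  field_simp

/-- A family of bounded kernels that approximates `e σ(x) K(θ, θ')` from below up to a constant. -/
structure IsKernelApprox (s e : ℝ) (σ : Pos d → ℝ) (k : ℝ → Pos d → Dir d → Dir d → ℝ) (A : ℝ) :
    Prop where
  kernel : ∀ g, 0 < g → g < 1 → ∃ M, IsScatteringKernel (k g) M
  le : ∀ g, 1 / 2 ≤ g → g < 1 → ∀ x a b, a ≠ b → k g x a b ≤ A * angKernel s a b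
  tendsto : ∀ x a b, a ≠ b → Tendsto (fun g => k g x a b) (𝓝[<] 1) (𝓝 (e * σ x * angKernel s a b))

/-- The denominator is a power of `(1 - g)² + 2g(1 - θ·θ')`. The first summand bounds each kernel
with `g < 1`. For `g ≥ 1/2` the second is at least `1 - θ·θ'`, which gives the domination. At `g =
1` the sum is `2(1 - θ·θ')`, the limit kernel. -/
lemma isKernelApprox_hgKernel (hd : 2 ≤ d) {s : ℝ} (h0 : 0 < s) (h1 : s < 1) {m : ℝ} (hm : 0 < m)
    {ε : ℝ} (hε : 0 < ε) {b : Pos d → ℝ} {c : ℝ} (hσ : IsAbsorption (diffCoeff s m b) c) :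
    ∃ A, IsKernelApprox s (ε ^ (2 * s)) (diffCoeff s m b) (hgKernel s m ε b) A := by
  have hF := fracLapConst_pos hd h0 h1
  have hp := angExp_pos hd h0
  set p : ℝ := ((d : ℝ) - 1) / 2 + s with hpdef
  have h2 : (0 : ℝ) < 2 ^ (m - 2 * s) := by positivity
  set B : ℝ := fracLapConst ((d : ℝ) - 1) s / 2 ^ (m - 2 * s) with hB
  have hB0 : 0 < B := by positivity
  have hb : ∀ x, b x = B * diffCoeff s m b x := eq_mul_diffCoeff hd h0 h1 m b
  have hb0 : ∀ x, 0 ≤ b x := fun x => by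
    rw [hb]; exact mul_nonneg hB0.le (hσ.pos.le.trans (hσ.ge x))
  have hb1 : ∀ x, b x ≤ B * c⁻¹ := fun x => by
    rw [hb]; exact mul_le_mul_of_nonneg_left (hσ.le x) hB0.le
  have hbc : Continuous b := by
    rw [show b = fun x => B * diffCoeff s m b x from funext hb]
    exact continuous_const.mul hσ.continuous
  have hB1 : 0 ≤ B * c⁻¹ := mul_nonneg hB0.le (inv_nonneg.2 hσ.pos.le)
  have hin : ∀ θ θ' : Dir d, 0 ≤ 1 - inner ℝ (θ : Pos d) (θ' : Pos d) := one_sub_inner_nonneg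
  -- The factor `2 ^ p` compares `(1 - θ·θ')^p` with `(2(1 - θ·θ'))^p`, and `c⁻¹` bounds the
  -- diffusion coefficient.
  refine ⟨2 ^ p * (ε ^ (2 * s) * c⁻¹), fun g hg hg1 => ⟨ε ^ (2 * s) * 2 ^ m * (B * c⁻¹) /
    ((1 - g) ^ 2) ^ p, ?_, ?_, ?_, ?_⟩, ?_, ?_⟩
  · unfold hgKernel
    have := hbc.measurable
    fun_prop
  · intro x θ θ'
    unfold hgKernel
    rw [hg_denominator]
    have := hin θ θ'
    have := hb0 x
    positivity
  · intro x θ θ'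
    unfold hgKernel
    rw [hg_denominator]
    have i1 := hin θ θ'
    have i2 := hb0 x
    have i3 : 0 < (1 - g) ^ 2 := by nlinarith
    have i4 : (1 - g) ^ 2 ≤ (1 - g) ^ 2 + 2 * g * (1 - inner ℝ (θ : Pos d) (θ' : Pos d)) := by
      have : 0 ≤ 2 * g * (1 - inner ℝ (θ : Pos d) (θ' : Pos d)) := by positivity
      linarith
    have i5 := hb1 x
    gcongr
    linarith
  · intro x θ θ'
    unfold hgKernel
    rw [real_inner_comm]
  · intro g hg hg1 x θ θ' hne
    have i1 := one_sub_inner_pos hne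
    have i2 := hb0 x
    have i0 := hσ.pos.le.trans (hσ.ge x)
    have e1 : 2 ^ p * (ε ^ (2 * s) * (diffCoeff s m b x * angKernel s θ θ')) =
        ε ^ (2 * s) * 2 ^ m * b x / (1 - inner ℝ (θ : Pos d) (θ' : Pos d)) ^ p := by
      rw [diffCoeff_mul_angKernel hd h0 h1, Real.mul_rpow (by norm_num) i1.le, ← hpdef]
      have : (0 : ℝ) < 2 ^ p := by positivity
      clear_value p
      field_simp
    have e2 : hgKernel s m ε b g x θ θ' ≤
        ε ^ (2 * s) * 2 ^ m * b x / (1 - inner ℝ (θ : Pos d) (θ' : Pos d)) ^ p := by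
      unfold hgKernel
      rw [hg_denominator]
      have i4 : 1 - inner ℝ (θ : Pos d) (θ' : Pos d) ≤
          (1 - g) ^ 2 + 2 * g * (1 - inner ℝ (θ : Pos d) (θ' : Pos d)) := by nlinarith [sq_nonneg (1 - g)]
      gcongr
      linarith
    refine e2.trans (e1.symm.le.trans ?_)
    have hK := angKernel_nonneg hd h0 h1 θ θ'
    rw [mul_assoc (2 ^ p), mul_assoc (ε ^ (2 * s))]
    have := hσ.le x
    gcongr
  · intro x θ θ' hne
    have i1 := one_sub_inner_pos hne
    rw [mul_assoc, diffCoeff_mul_angKernel hd h0 h1]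
    have hlim : Tendsto (fun g : ℝ => hgKernel s m ε b g x θ θ') (𝓝 1)
        (𝓝 (hgKernel s m ε b 1 x θ θ')) := by
      have hc : ContinuousAt (fun g : ℝ => hgKernel s m ε b g x θ θ') 1 := by
        unfold hgKernel
        have j1 : (1 : ℝ) + 1 ^ 2 - 2 * 1 * inner ℝ (θ : Pos d) (θ' : Pos d) ≠ 0 := by
          rw [hg_denominator]; nlinarith
        refine ContinuousAt.div ?_ ?_ ?_
        · exact ((continuousAt_const).mul ((continuousAt_const.add continuousAt_id).rpow_const
            (Or.inl (by norm_num)))).mul continuousAt_const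
        · exact ContinuousAt.rpow_const (by fun_prop) (Or.inl j1)
        · refine (Real.rpow_pos_of_pos ?_ _).ne'
          rw [hg_denominator]; nlinarith
      exact hc
    have e : hgKernel s m ε b 1 x θ θ' = ε ^ (2 * s) * (2 ^ m * b x /
        (2 * (1 - inner ℝ (θ : Pos d) (θ' : Pos d))) ^ p) := by
      unfold hgKernel
      rw [hg_denominator]
      norm_num
      ring
    rw [← e]
    exact hlim.mono_left nhdsWithin_le_nhds

end HenyeyGreenstein

/-! ### Dominated convergence and weak limits in `L²`. -/

section WeakConvergence

variable {X : Type*} [MeasurableSpace X] {μ : Measure X} {ι : Type*}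

lemma tendsto_eLpNorm_two_of_dominated {l : Filter ι} [l.IsCountablyGenerated] [l.NeBot]
    {F : ι → X → ℝ} {f H : X → ℝ} (hF : ∀ᶠ i in l, AEStronglyMeasurable (F i) μ)
    (hH : MemLp H 2 μ) (hb : ∀ᶠ i in l, ∀ x, |F i x| ≤ |H x|)
    (hlim : ∀ x, Tendsto (fun i => F i x) l (𝓝 (f x))) :
    Tendsto (fun i => eLpNorm (F i - f) 2 μ) l (𝓝 0) := by
  have hf : AEStronglyMeasurable f μ := by
    obtain ⟨i, hi⟩ := exists_seq_tendsto l
    obtain ⟨N, hN⟩ := eventually_atTop.1 (hi.eventually hF)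
    exact aestronglyMeasurable_of_tendsto_ae atTop (f := fun n => F (i (n + N)))
      (fun n => hN _ (Nat.le_add_left _ _))
      (Eventually.of_forall fun x => ((hlim x).comp hi).comp (tendsto_add_atTop_nat N))
  have hfH : ∀ x, |f x| ≤ |H x| := fun x =>
    le_of_tendsto (hlim x).abs (hb.mono fun i hi => hi x)
  have key : Tendsto (fun i => ∫⁻ x, ENNReal.ofReal ((F i - f) x ^ 2) ∂μ) l
      (𝓝 (∫⁻ _, 0 ∂μ)) := by
    refine tendsto_lintegral_filter_of_dominated_convergence'
      (fun x => ENNReal.ofReal (4 * H x ^ 2)) ?_ ?_ ?_ ?_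
    · filter_upwards [hF] with i hi
      exact ((hi.sub hf).aemeasurable.pow_const 2).ennreal_ofReal
    · filter_upwards [hb] with i hi
      refine Eventually.of_forall fun x => ENNReal.ofReal_le_ofReal ?_
      have h1 : |(F i - f) x| ≤ 2 * |H x| := by
        rw [Pi.sub_apply]
        refine (abs_sub _ _).trans ?_
        linarith [hi x, hfH x]
      calc (F i - f) x ^ 2 = |(F i - f) x| ^ 2 := (sq_abs _).symm
        _ ≤ (2 * |H x|) ^ 2 := by gcongr
        _ = _ := by rw [mul_pow, sq_abs]; norm_num
    · have := (memLp_two_iff_lintegral hH.1).1 hH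
      simp only [ENNReal.ofReal_mul (by norm_num : (0 : ℝ) ≤ 4)]
      rw [lintegral_const_mul' _ _ ENNReal.ofReal_ne_top]
      exact (ENNReal.mul_lt_top ENNReal.ofReal_lt_top this).ne
    · refine Eventually.of_forall fun x => ?_
      have : Tendsto (fun i => (F i - f) x ^ 2) l (𝓝 ((f x - f x) ^ 2)) :=
        ((hlim x).sub_const _).pow 2
      simpa using ENNReal.tendsto_ofReal this
  simp only [lintegral_zero, ← eLpNorm_two_sq] at key
  have h2 := key.ennrpow_const (1 / 2)
  rw [ENNReal.zero_rpow_of_pos (by norm_num)] at h2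
  refine h2.congr fun i => ?_
  rw [← ENNReal.rpow_natCast, ← ENNReal.rpow_mul]
  norm_num

lemma ae_eq_of_integral_mul_eq {F G : X → ℝ} (hF : MemLp F 2 μ) (hG : MemLp G 2 μ)
    (h : ∀ g, MemLp g 2 μ → ∫ x, F x * g x ∂μ = ∫ x, G x * g x ∂μ) : F =ᵐ[μ] G := by
  have h1 := h _ (hF.sub hG)
  have h2 := integrable_mul_of_memLp_two hF (hF.sub hG)
  have h3 := integrable_mul_of_memLp_two hG (hF.sub hG)
  have e : ∀ x, 1 * (F - G) x * (F - G) x = F x * (F - G) x - G x * (F - G) x := fun x => by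
    simp only [Pi.sub_apply]; ring
  have := ae_eq_zero_of_integral_weight_mul_sq (w := fun _ => 1) one_pos (hF.sub hG)
    (fun _ => le_rfl) (by simp only [e]; exact h2.sub h3)
    (by simp only [e]; rw [integral_sub h2 h3, h1, sub_self])
  filter_upwards [this] with x hx
  exact sub_eq_zero.1 hx

/-- The `L¹` norm on a set of finite measure is the pairing with the sign of `f` there, an `L²`
function of modulus at most `1`. Exhausting by such sets gives lower semicontinuity. -/
lemma eLpNorm_one_le_of_weak [SigmaFinite μ] {l : Filter ι} [l.NeBot] {F : ι → X → ℝ} {f : X → ℝ}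
    (hF : ∀ᶠ i in l, MemLp (F i) 2 μ) (hf : MemLp f 2 μ)
    (hw : ∀ g, MemLp g 2 μ → Tendsto (fun i => ∫ x, F i x * g x ∂μ) l (𝓝 (∫ x, f x * g x ∂μ)))
    {B : ℝ≥0∞} (hB : ∀ᶠ i in l, eLpNorm (F i) 1 μ ≤ B) : eLpNorm f 1 μ ≤ B := by
  rcases eq_or_ne B ⊤ with rfl | hBt
  · exact le_top
  obtain ⟨f', hf'm, hff'⟩ := hf.1
  set S := spanningSets μ with hS
  have hSm : ∀ n, MeasurableSet (S n) := measurableSet_spanningSets μ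
  have hn : ∀ n, ∫⁻ x in S n, ‖f' x‖ₑ ∂μ ≤ B := by
    intro n
    set ψ : X → ℝ := (S n).indicator fun x => if 0 ≤ f' x then 1 else -1 with hψ
    have hψm : Measurable ψ :=
      (Measurable.ite (measurableSet_le measurable_const hf'm.measurable) measurable_const
        measurable_const).indicator (hSm n)
    have hψ1 : ∀ x, |ψ x| ≤ 1 := by
      intro x
      simp only [hψ, indicator]
      split_ifs <;> simp
    have hψL : MemLp ψ 2 μ := by
      refine MemLp.mono' (memLp_indicator_const 2 (hSm n) (1 : ℝ)
        (Or.inr (measure_spanningSets_lt_top μ n).ne)) hψm.aestronglyMeasurable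
        (Eventually.of_forall fun x => ?_)
      simp only [hψ, indicator]
      split_ifs <;> simp
    have e : ∀ x, f' x * ψ x = (S n).indicator (fun x => |f' x|) x := by
      intro x
      simp only [hψ, indicator]
      split_ifs with h1 h2
      · rw [abs_of_nonneg h2, mul_one]
      · rw [abs_of_neg (not_le.1 h2)]; ring
      · ring
    have hle : ∫ x, f x * ψ x ∂μ ≤ B.toReal := by
      refine le_of_tendsto (hw ψ hψL) ?_
      filter_upwards [hF, hB] with i hi hBi
      have hint : Integrable (F i) μ :=
        memLp_one_iff_integrable.1 ⟨hi.1, hBi.trans_lt hBt.lt_top⟩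
      have : ∫ x, |F i x| ∂μ = (eLpNorm (F i) 1 μ).toReal := by
        rw [eLpNorm_one_eq_lintegral_enorm, ← integral_norm_eq_lintegral_enorm hi.1]
        rfl
      calc ∫ x, F i x * ψ x ∂μ ≤ ∫ x, |F i x| ∂μ := by
            refine integral_mono (integrable_mul_of_memLp_two hi hψL) hint.abs fun x => ?_
            refine (le_abs_self _).trans ?_
            rw [abs_mul]
            exact mul_le_of_le_one_right (abs_nonneg _) (hψ1 x)
        _ ≤ B.toReal := this ▸ ENNReal.toReal_mono hBt hBi
    have h3 : ∫ x, f x * ψ x ∂μ = ∫ x in S n, ‖f' x‖ ∂μ := by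
      rw [← integral_indicator (hSm n)]
      refine integral_congr_ae ?_
      filter_upwards [hff'] with x hx
      rw [hx, e]
      rfl
    have hi : Integrable f' (μ.restrict (S n)) := by
      have : IsFiniteMeasure (μ.restrict (S n)) :=
        ⟨by rw [Measure.restrict_apply_univ]; exact measure_spanningSets_lt_top μ n⟩
      exact (((memLp_congr_ae hff').1 hf).restrict (S n)).integrable (by norm_num)
    rw [h3, integral_norm_eq_lintegral_enorm hi.1] at hle
    rwa [ENNReal.toReal_le_toReal hi.2.ne hBt] at hle
  rw [eLpNorm_congr_ae hff', eLpNorm_one_eq_lintegral_enorm, ← setLIntegral_univ,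
    ← iUnion_spanningSets μ, setLIntegral_iUnion_of_directed _
      (monotone_spanningSets μ).directed_le]
  exact iSup_le hn

end WeakConvergence

/-! ### Weak continuity of the jump. -/

section JumpDuality

variable {d : ℕ}

/-- The adjoint of the jump maps `L²` to `L²`, so weak convergence of functions transfers to their
jumps. -/
lemma integral_jump_mul {u : Phase d → ℝ} (hu : MemLp u 2 (phaseMeasure d))
    {H : Pos d × (Dir d × Dir d) → ℝ} (hH : MemLp H 2 (pairMeasure d)) :
    ∫ q, jump u q * H q ∂(pairMeasure d) =
      ∫ p, u p * ∫ b, (H (p.1, (p.2, b)) - H (p.1, (b, p.2))) ∂(dirMeasure d)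
        ∂(phaseMeasure d) := by
  have hHs : MemLp (fun q : Pos d × (Dir d × Dir d) => H (q.1, q.2.swap)) 2 (pairMeasure d) :=
    hH.comp_measurePreserving measurePreserving_pair_swap
  have i1 := integrable_mul_of_memLp_two (memLp_pair_fst hu) hH
  have i2 := integrable_mul_of_memLp_two (memLp_pair_snd hu) hH
  have i3 := integrable_mul_of_memLp_two (memLp_pair_fst hu) hHs
  have e1 : ∫ q, jump u q * H q ∂(pairMeasure d) =
      ∫ q : Pos d × (Dir d × Dir d), u (q.1, q.2.1) * H q ∂(pairMeasure d) -
      ∫ q : Pos d × (Dir d × Dir d), u (q.1, q.2.2) * H q ∂(pairMeasure d) := by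
    rw [← integral_sub i1 i2]
    congr 1; funext q
    simp only [jump]; ring
  rw [e1, ← integral_pair_swap fun q : Pos d × (Dir d × Dir d) => u (q.1, q.2.2) * H q]
  simp only [Prod.snd_swap]
  rw [← integral_sub i1 i3]
  refine (integral_pairMeasure (i1.sub i3)).trans ?_
  congr 1; funext p
  rw [← integral_const_mul]
  congr 1; funext b
  simp only [Pi.sub_apply, Prod.swap_prod_mk]
  ring

lemma exists_eLpNorm_jump_le (d : ℕ) : ∃ C : ℝ≥0, ∀ u : Phase d → ℝ,
    MemLp u 2 (phaseMeasure d) → eLpNorm (jump u) 2 (pairMeasure d) ≤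
      C * eLpNorm u 2 (phaseMeasure d) := by
  refine ⟨2 * (dirMeasure d univ).toNNReal ^ (1 / (2 : ℝ)), fun u hu => ?_⟩
  have h1 := memLp_comp_of_map_le (by fun_prop) map_pair_fst_le hu
  have h2 := memLp_comp_of_map_le (by fun_prop) map_pair_snd_le hu
  refine (eLpNorm_sub_le h1.1.1 h2.1.1 (by norm_num)).trans ((add_le_add h1.2 h2.2).trans ?_)
  rw [ENNReal.coe_mul, ENNReal.coe_rpow_of_nonneg _ (by norm_num), mul_assoc, ENNReal.coe_ofNat,
    two_mul]

lemma tendsto_integral_jump_mul {ι : Type*} {l : Filter ι} {F : ι → Phase d → ℝ}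
    {u : Phase d → ℝ} (hF : ∀ᶠ i in l, MemLp (F i) 2 (phaseMeasure d))
    (hu : MemLp u 2 (phaseMeasure d))
    (hw : ∀ g, MemLp g 2 (phaseMeasure d) → Tendsto (fun i => ∫ p, F i p * g p ∂(phaseMeasure d)) l
      (𝓝 (∫ p, u p * g p ∂(phaseMeasure d))))
    {H : Pos d × (Dir d × Dir d) → ℝ} (hH : MemLp H 2 (pairMeasure d)) :
    Tendsto (fun i => ∫ q, jump (F i) q * H q ∂(pairMeasure d)) l
      (𝓝 (∫ q, jump u q * H q ∂(pairMeasure d))) := by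
  rw [integral_jump_mul hu hH]
  have hHs : MemLp (fun q : Pos d × (Dir d × Dir d) => H (q.1, q.2.swap)) 2 (pairMeasure d) :=
    hH.comp_measurePreserving measurePreserving_pair_swap
  refine (hw _ (memLp_integral_pair (hH.sub hHs))).congr' ?_
  filter_upwards [hF] with i hi
  rw [integral_jump_mul hi hH]
  rfl

end JumpDuality

/-! ### Passage to the limit `g → 1`. -/

section Limit

variable {d : ℕ}

/-- The angular difference weighted with the square root of a kernel. -/
noncomputable def kernelJump (k : Pos d → Dir d → Dir d → ℝ) (u : Phase d → ℝ)
    (q : Pos d × (Dir d × Dir d)) : ℝ := √(k q.1 q.2.1 q.2.2) * jump u q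

lemma IsScatteringKernel.memLp_kernelJump {k : Pos d → Dir d → Dir d → ℝ} {M : ℝ}
    (hk : IsScatteringKernel k M) {u : Phase d → ℝ} (hu : MemLp u 2 (phaseMeasure d)) :
    MemLp (kernelJump k u) 2 (pairMeasure d) :=
  memLp_two_mul_of_bound (memLp_jump hu) hk.measurable.sqrt.aestronglyMeasurable
    fun q => by rw [abs_of_nonneg (Real.sqrt_nonneg _)]; exact Real.sqrt_le_sqrt (hk.le _ _ _)

lemma IsScatteringKernel.scatterForm_eq {k : Pos d → Dir d → Dir d → ℝ} {M : ℝ}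
    (hk : IsScatteringKernel k M) (u φ : Phase d → ℝ) :
    scatterForm k u φ = 1 / 2 * ∫ q, kernelJump k u q * kernelJump k φ q ∂(pairMeasure d) := by
  unfold scatterForm kernelJump
  congr 2; funext q
  have := Real.mul_self_sqrt (hk.nonneg q.1 q.2.1 q.2.2)
  linear_combination -(jump u q * jump φ q) * this

/-- By the energy identity half the square of this norm is at most `‖f‖ ‖u‖ ≤ c⁻¹ ‖f‖²`. The bound
does not involve `M`, hence not `g` either. -/
lemma IsRTESolution.eLpNorm_kernelJump_le {lam : Pos d → ℝ} {c : ℝ} (hl : IsAbsorption lam c)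
    {k : Pos d → Dir d → Dir d → ℝ} {M : ℝ} (hk : IsScatteringKernel k M)
    {f u : Phase d → ℝ} (hf : MemLp f 2 (phaseMeasure d)) (h : IsRTESolution lam k f u) :
    eLpNorm (kernelJump k u) 2 (pairMeasure d) ≤
      (√(2 * c⁻¹ * (eLpNorm f 2 (phaseMeasure d)).toReal ^ 2)).toNNReal := by
  have hD := hk.memLp_kernelJump h.1
  have h1 := integral_sq_eq hD
  have h2 := h.energy hl hk hf
  have h3 : 0 ≤ ∫ p, lam p.1 * u p * u p ∂(phaseMeasure d) := integral_nonneg fun p => by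
    have := hl.pos.le.trans (hl.ge p.1)
    simp only [Pi.zero_apply]
    nlinarith [mul_nonneg this (mul_self_nonneg (u p))]
  have h4 := (le_abs_self _).trans (abs_integral_mul_le hf h.1)
  have h5 := h.eLpNorm_two_le hl hk hf
  rw [hk.scatterForm_eq, h1] at h2
  rw [← ENNReal.ofReal_toReal hD.2.ne]
  refine ENNReal.ofReal_le_ofReal (Real.le_sqrt_of_sq_le ?_)
  have h6 : (0 : ℝ) ≤ (eLpNorm f 2 (phaseMeasure d)).toReal := ENNReal.toReal_nonneg
  nlinarith [mul_le_mul_of_nonneg_left h5 h6]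

/-- A weight that removes the singularity of the angular kernel. -/
noncomputable def angWeight (s : ℝ) (q : Pos d × (Dir d × Dir d)) : ℝ :=
  √((1 - inner ℝ (q.2.1 : Pos d) (q.2.2 : Pos d)) ^ (((d : ℝ) - 1) / 2 + s))

lemma measurable_angWeight (s : ℝ) : Measurable (angWeight (d := d) s) := by
  unfold angWeight; fun_prop

lemma angWeight_diag (hd : 2 ≤ d) {s : ℝ} (h0 : 0 < s) {q : Pos d × (Dir d × Dir d)}
    (h : q.2.1 = q.2.2) : angWeight s q = 0 := by
  rw [angWeight, h, real_inner_self_eq_norm_sq, norm_dir]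
  simp [Real.zero_rpow (angExp_pos hd h0).ne']

lemma abs_angWeight_le (hd : 2 ≤ d) {s : ℝ} (h0 : 0 < s) (q : Pos d × (Dir d × Dir d)) :
    |angWeight s q| ≤ √(2 ^ (((d : ℝ) - 1) / 2 + s)) := by
  rw [angWeight, abs_of_nonneg (Real.sqrt_nonneg _)]
  refine Real.sqrt_le_sqrt (Real.rpow_le_rpow (one_sub_inner_nonneg _ _) ?_ (angExp_pos hd h0).le)
  have := neg_le_of_abs_le (abs_real_inner_le_norm (q.2.1 : Pos d) (q.2.2 : Pos d))
  rw [norm_dir, norm_dir] at this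
  linarith

/-- The kernel is at most `A` times the angular kernel, whose product with the square of the weight
is constant off the diagonal. -/
lemma IsKernelApprox.abs_sqrt_mul_angWeight_le (hd : 2 ≤ d) {s : ℝ} (h0 : 0 < s) {e : ℝ}
    {σ : Pos d → ℝ} {k : ℝ → Pos d → Dir d → Dir d → ℝ} {A : ℝ} (hk : IsKernelApprox s e σ k A)
    {g : ℝ} (hg : 1 / 2 ≤ g) (hg1 : g < 1) (q : Pos d × (Dir d × Dir d)) :
    |√(k g q.1 q.2.1 q.2.2) * angWeight s q| ≤ √(A * angConst d s) := by
  by_cases h : q.2.1 = q.2.2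
  · rw [angWeight_diag hd h0 h, mul_zero, abs_zero]
    exact Real.sqrt_nonneg _
  · obtain ⟨M, hM⟩ := hk.kernel g (by linarith) hg1
    have h1 := hk.le g hg hg1 q.1 _ _ h
    have h2 := one_sub_inner_pos h
    have h3 : 0 < (1 - inner ℝ (q.2.1 : Pos d) (q.2.2 : Pos d)) ^ (((d : ℝ) - 1) / 2 + s) :=
      Real.rpow_pos_of_pos h2 _
    rw [angWeight, abs_of_nonneg (mul_nonneg (Real.sqrt_nonneg _) (Real.sqrt_nonneg _)),
      ← Real.sqrt_mul (hM.nonneg _ _ _)]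
    refine Real.sqrt_le_sqrt ((mul_le_mul_of_nonneg_right h1 h3.le).trans (le_of_eq ?_))
    rw [angKernel_eq, mul_assoc, div_mul_cancel₀ _ h3.ne']

lemma eventually_half_le_lt_one : ∀ᶠ g : ℝ in 𝓝[<] 1, 1 / 2 ≤ g ∧ g < 1 :=
  mem_of_superset (Ico_mem_nhdsLT (by norm_num : (1 / 2 : ℝ) < 1)) fun _ h => h

lemma fracJump_diag (s : ℝ) (u : Phase d → ℝ) {q : Pos d × (Dir d × Dir d)} (h : q.2.1 = q.2.2) :
    fracJump s u q = 0 := by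
  simp [fracJump, jump, h]

variable {s e : ℝ} {σ lam : Pos d → ℝ} {k : ℝ → Pos d → Dir d → Dir d → ℝ} {A c c' : ℝ}

/-- Dominated convergence, with a multiple of the weighted jump of `v` as majorant. Finite energy of
`v` makes the convergence strong. -/
lemma IsKernelApprox.tendsto_kernelJump (hd : 2 ≤ d) (h0 : 0 < s) (h1 : s < 1)
    (hk : IsKernelApprox s e σ k A) (hσ : IsAbsorption σ c') (he : 0 < e) {v : Phase d → ℝ}
    (hv : MemLp v 2 (phaseMeasure d)) (hDv : MemLp (fracJump s v) 2 (pairMeasure d)) :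
    Tendsto (fun g => eLpNorm (kernelJump (k g) v - fun q => √(e * σ q.1) * fracJump s v q) 2
      (pairMeasure d)) (𝓝[<] 1) (𝓝 0) := by
  refine tendsto_eLpNorm_two_of_dominated (H := fun q => √A * fracJump s v q) ?_
    (hDv.const_mul _) ?_ ?_
  · filter_upwards [eventually_half_le_lt_one] with g hg
    obtain ⟨M, hM⟩ := hk.kernel g (by linarith) hg.2
    exact (hM.memLp_kernelJump hv).1
  · filter_upwards [eventually_half_le_lt_one] with g hg q
    by_cases h : q.2.1 = q.2.2
    · rw [kernelJump, jump, h, sub_self, mul_zero, abs_zero]; exact abs_nonneg _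
    · have h2 := hk.le g hg.1 hg.2 q.1 _ _ h
      have hK := angKernel_nonneg hd h0 h1 q.2.1 q.2.2
      rw [kernelJump, fracJump, ← mul_assoc, ← Real.sqrt_mul' _ hK, abs_mul, abs_mul,
        abs_of_nonneg (Real.sqrt_nonneg _), abs_of_nonneg (Real.sqrt_nonneg _)]
      exact mul_le_mul_of_nonneg_right (Real.sqrt_le_sqrt h2) (abs_nonneg _)
  · intro q
    by_cases h : q.2.1 = q.2.2
    · simp [kernelJump, fracJump, jump, h]
    · have h3 := (hk.tendsto q.1 _ _ h).sqrt.mul_const (jump v q)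
      rwa [Real.sqrt_mul (mul_nonneg he.le (hσ.pos.le.trans (hσ.ge _))), mul_assoc] at h3

/-- In the weak form both functions carry `√k_g`. The weighted jumps of the solutions are bounded
and converge weakly to some `W`, while those of a test function converge strongly. It remains to
recognize `W` as `√(e σ)` times the weighted jump of `u`. -/
theorem IsEnergySolution.of_weak_limit (hd : 2 ≤ d) (h0 : 0 < s) (h1 : s < 1) {ε : ℝ} (hε : 0 < ε)
    (hl : IsAbsorption lam c) (hσ : IsAbsorption σ c') (hk : IsKernelApprox s (ε ^ (2 * s)) σ k A)
    {f : Phase d → ℝ} (hf : MemLp f 2 (phaseMeasure d)) {uu : ℝ → Phase d → ℝ}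
    (hR : ∀ g, 0 < g → g < 1 → IsRTESolution lam (k g) f (uu g)) {𝒰 : Ultrafilter ℝ}
    (h𝒰 : (𝒰 : Filter ℝ) ≤ 𝓝[<] 1) {u : Phase d → ℝ} (hu : MemLp u 2 (phaseMeasure d))
    (hw : ∀ G, MemLp G 2 (phaseMeasure d) → Tendsto (fun g => ∫ p, uu g p * G p ∂(phaseMeasure d))
      𝒰 (𝓝 (∫ p, u p * G p ∂(phaseMeasure d)))) :
    IsEnergySolution s ε lam σ f u := by
  set e : ℝ := ε ^ (2 * s) with hedef
  have he : 0 < e := by positivity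
  have hev : ∀ᶠ g in (𝒰 : Filter ℝ), 1 / 2 ≤ g ∧ g < 1 := h𝒰 eventually_half_le_lt_one
  have hu2 : ∀ᶠ g in (𝒰 : Filter ℝ), MemLp (uu g) 2 (phaseMeasure d) :=
    hev.mono fun g hg => (hR g (by linarith) hg.2).1
  set C := (√(2 * c⁻¹ * (eLpNorm f 2 (phaseMeasure d)).toReal ^ 2)).toNNReal with hC
  have hDb : ∀ᶠ g in (𝒰 : Filter ℝ), MemLp (kernelJump (k g) (uu g)) 2 (pairMeasure d) ∧
      eLpNorm (kernelJump (k g) (uu g)) 2 (pairMeasure d) ≤ C := by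
    filter_upwards [hev] with g hg
    obtain ⟨M, hM⟩ := hk.kernel g (by linarith) hg.2
    have := hR g (by linarith) hg.2
    exact ⟨hM.memLp_kernelJump this.1, this.eLpNorm_kernelJump_le hl hM hf⟩
  obtain ⟨W, hW, hWw⟩ := exists_weak_limit 𝒰 hDb
  have heσ : ∀ x, 0 < e * σ x := fun x => mul_pos he (hσ.pos.trans_le (hσ.ge x))
  -- The product `√k_g · angWeight` is bounded and converges pointwise, so against an `L²` function
  -- it converges strongly; the plain jumps converge weakly. The limit of their product determines
  -- `angWeight · W`.
  have hid : (fun q => angWeight s q * W q) =ᵐ[pairMeasure d]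
      fun q => (√(e * σ q.1 * angKernel s q.2.1 q.2.2) * angWeight s q) * jump u q := by
    have hωm : AEStronglyMeasurable (angWeight (d := d) s) (pairMeasure d) :=
      (measurable_angWeight s).aestronglyMeasurable
    have hrb : ∀ᶠ g in 𝓝[<] (1 : ℝ), ∀ q : Pos d × (Dir d × Dir d),
        |√(k g q.1 q.2.1 q.2.2) * angWeight s q| ≤ √(A * angConst d s) :=
      eventually_half_le_lt_one.mono fun g hg => hk.abs_sqrt_mul_angWeight_le hd h0 hg.1 hg.2
    have hrl : ∀ q : Pos d × (Dir d × Dir d),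
        Tendsto (fun g => √(k g q.1 q.2.1 q.2.2) * angWeight s q) (𝓝[<] 1)
          (𝓝 (√(e * σ q.1 * angKernel s q.2.1 q.2.2) * angWeight s q)) := by
      intro q
      by_cases h : q.2.1 = q.2.2
      · simp [angWeight_diag hd h0 h]
      · exact (hk.tendsto q.1 _ _ h).sqrt.mul_const _
    have hrm : Measurable fun q : Pos d × (Dir d × Dir d) =>
        √(e * σ q.1 * angKernel s q.2.1 q.2.2) * angWeight s q := by
      have h3 := hσ.continuous.measurable
      have h4 := (measurable_angKernel (d := d) s).comp
        (measurable_snd : Measurable fun q : Pos d × (Dir d × Dir d) => q.2)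
      exact (((h3.comp measurable_fst).const_mul e).mul h4).sqrt.mul (measurable_angWeight s)
    have hrB : ∀ q : Pos d × (Dir d × Dir d),
        |√(e * σ q.1 * angKernel s q.2.1 q.2.2) * angWeight s q| ≤ √(A * angConst d s) :=
      fun q => le_of_tendsto (hrl q).abs (hrb.mono fun g hg => hg q)
    have mrG : ∀ {G}, MemLp G 2 (pairMeasure d) → MemLp (fun q => (√(e * σ q.1 *
        angKernel s q.2.1 q.2.2) * angWeight s q) * G q) 2 (pairMeasure d) := fun hG =>
      memLp_two_mul_of_bound hG hrm.aestronglyMeasurable hrB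
    have mω : ∀ {G}, MemLp G 2 (pairMeasure d) →
        MemLp (fun q => angWeight s q * G q) 2 (pairMeasure d) := fun hG =>
      memLp_two_mul_of_bound hG hωm (abs_angWeight_le hd h0)
    refine ae_eq_of_integral_mul_eq (mω hW) (mrG (memLp_jump hu)) fun G hG => ?_
    have t1 := hWw _ (mω hG)
    have hrk : ∀ᶠ g in 𝓝[<] (1 : ℝ), MemLp (fun q => (√(k g q.1 q.2.1 q.2.2) * angWeight s q) *
        G q) 2 (pairMeasure d) := by
      filter_upwards [hrb, eventually_half_le_lt_one] with g hg hg'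
      obtain ⟨M, hM⟩ := hk.kernel g (by linarith) hg'.2
      exact memLp_two_mul_of_bound hG
        (hM.measurable.sqrt.mul (measurable_angWeight s)).aestronglyMeasurable hg
    have t2 := tendsto_eLpNorm_two_of_dominated (l := 𝓝[<] (1 : ℝ))
      (F := fun g q => (√(k g q.1 q.2.1 q.2.2) * angWeight s q) * G q)
      (f := fun q => (√(e * σ q.1 * angKernel s q.2.1 q.2.2) * angWeight s q) * G q)
      (H := fun q => √(A * angConst d s) * G q) (hrk.mono fun g hg => hg.1) (hG.const_mul _)
      (by
        filter_upwards [hrb] with g hg q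
        rw [abs_mul, abs_mul (√(A * angConst d s)), abs_of_nonneg (Real.sqrt_nonneg (A * _))]
        exact mul_le_mul_of_nonneg_right (hg q) (abs_nonneg _))
      (fun q => (hrl q).mul_const _)
    set C1 : ℝ := c⁻¹ * (eLpNorm f 2 (phaseMeasure d)).toReal with hC1
    have hjb : ∃ C2 : ℝ≥0, ∀ᶠ g in (𝒰 : Filter ℝ), eLpNorm (jump (uu g)) 2 (pairMeasure d) ≤ C2 := by
      obtain ⟨C3, hC3⟩ := exists_eLpNorm_jump_le d
      refine ⟨C3 * C1.toNNReal, ?_⟩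
      filter_upwards [hev] with g hg
      obtain ⟨M, hM⟩ := hk.kernel g (by linarith) hg.2
      have h4 := hR g (by linarith) hg.2
      refine (hC3 _ h4.1).trans ?_
      rw [ENNReal.coe_mul]
      gcongr
      rw [← ENNReal.ofReal_toReal h4.1.2.ne]
      exact ENNReal.ofReal_le_ofReal (h4.eLpNorm_two_le hl hM hf)
    obtain ⟨C2, hC2⟩ := hjb
    have t3 := tendsto_integral_mul_of_weak_of_strong (hu2.mono fun g hg => memLp_jump hg) hC2
      (h𝒰 hrk) (mrG hG) (tendsto_integral_jump_mul hu2 hu hw (mrG hG)) (t2.mono_left h𝒰)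
    have e1 : ∫ q, angWeight s q * W q * G q ∂(pairMeasure d) =
        ∫ q, W q * (angWeight s q * G q) ∂(pairMeasure d) := by
      congr 1; funext q; ring
    have e2 : ∫ q, (√(e * σ q.1 * angKernel s q.2.1 q.2.2) * angWeight s q) * jump u q * G q
        ∂(pairMeasure d) = ∫ q, jump u q * ((√(e * σ q.1 * angKernel s q.2.1 q.2.2) *
          angWeight s q) * G q) ∂(pairMeasure d) := by
      congr 1; funext q; ring
    rw [e1, e2]
    refine tendsto_nhds_unique t1 (t3.congr fun g => ?_)
    congr 1; funext q
    simp only [kernelJump]; ring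
  -- The weight is positive off the diagonal and can be cancelled. Nothing has to be known about `W`
  -- on the diagonal, since every jump paired with it vanishes there.
  have hWoff : ∀ᵐ q ∂(pairMeasure d), q.2.1 ≠ q.2.2 → W q = √(e * σ q.1) * fracJump s u q := by
    filter_upwards [hid] with q hq hne
    have h2 : 0 < angWeight s q := Real.sqrt_pos.2 (Real.rpow_pos_of_pos (one_sub_inner_pos hne) _)
    rw [Real.sqrt_mul (heσ q.1).le] at hq
    refine mul_left_cancel₀ h2.ne' (hq.trans ?_)
    rw [fracJump]; ring
  -- The lower bound `c'` of `σ` lets `W` dominate the weighted jump of `u`, so finite energy of the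
  -- limit comes from `W` being in `L²`.
  have hDu : MemLp (fracJump s u) 2 (pairMeasure d) := by
    have h2 : √(e * c') ≠ 0 := (Real.sqrt_pos.2 (mul_pos he hσ.pos)).ne'
    refine MemLp.mono (hW.const_mul (√(e * c'))⁻¹) (aestronglyMeasurable_fracJump s hu.1) ?_
    filter_upwards [hWoff] with q hq
    by_cases h : q.2.1 = q.2.2
    · rw [fracJump_diag s u h, norm_zero]; exact norm_nonneg _
    · rw [hq h, norm_mul, norm_mul, norm_inv, ← mul_assoc, Real.norm_of_nonneg (Real.sqrt_nonneg _),
        Real.norm_of_nonneg (Real.sqrt_nonneg _)]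
      refine le_mul_of_one_le_left (norm_nonneg _) ?_
      rw [inv_mul_eq_div, one_le_div (by positivity)]
      exact Real.sqrt_le_sqrt (mul_le_mul_of_nonneg_left (hσ.ge _) he.le)
  refine ⟨hu, hDu, fun φ hφ => ?_⟩
  have hDφ := hφ.memLp_fracJump hd h0 h1
  have mσφ : MemLp (fun q => √(e * σ q.1) * fracJump s (onPhase φ) q) 2 (pairMeasure d) := by
    refine memLp_two_mul_of_bound hDφ (M := √(e * c'⁻¹)) ?_ fun q => ?_
    · exact ((hσ.continuous.measurable.comp measurable_fst).const_mul e).sqrt.aestronglyMeasurable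
    · rw [abs_of_nonneg (Real.sqrt_nonneg _)]
      exact Real.sqrt_le_sqrt (mul_le_mul_of_nonneg_left (hσ.le _) he.le)
  have t1 := hw _ (hφ.memLp_transport 2)
  have t2 := hw _ (hl.memLp_mul measurable_fst (hφ.memLp 2))
  have hφk : ∀ᶠ g in (𝒰 : Filter ℝ), MemLp (kernelJump (k g) (onPhase φ)) 2 (pairMeasure d) := by
    filter_upwards [hev] with g hg
    obtain ⟨M, hM⟩ := hk.kernel g (by linarith) hg.2
    exact hM.memLp_kernelJump (hφ.memLp 2)
  have t3 := tendsto_integral_mul_of_weak_of_strong (hDb.mono fun g hg => hg.1)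
    (hDb.mono fun g hg => hg.2) hφk mσφ (hWw _ mσφ)
    ((hk.tendsto_kernelJump hd h0 h1 hσ he (hφ.memLp 2) hDφ).mono_left h𝒰)
  have t4 := (t1.neg.add t2).add (t3.const_mul (1 / 2))
  have e4 : ∀ᶠ g in (𝒰 : Filter ℝ), -∫ p, uu g p * transport φ p ∂(phaseMeasure d) +
      ∫ p, uu g p * (lam p.1 * onPhase φ p) ∂(phaseMeasure d) +
      1 / 2 * ∫ q, kernelJump (k g) (uu g) q * kernelJump (k g) (onPhase φ) q ∂(pairMeasure d) =
      ∫ p, f p * onPhase φ p ∂(phaseMeasure d) := by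
    filter_upwards [hev] with g hg
    obtain ⟨M, hM⟩ := hk.kernel g (by linarith) hg.2
    rw [← (hR g (by linarith) hg.2).weak_form hl hM hf hφ, hM.scatterForm_eq]
    congr 3; funext p; ring
  have h5 := tendsto_nhds_unique (t4.congr' e4) tendsto_const_nhds
  have e5 : ∫ q, W q * (√(e * σ q.1) * fracJump s (onPhase φ) q) ∂(pairMeasure d) =
      e * ∫ q, σ q.1 * fracJump s u q * fracJump s (onPhase φ) q ∂(pairMeasure d) := by
    rw [← integral_const_mul]
    refine integral_congr_ae ?_
    filter_upwards [hWoff] with q hq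
    by_cases h : q.2.1 = q.2.2
    · simp [fracJump_diag s (onPhase φ) h]
    · rw [hq h]
      have := Real.mul_self_sqrt (heσ q.1).le
      linear_combination (fracJump s u q * fracJump s (onPhase φ) q) * this
  have e6 : ∫ p, lam p.1 * u p * onPhase φ p ∂(phaseMeasure d) =
      ∫ p, u p * (lam p.1 * onPhase φ p) ∂(phaseMeasure d) := by
    congr 1; funext p; ring
  rw [e5] at h5
  rw [e6]
  linarith

end Limit

/-! ### Existence, weak convergence and `L¹` bound for energy solutions. -/

section EnergySolutions

variable {d : ℕ} {s ε : ℝ} {σ lam : Pos d → ℝ} {k : ℝ → Pos d → Dir d → Dir d → ℝ} {A c c' : ℝ}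

lemma IsEnergySolution.sub (hd : 2 ≤ d) (h0 : 0 < s) (h1 : s < 1) (hl : IsAbsorption lam c)
    (hσ : IsAbsorption σ c') {f g u v : Phase d → ℝ} (hf : MemLp f 2 (phaseMeasure d))
    (hg : MemLp g 2 (phaseMeasure d)) (hu : IsEnergySolution s ε lam σ f u)
    (hv : IsEnergySolution s ε lam σ g v) : IsEnergySolution s ε lam σ (f - g) (u - v) := by
  refine ⟨hu.memLp.sub hv.memLp, ?_, fun φ hφ => ?_⟩
  · rw [fracJump_sub]; exact hu.memLp_fracJump.sub hv.memLp_fracJump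
  have hDφ := hφ.memLp_fracJump hd h0 h1
  have a1 := hu.weak φ hφ
  have a2 := hv.weak φ hφ
  have e1 : ∫ p, (u - v) p * transport φ p ∂(phaseMeasure d) =
      ∫ p, u p * transport φ p ∂(phaseMeasure d) - ∫ p, v p * transport φ p ∂(phaseMeasure d) := by
    rw [← integral_sub (integrable_mul_of_memLp_two hu.memLp (hφ.memLp_transport 2))
      (integrable_mul_of_memLp_two hv.memLp (hφ.memLp_transport 2))]
    congr 1; funext p; simp only [Pi.sub_apply]; ring
  have e2 : ∫ p, lam p.1 * (u - v) p * onPhase φ p ∂(phaseMeasure d) =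
      ∫ p, lam p.1 * u p * onPhase φ p ∂(phaseMeasure d) -
        ∫ p, lam p.1 * v p * onPhase φ p ∂(phaseMeasure d) := by
    rw [← integral_sub
      (integrable_mul_of_memLp_two (hl.memLp_mul measurable_fst hu.memLp) (hφ.memLp 2))
      (integrable_mul_of_memLp_two (hl.memLp_mul measurable_fst hv.memLp) (hφ.memLp 2))]
    congr 1; funext p; simp only [Pi.sub_apply]; ring
  have e3 : ∫ q, σ q.1 * fracJump s (u - v) q * fracJump s (onPhase φ) q ∂(pairMeasure d) =
      ∫ q, σ q.1 * fracJump s u q * fracJump s (onPhase φ) q ∂(pairMeasure d) -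
        ∫ q, σ q.1 * fracJump s v q * fracJump s (onPhase φ) q ∂(pairMeasure d) := by
    rw [← integral_sub
      (integrable_mul_of_memLp_two (hσ.memLp_mul measurable_fst hu.memLp_fracJump) hDφ)
      (integrable_mul_of_memLp_two (hσ.memLp_mul measurable_fst hv.memLp_fracJump) hDφ)]
    congr 1; funext p; rw [fracJump_sub]; simp only [Pi.sub_apply]; ring
  have e4 : ∫ p, (f - g) p * onPhase φ p ∂(phaseMeasure d) =
      ∫ p, f p * onPhase φ p ∂(phaseMeasure d) - ∫ p, g p * onPhase φ p ∂(phaseMeasure d) := by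
    rw [← integral_sub (integrable_mul_of_memLp_two hf (hφ.memLp 2))
      (integrable_mul_of_memLp_two hg (hφ.memLp 2))]
    congr 1; funext p; simp only [Pi.sub_apply]; ring
  rw [e1, e2, e3, e4]
  linear_combination a1 - a2

lemma IsEnergySolution.ae_unique (hd : 2 ≤ d) (h0 : 0 < s) (h1 : s < 1) (hε : 0 < ε)
    (hl : IsAbsorption lam c) (hσ : IsAbsorption σ c') {f u v : Phase d → ℝ}
    (hf : MemLp f 2 (phaseMeasure d)) (hu : IsEnergySolution s ε lam σ f u)
    (hv : IsEnergySolution s ε lam σ f v) : u =ᵐ[phaseMeasure d] v := by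
  have h2 := hu.sub hd h0 h1 hl hσ hf hf hv
  rw [sub_self] at h2
  filter_upwards [h2.ae_eq_zero hd h0 h1 hε hl hσ fun φ hφ => hφ.memLp_fracJump hd h0 h1] with p hp
  exact sub_eq_zero.1 hp

lemma exists_isEnergySolution_of_ultrafilter (hd : 2 ≤ d) (h0 : 0 < s) (h1 : s < 1) (hε : 0 < ε)
    (hl : IsAbsorption lam c) (hσ : IsAbsorption σ c') (hk : IsKernelApprox s (ε ^ (2 * s)) σ k A)
    {f : Phase d → ℝ} (hf : MemLp f 2 (phaseMeasure d)) {uu : ℝ → Phase d → ℝ}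
    (hR : ∀ g, 0 < g → g < 1 → IsRTESolution lam (k g) f (uu g)) {𝒰 : Ultrafilter ℝ}
    (h𝒰 : (𝒰 : Filter ℝ) ≤ 𝓝[<] 1) :
    ∃ u, IsEnergySolution s ε lam σ f u ∧ ∀ G, MemLp G 2 (phaseMeasure d) →
      Tendsto (fun g => ∫ p, uu g p * G p ∂(phaseMeasure d)) 𝒰
        (𝓝 (∫ p, u p * G p ∂(phaseMeasure d))) := by
  have hb : ∀ᶠ g in (𝒰 : Filter ℝ), MemLp (uu g) 2 (phaseMeasure d) ∧
      eLpNorm (uu g) 2 (phaseMeasure d) ≤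
        ((c⁻¹ * (eLpNorm f 2 (phaseMeasure d)).toReal).toNNReal : ℝ≥0) := by
    filter_upwards [h𝒰 eventually_half_le_lt_one] with g hg
    obtain ⟨M, hM⟩ := hk.kernel g (by linarith) hg.2
    have h4 := hR g (by linarith) hg.2
    refine ⟨h4.1, ?_⟩
    rw [← ENNReal.ofReal_toReal h4.1.2.ne]
    exact ENNReal.ofReal_le_ofReal (h4.eLpNorm_two_le hl hM hf)
  obtain ⟨u, hu, hw⟩ := exists_weak_limit 𝒰 hb
  exact ⟨u, .of_weak_limit hd h0 h1 hε hl hσ hk hf hR h𝒰 hu hw, hw⟩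

lemma exists_family_isRTESolution (hl : IsAbsorption lam c) {e : ℝ}
    (hk : IsKernelApprox s e σ k A) {f : Phase d → ℝ} (hf : MemLp f 2 (phaseMeasure d)) :
    ∃ uu : ℝ → Phase d → ℝ, ∀ g, 0 < g → g < 1 → IsRTESolution lam (k g) f (uu g) := by
  have : ∀ g : ℝ, ∃ u, 0 < g → g < 1 → IsRTESolution lam (k g) f u := by
    intro g
    by_cases h : 0 < g ∧ g < 1
    · obtain ⟨M, hM⟩ := hk.kernel g h.1 h.2
      obtain ⟨u, hu⟩ := exists_isRTESolution hl hM hf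
      exact ⟨u, fun _ _ => hu⟩
    · exact ⟨0, fun h2 h3 => absurd ⟨h2, h3⟩ h⟩
  choose uu huu using this
  exact ⟨uu, huu⟩

/-- The radiative transfer solutions themselves are the approximation; any ultrafilter finer than
`𝓝[<] 1` yields a solution. -/
theorem exists_isEnergySolution (hd : 2 ≤ d) (h0 : 0 < s) (h1 : s < 1) (hε : 0 < ε)
    (hl : IsAbsorption lam c) (hσ : IsAbsorption σ c') (hk : IsKernelApprox s (ε ^ (2 * s)) σ k A)
    {f : Phase d → ℝ} (hf : MemLp f 2 (phaseMeasure d)) :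
    ∃ u, IsEnergySolution s ε lam σ f u := by
  obtain ⟨uu, hR⟩ := exists_family_isRTESolution hl hk hf
  obtain ⟨u, hu, -⟩ := exists_isEnergySolution_of_ultrafilter hd h0 h1 hε hl hσ hk hf hR
    (Ultrafilter.of_le (𝓝[<] (1 : ℝ)))
  exact ⟨u, hu⟩

/-- Solutions of the radiative transfer equation converge weakly to the energy solution. -/
theorem IsEnergySolution.tendsto_weak (hd : 2 ≤ d) (h0 : 0 < s) (h1 : s < 1) (hε : 0 < ε)
    (hl : IsAbsorption lam c) (hσ : IsAbsorption σ c') (hk : IsKernelApprox s (ε ^ (2 * s)) σ k A)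
    {f : Phase d → ℝ} (hf : MemLp f 2 (phaseMeasure d)) {uu : ℝ → Phase d → ℝ}
    (hR : ∀ g, 0 < g → g < 1 → IsRTESolution lam (k g) f (uu g)) {u : Phase d → ℝ}
    (hu : IsEnergySolution s ε lam σ f u) {G : Phase d → ℝ} (hG : MemLp G 2 (phaseMeasure d)) :
    Tendsto (fun g => ∫ p, uu g p * G p ∂(phaseMeasure d)) (𝓝[<] 1)
      (𝓝 (∫ p, u p * G p ∂(phaseMeasure d))) := by
  -- Every finer ultrafilter has a weak limit that solves the equation. Uniqueness makes all these
  -- limits agree, so the full filter converges.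
  rw [tendsto_iff_ultrafilter]
  intro 𝒰 h𝒰
  obtain ⟨v, hv, hw⟩ := exists_isEnergySolution_of_ultrafilter hd h0 h1 hε hl hσ hk hf hR h𝒰
  have huv := hu.ae_unique hd h0 h1 hε hl hσ hf hv
  have e : ∫ p, u p * G p ∂(phaseMeasure d) = ∫ p, v p * G p ∂(phaseMeasure d) :=
    integral_congr_ae (huv.mono fun p hp => by simp only [hp])
  rw [e]
  exact hw G hG

/-- Inherited from the approximating transfer solutions, whose bound is uniform in `g`, by weak
lower semicontinuity of the `L¹` norm. -/
theorem IsEnergySolution.eLpNorm_one_le (hd : 2 ≤ d) (h0 : 0 < s) (h1 : s < 1) (hε : 0 < ε)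
    (hl : IsAbsorption lam c) (hσ : IsAbsorption σ c') (hk : IsKernelApprox s (ε ^ (2 * s)) σ k A)
    {f u : Phase d → ℝ} (hf : MemLp f 2 (phaseMeasure d)) (hf1 : Integrable f (phaseMeasure d))
    (hu : IsEnergySolution s ε lam σ f u) :
    eLpNorm u 1 (phaseMeasure d) ≤ ENNReal.ofReal c⁻¹ * eLpNorm f 1 (phaseMeasure d) := by
  obtain ⟨uu, hR⟩ := exists_family_isRTESolution hl hk hf
  refine eLpNorm_one_le_of_weak (l := 𝓝[<] (1 : ℝ)) (F := uu) ?_ hu.memLp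
    (fun G hG => hu.tendsto_weak hd h0 h1 hε hl hσ hk hf hR hG) ?_
  · filter_upwards [eventually_half_le_lt_one] with g hg
    exact (hR g (by linarith) hg.2).1
  · filter_upwards [eventually_half_le_lt_one] with g hg
    obtain ⟨M, hM⟩ := hk.kernel g (by linarith) hg.2
    exact (hR g (by linarith) hg.2).eLpNorm_one_le hl hM hf hf1

end EnergySolutions

/-! ### Equivalence with the weak formulation in the statement. -/

section WeakFormulation

variable {d : ℕ} {s ε : ℝ} {σ lam : Pos d → ℝ} {c c' : ℝ}

lemma fracJump_mul_fracJump (hd : 2 ≤ d) (h0 : 0 < s) (h1 : s < 1) (u v : Phase d → ℝ)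
    (q : Pos d × (Dir d × Dir d)) : fracJump s u q * fracJump s v q =
      angKernel s q.2.1 q.2.2 * (u (q.1, q.2.1) - u (q.1, q.2.2)) *
        (v (q.1, q.2.1) - v (q.1, q.2.2)) := by
  have := Real.mul_self_sqrt (angKernel_nonneg hd h0 h1 q.2.1 q.2.2)
  simp only [fracJump, jump]
  linear_combination ((u (q.1, q.2.1) - u (q.1, q.2.2)) * (v (q.1, q.2.1) - v (q.1, q.2.2))) * this

lemma hNormSq_eq (hd : 2 ≤ d) (h0 : 0 < s) (h1 : s < 1) {u : Phase d → ℝ}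
    (hu : AEStronglyMeasurable u (phaseMeasure d)) :
    hNormSq s ε u = eLpNorm u 2 (phaseMeasure d) ^ 2 + ENNReal.ofReal (ε ^ (2 * s)) *
      (1 / 2 * eLpNorm (fracJump s u) 2 (pairMeasure d) ^ 2 +
        eLpNorm u 2 (phaseMeasure d) ^ 2) := by
  have m1 : AEMeasurable (fun q => ENNReal.ofReal (fracJump s u q ^ 2)) (pairMeasure d) :=
    ((aestronglyMeasurable_fracJump s hu).aemeasurable.pow_const 2).ennreal_ofReal
  have m2 : AEMeasurable (fun p => ENNReal.ofReal (u p ^ 2)) (phaseMeasure d) :=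
    (hu.aemeasurable.pow_const 2).ennreal_ofReal
  have e1 : ∀ x, angEnergy s (fun θ => u (x, θ)) =
      1 / 2 * ∫⁻ q, ENNReal.ofReal (fracJump s u (x, q) ^ 2)
        ∂((dirMeasure d).prod (dirMeasure d)) := by
    intro x
    rw [angEnergy]
    congr 2; funext q
    rw [pow_two (fracJump _ _ _), fracJump_mul_fracJump hd h0 h1]
    congr 1
    ring
  rw [eLpNorm_two_sq, eLpNorm_two_sq, hNormSq, lintegral_prod _ m1]
  congr 2
  rw [lintegral_add_right' _ m2.lintegral_prod_right', ← lintegral_prod _ m2]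
  congr 1
  simp only [e1]
  rw [lintegral_const_mul' _ _ (by norm_num)]

lemma hNormSq_lt_top_iff (hd : 2 ≤ d) (h0 : 0 < s) (h1 : s < 1) (hε : 0 < ε) {u : Phase d → ℝ}
    (hu : AEStronglyMeasurable u (phaseMeasure d)) :
    hNormSq s ε u < ⊤ ↔
      MemLp u 2 (phaseMeasure d) ∧ MemLp (fracJump s u) 2 (pairMeasure d) := by
  have he : ENNReal.ofReal (ε ^ (2 * s)) ≠ 0 := by
    rw [Ne, ENNReal.ofReal_eq_zero, not_le]; positivity
  rw [hNormSq_eq hd h0 h1 hu]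
  constructor
  · intro h
    rw [ENNReal.add_lt_top, ENNReal.mul_lt_top_iff] at h
    obtain ⟨h2, h3⟩ := h
    refine ⟨⟨hu, (ENNReal.pow_lt_top_iff.1 h2).resolve_right two_ne_zero⟩,
      aestronglyMeasurable_fracJump s hu, ?_⟩
    rcases h3 with ⟨-, h3⟩ | h3 | h3
    · rw [ENNReal.add_lt_top, ENNReal.mul_lt_top_iff] at h3
      rcases h3.1 with ⟨-, h4⟩ | h4 | h4
      · exact (ENNReal.pow_lt_top_iff.1 h4).resolve_right two_ne_zero
      · simp at h4
      · rw [eq_zero_of_pow_eq_zero h4]; exact ENNReal.zero_lt_top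
    · exact absurd h3 he
    · rw [add_eq_zero] at h3
      have h4 : eLpNorm (fracJump s u) 2 (pairMeasure d) = 0 := by
        have := h3.1
        simpa using this
      rw [h4]; exact ENNReal.zero_lt_top
  · rintro ⟨h2, h3⟩
    have h4 := ENNReal.pow_lt_top h2.2 (n := 2)
    have h5 := ENNReal.pow_lt_top h3.2 (n := 2)
    exact ENNReal.add_lt_top.2 ⟨h4, ENNReal.mul_lt_top ENNReal.ofReal_lt_top
      (ENNReal.add_lt_top.2 ⟨ENNReal.mul_lt_top (by norm_num) h5, h4⟩)⟩

lemma integral_mul_angForm (hd : 2 ≤ d) (h0 : 0 < s) (h1 : s < 1) (hσ : IsAbsorption σ c')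
    {u v : Phase d → ℝ} (hu : MemLp (fracJump s u) 2 (pairMeasure d))
    (hv : MemLp (fracJump s v) 2 (pairMeasure d)) :
    ∫ x, σ x * angForm s (fun θ => u (x, θ)) (fun θ => v (x, θ)) =
      1 / 2 * ∫ q, σ q.1 * fracJump s u q * fracJump s v q ∂(pairMeasure d) := by
  have hi := integrable_mul_of_memLp_two (hσ.memLp_mul measurable_fst hu) hv
  have e := integral_prod _ hi
  rw [e, ← integral_const_mul]
  congr 1; funext x
  rw [angForm, mul_left_comm]
  congr 1
  rw [← integral_const_mul]
  congr 1; funext q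
  rw [mul_assoc (σ x) (fracJump s u (x, q)), fracJump_mul_fracJump hd h0 h1]

/-- The equation expresses the transport term through pairings that Cauchy–Schwarz bounds by the
energy norm of the test function. -/
lemma IsEnergySolution.inYSpace (hd : 2 ≤ d) (h0 : 0 < s) (h1 : s < 1) (hε : 0 < ε)
    (hl : IsAbsorption lam c) (hσ : IsAbsorption σ c') {f u : Phase d → ℝ}
    (hf : MemLp f 2 (phaseMeasure d)) (hu : IsEnergySolution s ε lam σ f u) : InYSpace s ε u := by
  refine ⟨hu.memLp.1, (hNormSq_lt_top_iff hd h0 h1 hε hu.memLp.1).2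
    ⟨hu.memLp, hu.memLp_fracJump⟩, ?_⟩
  set e : ℝ := ε ^ (2 * s) with hedef
  have he : 0 < e := by positivity
  have ml := hl.memLp_mul measurable_fst hu.memLp
  have mσ := hσ.memLp_mul measurable_fst hu.memLp_fracJump
  set a : ℝ := (eLpNorm (fun p : Phase d => lam p.1 * u p) 2 (phaseMeasure d)).toReal +
    (eLpNorm f 2 (phaseMeasure d)).toReal with ha
  set b : ℝ := e / 2 * (eLpNorm (fun q : Pos d × (Dir d × Dir d) => σ q.1 * fracJump s u q) 2
    (pairMeasure d)).toReal with hb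
  -- From `(a x + b y)² ≤ 2 a² x² + 2 b² y²`; in the squared norm `y²` carries the factor `e / 2`,
  -- whence `4 b² / e`.
  refine ⟨(2 * a ^ 2 + 4 * b ^ 2 / e).toNNReal, fun φ hφ => ?_⟩
  have mφ := hφ.memLp 2
  have mD := hφ.memLp_fracJump hd h0 h1
  have hw := hu.weak φ hφ
  have i1 := abs_le.1 (abs_integral_mul_le ml mφ)
  have i2 := abs_le.1 (abs_integral_mul_le mσ mD)
  have i3 := abs_le.1 (abs_integral_mul_le hf mφ)
  rw [hNormSq_eq hd h0 h1 mφ.1, ← ENNReal.ofReal_toReal mφ.2.ne, ← ENNReal.ofReal_toReal mD.2.ne]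
  set x := (eLpNorm (onPhase φ) 2 (phaseMeasure d)).toReal with hx
  set y := (eLpNorm (fracJump s (onPhase φ)) 2 (pairMeasure d)).toReal with hy
  have hx0 : 0 ≤ x := ENNReal.toReal_nonneg
  have hy0 : 0 ≤ y := ENNReal.toReal_nonneg
  have ha0 : 0 ≤ a := add_nonneg ENNReal.toReal_nonneg ENNReal.toReal_nonneg
  have hb0 : 0 ≤ b := mul_nonneg (by positivity) ENNReal.toReal_nonneg
  have habs : |∫ p, u p * transport φ p ∂(phaseMeasure d)| ≤ a * x + b * y := by
    rw [ha, hb, add_mul, mul_assoc (e / 2)]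
    set I2 := ∫ q, σ q.1 * fracJump s u q * fracJump s (onPhase φ) q ∂(pairMeasure d)
    have he2 : 0 ≤ e / 2 := by positivity
    have j1 := mul_le_mul_of_nonneg_left i2.1 he2
    have j2 := mul_le_mul_of_nonneg_left i2.2 he2
    rw [mul_neg] at j1
    exact abs_le.2 ⟨by linarith, by linarith⟩
  have hsq : (∫ p, u p * transport φ p ∂(phaseMeasure d)) ^ 2 ≤
      (2 * a ^ 2 + 4 * b ^ 2 / e) * (x ^ 2 + e * (1 / 2 * y ^ 2 + x ^ 2)) := by
    rw [← sq_abs]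
    have k1 := pow_le_pow_left₀ (abs_nonneg _) habs 2
    have k2 : (a * x + b * y) ^ 2 ≤ 2 * a ^ 2 * x ^ 2 + 2 * b ^ 2 * y ^ 2 := by
      nlinarith [sq_nonneg (a * x - b * y)]
    have k3 : 2 * b ^ 2 * y ^ 2 = 4 * b ^ 2 / e * (e * (1 / 2 * y ^ 2)) := by
      field_simp; ring
    have k4 : 0 ≤ 4 * b ^ 2 / e := by positivity
    have k5 : 2 * a ^ 2 * x ^ 2 ≤ 2 * a ^ 2 * (x ^ 2 + e * (1 / 2 * y ^ 2 + x ^ 2)) := by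
      gcongr
      have : 0 ≤ e * (1 / 2 * y ^ 2 + x ^ 2) := by positivity
      linarith
    have k6 : 4 * b ^ 2 / e * (e * (1 / 2 * y ^ 2)) ≤
        4 * b ^ 2 / e * (x ^ 2 + e * (1 / 2 * y ^ 2 + x ^ 2)) := by
      gcongr
      have : 0 ≤ e * x ^ 2 := by positivity
      nlinarith [sq_nonneg x]
    rw [add_mul]
    linarith
  refine (ENNReal.ofReal_le_ofReal hsq).trans (le_of_eq ?_)
  have h2 : ENNReal.ofReal (1 / 2) = 1 / 2 := by
    rw [ENNReal.ofReal_div_of_pos two_pos]; simp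
  rw [ENNReal.ofReal_mul (p := 2 * a ^ 2 + 4 * b ^ 2 / e) (by positivity),
    ENNReal.ofReal_add (p := x ^ 2) (by positivity) (by positivity),
    ENNReal.ofReal_mul (p := e) he.le,
    ENNReal.ofReal_add (p := 1 / 2 * y ^ 2) (by positivity) (by positivity),
    ENNReal.ofReal_mul (p := 1 / 2) (by norm_num), ENNReal.ofReal_pow hx0, ENNReal.ofReal_pow hy0,
    h2]
  rfl

/-- The dual bound on the transport derivative follows from the equation, so only finite energy and
the weak identity matter. -/
theorem isFFPSolution_iff (hd : 2 ≤ d) (h0 : 0 < s) (h1 : s < 1) (hε : 0 < ε)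
    (hl : IsAbsorption lam c) (hσ : IsAbsorption σ c') {f u : Phase d → ℝ}
    (hf : MemLp f 2 (phaseMeasure d)) :
    IsFFPSolution s ε lam σ f u ↔ IsEnergySolution s ε lam σ f u := by
  have key : MemLp u 2 (phaseMeasure d) → MemLp (fracJump s u) 2 (pairMeasure d) →
      ∀ φ, IsTest φ →
      (∫ p, (-(u p * transport φ p) + lam p.1 * u p * onPhase φ p) ∂(phaseMeasure d)) +
        ε ^ (2 * s) * ∫ x : Pos d, σ x *
          angForm s (fun θ => u (x, θ)) (fun θ => onPhase φ (x, θ)) =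
      -∫ p, u p * transport φ p ∂(phaseMeasure d) +
        ∫ p, lam p.1 * u p * onPhase φ p ∂(phaseMeasure d) +
        ε ^ (2 * s) / 2 * ∫ q, σ q.1 * fracJump s u q * fracJump s (onPhase φ) q
          ∂(pairMeasure d) := by
    intro mu mD φ hφ
    rw [integral_mul_angForm hd h0 h1 hσ mD (hφ.memLp_fracJump hd h0 h1), ← integral_neg,
      ← integral_add (f := fun p => -(u p * transport φ p))
        (integrable_mul_of_memLp_two mu (hφ.memLp_transport 2)).neg
        (integrable_mul_of_memLp_two (hl.memLp_mul measurable_fst mu) (hφ.memLp 2))]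
    ring
  constructor
  · rintro ⟨⟨hm, hfin, -⟩, hw⟩
    obtain ⟨mu, mD⟩ := (hNormSq_lt_top_iff hd h0 h1 hε hm).1 hfin
    exact ⟨mu, mD, fun φ hφ => (key mu mD φ hφ).symm.trans (hw φ hφ)⟩
  · intro h
    exact ⟨h.inYSpace hd h0 h1 hε hl hσ hf, fun φ hφ =>
      (key h.memLp h.memLp_fracJump φ hφ).trans (h.weak φ hφ)⟩

end WeakFormulation

/-! ### Solutions for integrable sources. -/

section IntegrableSources

variable {d : ℕ}

/-- Existence of solutions for sources in `L¹ ∩ L²`, and Lipschitz dependence on the source in the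
norm of `L¹`. -/
structure IsContractive (Sol : (Phase d → ℝ) → (Phase d → ℝ) → Prop) (C : ℝ≥0) : Prop where
  exists_sol : ∀ f, Integrable f (phaseMeasure d) → MemLp f 2 (phaseMeasure d) → ∃ u, Sol f u
  aestronglyMeasurable : ∀ f u, Sol f u → AEStronglyMeasurable u (phaseMeasure d)
  sub_le : ∀ f g u v, Integrable f (phaseMeasure d) → MemLp f 2 (phaseMeasure d) →
    Integrable g (phaseMeasure d) → MemLp g 2 (phaseMeasure d) → Sol f u → Sol g v →
    eLpNorm (u - v) 1 (phaseMeasure d) ≤ C * eLpNorm (f - g) 1 (phaseMeasure d)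
  le : ∀ f u, Integrable f (phaseMeasure d) → MemLp f 2 (phaseMeasure d) → Sol f u →
    eLpNorm u 1 (phaseMeasure d) ≤ C * eLpNorm f 1 (phaseMeasure d)

variable {Sol : (Phase d → ℝ) → (Phase d → ℝ) → Prop} {C : ℝ≥0}

lemma exists_memLp_two_eLpNorm_sub_lt {f : Phase d → ℝ} (hf : Integrable f (phaseMeasure d))
    {δ : ℝ≥0∞} (hδ : δ ≠ 0) : ∃ h : Phase d → ℝ, Integrable h (phaseMeasure d) ∧
      MemLp h 2 (phaseMeasure d) ∧ eLpNorm (f - h) 1 (phaseMeasure d) < δ := by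
  obtain ⟨h, h1, h2⟩ := (memLp_one_iff_integrable.2 hf).exists_simpleFunc_eLpNorm_sub_lt
    ENNReal.one_ne_top hδ
  have h3 := memLp_one_iff_integrable.1 h2
  exact ⟨h, h3, (SimpleFunc.memLp_iff_integrable two_ne_zero ENNReal.ofNat_ne_top).2 h3, h1⟩

lemma isL1Solution_of_sol (hS : IsContractive Sol C) {f u : Phase d → ℝ}
    (hf : Integrable f (phaseMeasure d)) (hf2 : MemLp f 2 (phaseMeasure d)) (hu : Sol f u) :
    IsL1Solution Sol f u :=
  ⟨hS.aestronglyMeasurable f u hu, fun _ => f, fun _ => u, fun _ => ⟨hf, hf2, hu⟩, by simp, by simp⟩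

/-- The Lipschitz bound holds for the approximating pairs and passes to the `L¹` limit. The
comparison is between arbitrary approximating sequences, so it contains uniqueness. -/
lemma IsL1Solution.eLpNorm_sub_le (hS : IsContractive Sol C) {f g u v : Phase d → ℝ}
    (hf : Integrable f (phaseMeasure d)) (hg : Integrable g (phaseMeasure d))
    (hu : IsL1Solution Sol f u) (hv : IsL1Solution Sol g v) :
    eLpNorm (u - v) 1 (phaseMeasure d) ≤ C * eLpNorm (f - g) 1 (phaseMeasure d) := by
  obtain ⟨mu, fn, un, h1, h2, h3⟩ := hu
  obtain ⟨mv, gn, vn, k1, k2, k3⟩ := hv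
  have mun : ∀ n, AEStronglyMeasurable (un n) (phaseMeasure d) := fun n =>
    hS.aestronglyMeasurable _ _ (h1 n).2.2
  have mvn : ∀ n, AEStronglyMeasurable (vn n) (phaseMeasure d) := fun n =>
    hS.aestronglyMeasurable _ _ (k1 n).2.2
  have tri : ∀ {a b : Phase d → ℝ}, AEStronglyMeasurable a (phaseMeasure d) →
      AEStronglyMeasurable b (phaseMeasure d) → eLpNorm (a + b) 1 (phaseMeasure d) ≤
        eLpNorm a 1 (phaseMeasure d) + eLpNorm b 1 (phaseMeasure d) := fun ha hb =>
    eLpNorm_add_le ha hb le_rfl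
  have hle : ∀ n, eLpNorm (u - v) 1 (phaseMeasure d) ≤ eLpNorm (un n - u) 1 (phaseMeasure d) +
      (C * (eLpNorm (fn n - f) 1 (phaseMeasure d) + (eLpNorm (f - g) 1 (phaseMeasure d) +
        eLpNorm (gn n - g) 1 (phaseMeasure d))) + eLpNorm (vn n - v) 1 (phaseMeasure d)) := by
    intro n
    have e1 : u - v = (u - un n) + ((un n - vn n) + (vn n - v)) := by abel
    have e2 : fn n - gn n = (fn n - f) + ((f - g) + (g - gn n)) := by abel
    rw [e1, eLpNorm_sub_comm (un n) u, eLpNorm_sub_comm (gn n) g]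
    refine (tri (mu.sub (mun n)) (((mun n).sub (mvn n)).add ((mvn n).sub mv))).trans ?_
    gcongr
    refine (tri ((mun n).sub (mvn n)) ((mvn n).sub mv)).trans ?_
    gcongr
    refine (hS.sub_le _ _ _ _ (h1 n).1 (h1 n).2.1 (k1 n).1 (k1 n).2.1 (h1 n).2.2
      (k1 n).2.2).trans ?_
    gcongr
    rw [e2]
    refine (tri ((h1 n).1.1.sub hf.1) ((hf.1.sub hg.1).add (hg.1.sub (k1 n).1.1))).trans ?_
    gcongr
    exact tri (hf.1.sub hg.1) (hg.1.sub (k1 n).1.1)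
  have hlim := h3.add ((ENNReal.Tendsto.const_mul (h2.add (k2.const_add
    (eLpNorm (f - g) 1 (phaseMeasure d)))) (Or.inr (ENNReal.coe_ne_top (r := C)))).add k3)
  simp only [zero_add, add_zero] at hlim
  exact ge_of_tendsto' hlim hle

lemma IsL1Solution.ae_unique (hS : IsContractive Sol C) {f u v : Phase d → ℝ}
    (hf : Integrable f (phaseMeasure d)) (hu : IsL1Solution Sol f u) (hv : IsL1Solution Sol f v) :
    u =ᵐ[phaseMeasure d] v := by
  have h := hu.eLpNorm_sub_le hS hf hf hv
  rw [sub_self, eLpNorm_zero, mul_zero] at h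
  have h2 := (eLpNorm_eq_zero_iff (hu.1.sub hv.1) one_ne_zero).1 (le_antisymm h bot_le)
  filter_upwards [h2] with p hp
  exact sub_eq_zero.1 hp

/-- Sources approximated at rate `2⁻ⁿ` have solutions that are Cauchy in `L¹` with summable
increments. -/
lemma exists_isL1Solution (hS : IsContractive Sol C) {f : Phase d → ℝ}
    (hf : Integrable f (phaseMeasure d)) :
    ∃ u, Integrable u (phaseMeasure d) ∧ IsL1Solution Sol f u := by
  have hδ : ∀ n : ℕ, (2⁻¹ : ℝ≥0∞) ^ n ≠ 0 := fun n => pow_ne_zero _ (by simp)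
  choose fn h1 h2 h3 using fun n => exists_memLp_two_eLpNorm_sub_lt hf (hδ n)
  choose un hun using fun n => hS.exists_sol (fn n) (h1 n) (h2 n)
  have mun : ∀ n, MemLp (un n) 1 (phaseMeasure d) := fun n =>
    ⟨hS.aestronglyMeasurable _ _ (hun n), (hS.le _ _ (h1 n) (h2 n) (hun n)).trans_lt
      (ENNReal.mul_lt_top ENNReal.coe_lt_top (memLp_one_iff_integrable.2 (h1 n)).2)⟩
  have hcau : ∀ N n m : ℕ, N ≤ n → N ≤ m → eLpNorm (un n - un m) 1 (phaseMeasure d) <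
      ((C + 1 : ℝ≥0) : ℝ≥0∞) * (2 * (2⁻¹ : ℝ≥0∞) ^ N) := by
    intro N n m hn hm
    have hs : ∀ k, N ≤ k → eLpNorm (f - fn k) 1 (phaseMeasure d) < (2⁻¹ : ℝ≥0∞) ^ N := fun k hk =>
      (h3 k).trans_le (pow_le_pow_right_of_le_one' (by simp) hk)
    have e : fn n - fn m = (f - fn m) - (f - fn n) := by abel
    have h4 : eLpNorm (fn n - fn m) 1 (phaseMeasure d) < 2 * (2⁻¹ : ℝ≥0∞) ^ N := by
      rw [e, two_mul]
      exact (eLpNorm_sub_le (hf.1.sub (h1 m).1) (hf.1.sub (h1 n).1) le_rfl).trans_lt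
        (ENNReal.add_lt_add (hs m hm) (hs n hn))
    refine (hS.sub_le _ _ _ _ (h1 n) (h2 n) (h1 m) (h2 m) (hun n) (hun m)).trans_lt ?_
    -- `C` is enlarged to `C + 1`, which is nonzero, so that multiplication keeps the inequality
    -- strict.
    refine lt_of_le_of_lt (mul_le_mul_left (ENNReal.coe_le_coe.2 (le_add_of_nonneg_right
      (zero_le_one' ℝ≥0))) _) ?_
    exact ENNReal.mul_lt_mul_right (by simp) ENNReal.coe_ne_top h4
  obtain ⟨u, hu, hlim⟩ := Lp.cauchy_complete_eLpNorm le_rfl mun (B := fun N =>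
    ((C + 1 : ℝ≥0) : ℝ≥0∞) * (2 * (2⁻¹ : ℝ≥0∞) ^ N)) (by
      rw [ENNReal.tsum_mul_left, ENNReal.tsum_mul_left, ENNReal.tsum_geometric]
      refine ENNReal.mul_ne_top ENNReal.coe_ne_top (ENNReal.mul_ne_top ENNReal.ofNat_ne_top ?_)
      rw [ENNReal.one_sub_inv_two]
      simp) hcau
  refine ⟨u, memLp_one_iff_integrable.1 hu, hu.1, fn, un, fun n => ⟨h1 n, h2 n, hun n⟩, ?_, hlim⟩
  refine tendsto_of_tendsto_of_tendsto_of_le_of_le tendsto_const_nhds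
    (ENNReal.tendsto_pow_atTop_nhds_zero_of_lt_one (r := 2⁻¹) (by simp)) (fun _ => bot_le)
    fun n => ?_
  rw [eLpNorm_sub_comm]
  exact (h3 n).le

/-- Compare with an `L²` solution for the zero source, whose `L¹` norm vanishes. -/
lemma IsL1Solution.eLpNorm_le (hS : IsContractive Sol C) {f u : Phase d → ℝ}
    (hf : Integrable f (phaseMeasure d)) (hu : IsL1Solution Sol f u) :
    eLpNorm u 1 (phaseMeasure d) ≤ C * eLpNorm f 1 (phaseMeasure d) := by
  have i0 : Integrable (0 : Phase d → ℝ) (phaseMeasure d) := integrable_zero _ _ _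
  have m0 : MemLp (0 : Phase d → ℝ) 2 (phaseMeasure d) := MemLp.zero
  obtain ⟨v, hv⟩ := hS.exists_sol 0 i0 m0
  have h1 := hS.le 0 v i0 m0 hv
  rw [eLpNorm_zero, mul_zero] at h1
  have h2 := hu.eLpNorm_sub_le hS hf i0 (isL1Solution_of_sol hS i0 m0 hv)
  rw [sub_zero] at h2
  have h3 : u = (u - v) + v := by abel
  rw [h3]
  refine (eLpNorm_add_le (hu.1.sub (hS.aestronglyMeasurable _ _ hv)) (hS.aestronglyMeasurable _ _ hv)
    le_rfl).trans ?_
  rw [le_antisymm h1 bot_le, add_zero]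
  exact h2

end IntegrableSources

/-! ### From convergence on sets to the bounded-Lipschitz distance. -/

section Wasserstein

variable {d : ℕ}

lemma abs_setIntegral_le_eLpNorm_one {X : Type*} [MeasurableSpace X] {μ : Measure X} {w : X → ℝ}
    (hw : Integrable w μ) (S : Set X) : |∫ x in S, w x ∂μ| ≤ (eLpNorm w 1 μ).toReal := by
  have h1 : (eLpNorm w 1 μ).toReal = ∫ x, ‖w x‖ ∂μ := by
    rw [eLpNorm_one_eq_lintegral_enorm, integral_norm_eq_lintegral_enorm hw.1]
  rw [h1]
  refine (norm_integral_le_integral_norm w).trans ?_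
  exact setIntegral_le_integral hw.norm (Eventually.of_forall fun _ => norm_nonneg _)

/-- The factor `2` passes from the Euclidean distance to the maximum distance of the product. -/
lemma IsBL.dist_le {E : Set (Phase d)} {κ : ℝ} (hκ : 0 ≤ κ) {ψ : Phase d → ℝ} (h : IsBL E κ ψ)
    {p q : Phase d} (hp : p ∈ E) (hq : q ∈ E) : |ψ p - ψ q| ≤ κ * (2 * dist p q) := by
  refine (h.2 p hp q hq).trans (mul_le_mul_of_nonneg_left ?_ hκ)
  have h1 : dist p.1 q.1 ≤ dist p q := by rw [Prod.dist_eq]; exact le_max_left _ _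
  have h2 : dist p.2 q.2 ≤ dist p q := by rw [Prod.dist_eq]; exact le_max_right _ _
  rw [Real.sqrt_le_left (by positivity)]
  nlinarith [dist_nonneg (x := p.1) (y := q.1), dist_nonneg (x := p.2) (y := q.2)]

lemma IsBL.continuousOn {E : Set (Phase d)} {κ : ℝ} (hκ : 0 ≤ κ) {ψ : Phase d → ℝ}
    (h : IsBL E κ ψ) : ContinuousOn ψ E := by
  have : LipschitzOnWith (κ * 2).toNNReal ψ E := LipschitzOnWith.of_dist_le_mul fun p hp q hq => by
    rw [Real.coe_toNNReal _ (by positivity), mul_assoc, Real.dist_eq]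
    exact h.dist_le hκ hp hq
  exact this.continuousOn

/-- A compact set is mapped to finitely many of its points by a small displacement. -/
lemma exists_simpleFunc_dist_lt {E : Set (Phase d)} (hE : IsCompact E) (hne : E.Nonempty) {r : ℝ}
    (hr : 0 < r) : ∃ π : SimpleFunc (Phase d) (Phase d), (∀ p, π p ∈ E) ∧
      ∀ p ∈ E, dist (π p) p < r := by
  have : Nonempty E := hne.to_subtype
  set a : ℕ → Phase d := fun n => (TopologicalSpace.denseSeq E n : Phase d) with ha
  have hcov : E ⊆ ⋃ n, Metric.ball (a n) r := by
    intro p hp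
    obtain ⟨n, hn⟩ := (TopologicalSpace.denseRange_denseSeq E).exists_dist_lt (⟨p, hp⟩ : E) hr
    exact mem_iUnion.2 ⟨n, hn⟩
  obtain ⟨t, ht⟩ := hE.elim_finite_subcover _ (fun n => Metric.isOpen_ball) hcov
  obtain ⟨N, hN⟩ := t.bddAbove
  refine ⟨SimpleFunc.nearestPt a N, fun p => ?_, fun p hp => ?_⟩
  · exact (TopologicalSpace.denseSeq E _).2
  · obtain ⟨n, hn, hpn⟩ := mem_iUnion₂.1 (ht hp)
    have h1 := SimpleFunc.edist_nearestPt_le a p (hN hn)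
    rw [edist_dist, edist_dist, ENNReal.ofReal_le_ofReal_iff dist_nonneg] at h1
    rw [Metric.mem_ball, dist_comm] at hpn
    exact h1.trans_lt hpn

/-- Replacing `ψ` by `ψ ∘ π` costs the Lipschitz constant times the displacement and leaves finitely
many values of modulus at most `1`. The bound does not depend on `ψ`, so it controls the supremum.
-/
lemma IsBL.setIntegral_mul_le {E : Set (Phase d)} (hE : MeasurableSet E) {κ : ℝ} (hκ : 0 ≤ κ)
    {ψ : Phase d → ℝ} (h : IsBL E κ ψ) {w : Phase d → ℝ} (hw : Integrable w (phaseMeasure d))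
    {π : SimpleFunc (Phase d) (Phase d)} (hπE : ∀ p, π p ∈ E) {r : ℝ} (hr : 0 ≤ r)
    (hπ : ∀ p ∈ E, dist (π p) p < r) :
    ∫ p in E, ψ p * w p ∂(phaseMeasure d) ≤
      κ * (2 * r) * (eLpNorm w 1 (phaseMeasure d)).toReal +
        ∑ y ∈ π.range, |∫ p in E ∩ π ⁻¹' {y}, w p ∂(phaseMeasure d)| := by
  have hwE := hw.integrableOn (s := E)
  have mψ : AEStronglyMeasurable ψ ((phaseMeasure d).restrict E) :=
    (h.continuousOn hκ).aestronglyMeasurable hE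
  have i1 : Integrable (fun p => ψ p * w p) ((phaseMeasure d).restrict E) := by
    refine Integrable.bdd_mul (c := 1) hwE mψ ?_
    filter_upwards [ae_restrict_mem hE] with p hp
    exact h.1 p hp
  have eπ : ∀ p, ψ (π p) * w p =
      ∑ y ∈ π.range, ψ y * (π ⁻¹' {y}).indicator w p := by
    intro p
    rw [Finset.sum_eq_single (π p)]
    · simp
    · intro y _ hy
      rw [indicator_of_notMem (by simpa using hy.symm), mul_zero]
    · intro h'; exact absurd (SimpleFunc.mem_range_self π p) h'
  have iy : ∀ y, Integrable (fun p => ψ y * (π ⁻¹' {y}).indicator w p)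
      ((phaseMeasure d).restrict E) := fun y =>
    ((hw.indicator (π.measurableSet_fiber y)).integrableOn).const_mul _
  have i2 : Integrable (fun p => ψ (π p) * w p) ((phaseMeasure d).restrict E) := by
    simp only [eπ]
    exact integrable_finsetSum _ fun y _ => iy y
  have e1 : ∫ p in E, ψ p * w p ∂(phaseMeasure d) =
      ∫ p in E, (ψ p - ψ (π p)) * w p ∂(phaseMeasure d) +
        ∫ p in E, ψ (π p) * w p ∂(phaseMeasure d) := by
    have i3 : Integrable (fun p => (ψ p - ψ (π p)) * w p) ((phaseMeasure d).restrict E) := by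
      simp only [sub_mul]; exact i1.sub i2
    rw [← integral_add i3 i2]
    congr 1; funext p; ring
  rw [e1]
  refine add_le_add ?_ ?_
  · have h1 : (eLpNorm w 1 (phaseMeasure d)).toReal = ∫ p, ‖w p‖ ∂(phaseMeasure d) := by
      rw [eLpNorm_one_eq_lintegral_enorm, integral_norm_eq_lintegral_enorm hw.1]
    rw [h1]
    calc ∫ p in E, (ψ p - ψ (π p)) * w p ∂(phaseMeasure d)
        ≤ ∫ p in E, κ * (2 * r) * ‖w p‖ ∂(phaseMeasure d) := by
          refine integral_mono_ae (by simp only [sub_mul]; exact i1.sub i2)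
            (hwE.norm.const_mul _) ?_
          filter_upwards [ae_restrict_mem hE] with p hp
          refine (le_abs_self _).trans ?_
          rw [abs_mul]
          refine mul_le_mul_of_nonneg_right ((h.dist_le hκ hp (hπE p)).trans ?_) (abs_nonneg _)
          have := (hπ p hp).le
          rw [dist_comm] at this
          gcongr
      _ = κ * (2 * r) * ∫ p in E, ‖w p‖ ∂(phaseMeasure d) := integral_const_mul _ _
      _ ≤ _ := by
          exact mul_le_mul_of_nonneg_left (setIntegral_le_integral hw.norm
            (Eventually.of_forall fun _ => norm_nonneg _)) (by positivity)
  · simp only [eπ]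
    rw [integral_finsetSum _ fun y _ => iy y]
    refine Finset.sum_le_sum fun y hy => ?_
    obtain ⟨p, rfl⟩ := SimpleFunc.mem_range.1 hy
    rw [integral_const_mul, setIntegral_indicator (π.measurableSet_fiber _)]
    refine (le_abs_self _).trans ?_
    rw [abs_mul]
    exact mul_le_of_le_one_left (abs_nonneg _) (h.1 _ (hπE p))

/-- A single finite net of the compact set serves all admissible `ψ`. The `L¹` bound absorbs the
discretization error, and the finitely many integrals over cells tend to zero. -/
lemma tendsto_wassersteinDist {ι : Type*} {l : Filter ι} {Ω : Set (Pos d)}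
    (hΩ : Bornology.IsBounded Ω) {κ : ℝ} (hκ : 0 ≤ κ) {U : ι → Phase d → ℝ} {u : Phase d → ℝ}
    (hU : ∀ᶠ i in l, Integrable (U i) (phaseMeasure d)) (hu : Integrable u (phaseMeasure d))
    {B : ℝ} (hB : ∀ᶠ i in l, (eLpNorm (U i - u) 1 (phaseMeasure d)).toReal ≤ B)
    (hA : ∀ S, MeasurableSet S → phaseMeasure d S < ⊤ →
      Tendsto (fun i => ∫ p in S, (U i - u) p ∂(phaseMeasure d)) l (𝓝 0)) :
    Tendsto (fun i => wassersteinDist Ω κ (U i) u) l (𝓝 0) := by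
  set E : Set (Phase d) := closure Ω ×ˢ univ with hE
  have hEc : IsCompact E := hΩ.isCompact_closure.prod isCompact_univ
  have hEm : MeasurableSet E := hEc.isClosed.measurableSet
  rcases E.eq_empty_or_nonempty with he | hne
  · have : ∀ i, wassersteinDist Ω κ (U i) u = 0 := by
      intro i
      rw [wassersteinDist, ← hE, he]
      simp
    simp only [this]
    exact tendsto_const_nhds
  rw [ENNReal.tendsto_nhds_zero]
  intro δ' hδ'
  obtain ⟨δ, hδ, hδδ⟩ : ∃ δ : ℝ, 0 < δ ∧ ENNReal.ofReal δ ≤ δ' := by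
    obtain ⟨x, hx0, hx⟩ := ENNReal.lt_iff_exists_nnreal_btwn.1 hδ'
    exact ⟨x, by exact_mod_cast hx0, by rw [ENNReal.ofReal_coe_nnreal]; exact hx.le⟩
  set B' : ℝ := max B 0 with hB'
  have hB'0 : 0 ≤ B' := le_max_right _ _
  -- Makes the error `κ (2 r) B'` at most `δ / 2`; the summand `1` avoids division by zero.
  set r : ℝ := δ / (4 * (κ * B' + 1)) with hr
  have hr0 : 0 < r := by positivity
  obtain ⟨π, hπE, hπ⟩ := exists_simpleFunc_dist_lt hEc hne hr0
  have hs : Tendsto (fun i => ∑ y ∈ π.range, |∫ p in E ∩ π ⁻¹' {y}, (U i - u) p ∂(phaseMeasure d)|)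
      l (𝓝 0) := by
    have : Tendsto (fun i => ∑ y ∈ π.range, |∫ p in E ∩ π ⁻¹' {y}, (U i - u) p ∂(phaseMeasure d)|)
        l (𝓝 (∑ y ∈ π.range, |(0 : ℝ)|)) :=
      tendsto_finsetSum _ fun y _ => (hA _ (hEm.inter (π.measurableSet_fiber y))
        ((measure_mono inter_subset_left).trans_lt hEc.measure_lt_top)).abs
    simpa using this
  filter_upwards [hU, hB, hs.eventually (gt_mem_nhds (half_pos hδ))] with i h1 h2 h3
  refine iSup₂_le fun ψ hψ => (ENNReal.ofReal_le_ofReal ?_).trans hδδ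
  refine (hψ.setIntegral_mul_le hEm hκ (h1.sub hu) hπE hr0.le hπ).trans ?_
  have h4 : κ * (2 * r) * (eLpNorm (U i - u) 1 (phaseMeasure d)).toReal ≤ κ * (2 * r) * B' := by
    gcongr
    exact h2.trans (le_max_left _ _)
  have h5 : κ * (2 * r) * B' ≤ δ / 2 := by
    have : κ * (2 * r) * B' = δ / 2 * (κ * B' / (κ * B' + 1)) := by
      rw [hr]; field_simp; ring
    rw [this]
    refine mul_le_of_le_one_right (by positivity) ?_
    rw [div_le_one (by positivity)]
    linarith
  linarith

end Wasserstein

/-! ### Convergence for integrable sources and conclusion. -/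

section Main

variable {d : ℕ} {s ε : ℝ} {σ lam : Pos d → ℝ} {k : ℝ → Pos d → Dir d → Dir d → ℝ} {A c c' : ℝ}

lemma IsScatteringKernel.isContractive (hl : IsAbsorption lam c) {k : Pos d → Dir d → Dir d → ℝ}
    {M : ℝ} (hk : IsScatteringKernel k M) :
    IsContractive (IsRTESolution lam k) (c⁻¹).toNNReal where
  exists_sol _ _ hf2 := exists_isRTESolution hl hk hf2
  aestronglyMeasurable _ _ h := h.1.1
  sub_le _ _ _ _ hf hf2 hg hg2 hu hv := (hu.sub hk hv).eLpNorm_one_le hl hk (hf2.sub hg2) (hf.sub hg)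
  le _ _ hf hf2 hu := hu.eLpNorm_one_le hl hk hf2 hf

lemma IsKernelApprox.isContractive_ffp (hd : 2 ≤ d) (h0 : 0 < s) (h1 : s < 1) (hε : 0 < ε)
    (hl : IsAbsorption lam c) (hσ : IsAbsorption σ c')
    (hk : IsKernelApprox s (ε ^ (2 * s)) σ k A) :
    IsContractive (IsFFPSolution s ε lam σ) (c⁻¹).toNNReal where
  exists_sol _ _ hf2 := by
    obtain ⟨u, hu⟩ := exists_isEnergySolution hd h0 h1 hε hl hσ hk hf2
    exact ⟨u, (isFFPSolution_iff hd h0 h1 hε hl hσ hf2).2 hu⟩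
  aestronglyMeasurable _ _ h := h.1.1
  sub_le _ _ _ _ hf hf2 hg hg2 hu hv :=
    (((isFFPSolution_iff hd h0 h1 hε hl hσ hf2).1 hu).sub hd h0 h1 hl hσ hf2 hg2
      ((isFFPSolution_iff hd h0 h1 hε hl hσ hg2).1 hv)).eLpNorm_one_le hd h0 h1 hε hl hσ hk
        (hf2.sub hg2) (hf.sub hg)
  le _ _ hf hf2 hu :=
    ((isFFPSolution_iff hd h0 h1 hε hl hσ hf2).1 hu).eLpNorm_one_le hd h0 h1 hε hl hσ hk hf2 hf

/-- Replace `f` by a source `h` in `L¹ ∩ L²`. The Lipschitz bounds, uniform in `g`, make both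
replacements cost at most `δ / 4`. For `h` the weak `L²` convergence applies to the indicator of
`S`, which is in `L²` because `S` has finite measure. -/
lemma tendsto_setIntegral_sub (hd : 2 ≤ d) (h0 : 0 < s) (h1 : s < 1) (hε : 0 < ε)
    (hl : IsAbsorption lam c) (hσ : IsAbsorption σ c') (hk : IsKernelApprox s (ε ^ (2 * s)) σ k A)
    {f : Phase d → ℝ} (hf : Integrable f (phaseMeasure d)) {U : ℝ → Phase d → ℝ}
    {u : Phase d → ℝ} (hU : ∀ g, 0 < g → g < 1 → Integrable (U g) (phaseMeasure d) ∧
      IsL1Solution (IsRTESolution lam (k g)) f (U g))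
    (hu : Integrable u (phaseMeasure d)) (hu' : IsL1Solution (IsFFPSolution s ε lam σ) f u)
    {S : Set (Phase d)} (hS : MeasurableSet S) (hSf : phaseMeasure d S < ⊤) :
    Tendsto (fun g => ∫ p in S, (U g - u) p ∂(phaseMeasure d)) (𝓝[<] 1) (𝓝 0) := by
  have hF := hk.isContractive_ffp hd h0 h1 hε hl hσ
  set C : ℝ≥0 := (c⁻¹).toNNReal with hC
  rw [Metric.tendsto_nhds]
  intro δ hδ
  -- Chosen so that `C` times it is at most `δ / 4`, including when `C = 0`.
  have hη : (0 : ℝ) < δ / (4 * (C + 1)) := by positivity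
  obtain ⟨h, ih, mh, hfh⟩ := exists_memLp_two_eLpNorm_sub_lt hf
    (δ := ENNReal.ofReal (δ / (4 * (C + 1)))) (by rw [Ne, ENNReal.ofReal_eq_zero, not_le]; exact hη)
  have hCh : ∀ a : ℝ≥0∞, a ≤ C * eLpNorm (f - h) 1 (phaseMeasure d) → a.toReal ≤ δ / 4 := by
    intro a ha
    refine ENNReal.toReal_le_of_le_ofReal (by positivity) (ha.trans ?_)
    calc (C : ℝ≥0∞) * eLpNorm (f - h) 1 (phaseMeasure d)
        ≤ ENNReal.ofReal C * ENNReal.ofReal (δ / (4 * (C + 1))) := by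
          rw [ENNReal.ofReal_coe_nnreal]; gcongr
      _ = ENNReal.ofReal (C * (δ / (4 * (C + 1)))) := (ENNReal.ofReal_mul C.2).symm
      _ ≤ _ := by
          refine ENNReal.ofReal_le_ofReal ?_
          have : (C : ℝ) * (δ / (4 * (C + 1))) = δ / 4 * (C / (C + 1)) := by field_simp
          rw [this]
          refine mul_le_of_le_one_right (by positivity) ?_
          rw [div_le_one (by positivity)]
          linarith
  obtain ⟨uu, hR⟩ := exists_family_isRTESolution hl hk mh
  obtain ⟨v, hv⟩ := hF.exists_sol h ih mh
  have hve := (isFFPSolution_iff hd h0 h1 hε hl hσ mh).1 hv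
  have iv : Integrable v (phaseMeasure d) := memLp_one_iff_integrable.1 ⟨hv.1.1,
    (hF.le _ _ ih mh hv).trans_lt
      (ENNReal.mul_lt_top ENNReal.coe_lt_top (memLp_one_iff_integrable.2 ih).2)⟩
  have hvu : |∫ p in S, (v - u) p ∂(phaseMeasure d)| ≤ δ / 4 := by
    refine (abs_setIntegral_le_eLpNorm_one (iv.sub hu) S).trans (hCh _ ?_)
    rw [eLpNorm_sub_comm]
    exact hu'.eLpNorm_sub_le hF hf ih (isL1Solution_of_sol hF ih mh hv)
  have hG : MemLp (S.indicator fun _ => (1 : ℝ)) 2 (phaseMeasure d) :=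
    memLp_indicator_const 2 hS 1 (Or.inr hSf.ne)
  have eG : ∀ w : Phase d → ℝ, ∫ p, w p * S.indicator (fun _ => (1 : ℝ)) p ∂(phaseMeasure d) =
      ∫ p in S, w p ∂(phaseMeasure d) := by
    intro w
    rw [← integral_indicator hS]
    congr 1; funext p
    simp only [indicator]
    split_ifs <;> simp
  have hweak := hve.tendsto_weak hd h0 h1 hε hl hσ hk mh hR hG
  simp only [eG] at hweak
  filter_upwards [eventually_half_le_lt_one, (Metric.tendsto_nhds.1 hweak) (δ / 4) (by positivity)]
    with g hg hgw
  have hg0 : 0 < g := by linarith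
  obtain ⟨M, hM⟩ := hk.kernel g hg0 hg.2
  have hK := hM.isContractive hl
  have hRg := hR g hg0 hg.2
  obtain ⟨iU, hUg⟩ := hU g hg0 hg.2
  have iuu : Integrable (uu g) (phaseMeasure d) := memLp_one_iff_integrable.1 ⟨hRg.1.1,
    (hK.le _ _ ih mh hRg).trans_lt
      (ENNReal.mul_lt_top ENNReal.coe_lt_top (memLp_one_iff_integrable.2 ih).2)⟩
  have hUu : |∫ p in S, (U g - uu g) p ∂(phaseMeasure d)| ≤ δ / 4 :=
    (abs_setIntegral_le_eLpNorm_one (iU.sub iuu) S).trans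
      (hCh _ (hUg.eLpNorm_sub_le hK hf ih (isL1Solution_of_sol hK ih mh hRg)))
  rw [integral_sub' iU.integrableOn iuu.integrableOn] at hUu
  rw [integral_sub' iv.integrableOn hu.integrableOn] at hvu
  rw [Real.dist_eq] at hgw
  rw [integral_sub' iU.integrableOn hu.integrableOn, dist_zero_right, Real.norm_eq_abs]
  have a1 := abs_le.1 hUu
  have a2 := abs_le.1 hvu
  have a3 := abs_lt.1 hgw
  exact abs_lt.2 ⟨by linarith [a1.1, a2.1, a3.1], by linarith [a1.2, a2.2, a3.2]⟩

end Main

theorem mainTheorem5 :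
    ∃ κ₀ : ℝ → ℝ → ℝ, (∀ a c : ℝ, 0 < κ₀ a c) ∧
      ∀ (d : ℕ), 2 ≤ d →
      ∀ (s : ℝ), 0 < s → s < 1 →
      ∀ (m : ℝ), 0 < m →
      ∀ (ε : ℝ), 0 < ε →
      ∀ (b lam : Pos d → ℝ), CoeffCond (diffCoeff s m b) lam →
      ∀ (f : Phase d → ℝ), Integrable f (phaseMeasure d) → (∀ᵐ p ∂(phaseMeasure d), 0 ≤ f p) →
      ∃ (U : ℝ → Phase d → ℝ) (u : Phase d → ℝ),
        (∀ g : ℝ, 0 < g → g < 1 →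
          Integrable (U g) (phaseMeasure d) ∧
          IsL1Solution (IsRTESolution lam (hgKernel s m ε b g)) f (U g) ∧
          ∀ v, IsL1Solution (IsRTESolution lam (hgKernel s m ε b g)) f v →
            v =ᵐ[phaseMeasure d] U g) ∧
        (Integrable u (phaseMeasure d) ∧
          IsL1Solution (IsFFPSolution s ε lam (diffCoeff s m b)) f u ∧
          ∀ v, IsL1Solution (IsFFPSolution s ε lam (diffCoeff s m b)) f v →
            v =ᵐ[phaseMeasure d] u) ∧
        ∀ (Ω : Set (Pos d)), IsOpen Ω → Bornology.IsBounded Ω →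
          ∃ gk : ℕ → ℝ, StrictMono gk ∧ (∀ k, 0 < gk k ∧ gk k < 1) ∧
            Tendsto gk atTop (𝓝 1) ∧
            ∀ κ : ℝ, κ₀ (c1Norm lam) (∫ p, f p ∂(phaseMeasure d)) ≤ κ →
              Tendsto (fun k => wassersteinDist Ω κ (U (gk k)) u) atTop (𝓝 0) := by
  -- The convergence holds for every `κ ≥ 0`, so any positive constant can serve as `κ₀`.
  refine ⟨fun _ _ => 1, fun _ _ => one_pos, fun d hd s h0 h1 m hm ε hε b lam hcoeff f hf _ => ?_⟩
  obtain ⟨⟨L, hL⟩, ⟨L', hL'⟩, ⟨c', hc', hσ⟩, ⟨c, hc, hlam⟩⟩ := hcoeff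
  have hσ : IsAbsorption (diffCoeff s m b) c' :=
    ⟨hc', hL.continuous, fun x => (hσ x).1, fun x => (hσ x).2⟩
  have hl : IsAbsorption lam c := ⟨hc, hL'.continuous, fun x => (hlam x).1, fun x => (hlam x).2⟩
  obtain ⟨A, hk⟩ := isKernelApprox_hgKernel hd h0 h1 hm hε hσ
  have hF := hk.isContractive_ffp hd h0 h1 hε hl hσ
  have hK : ∀ g, 0 < g → g < 1 →
      IsContractive (IsRTESolution lam (hgKernel s m ε b g)) (c⁻¹).toNNReal := fun g hg hg1 => by
    obtain ⟨M, hM⟩ := hk.kernel g hg hg1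
    exact hM.isContractive hl
  have hex : ∀ g : ℝ, ∃ u, 0 < g → g < 1 → Integrable u (phaseMeasure d) ∧
      IsL1Solution (IsRTESolution lam (hgKernel s m ε b g)) f u := by
    intro g
    by_cases h : 0 < g ∧ g < 1
    · obtain ⟨u, hu⟩ := exists_isL1Solution (hK g h.1 h.2) hf
      exact ⟨u, fun _ _ => hu⟩
    · exact ⟨0, fun h2 h3 => absurd ⟨h2, h3⟩ h⟩
  choose U hU using hex
  obtain ⟨u, iu, hu⟩ := exists_isL1Solution hF hf
  refine ⟨U, u, fun g hg hg1 => ⟨(hU g hg hg1).1, (hU g hg hg1).2, fun v hv =>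
    hv.ae_unique (hK g hg hg1) hf (hU g hg hg1).2⟩, ⟨iu, hu, fun v hv => hv.ae_unique hF hf hu⟩,
    fun Ω _ hΩ => ?_⟩
  have hpos : ∀ n : ℕ, (0 : ℝ) < (n : ℝ) + 2 := fun n => by positivity
  have hg0 : ∀ n : ℕ, (0 : ℝ) < 1 - 1 / ((n : ℝ) + 2) ∧ (1 : ℝ) - 1 / ((n : ℝ) + 2) < 1 := by
    intro n
    have h3 : 0 < 1 / ((n : ℝ) + 2) := by have := hpos n; positivity
    have h4 : 1 / ((n : ℝ) + 2) < 1 := by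
      rw [div_lt_one (hpos n)]
      have : (0 : ℝ) ≤ n := n.cast_nonneg
      linarith
    exact ⟨by linarith, by linarith⟩
  have hlim : Tendsto (fun n : ℕ => 1 - 1 / ((n : ℝ) + 2)) atTop (𝓝 1) := by
    have h3 : Tendsto (fun n : ℕ => 1 / ((n : ℝ) + 2)) atTop (𝓝 0) := by
      simp only [one_div]
      exact (tendsto_natCast_atTop_atTop.atTop_add tendsto_const_nhds).inv_tendsto_atTop
    simpa using h3.const_sub 1
  -- The whole family converges as `g → 1`, so any sequence will do, independently of `Ω`. The shift
  -- by `2` keeps the first term `1/2` positive.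
  refine ⟨fun n => 1 - 1 / ((n : ℝ) + 2), fun a a' haa => ?_, hg0, hlim, fun κ hκ => ?_⟩
  · have h3 : (a : ℝ) < a' := by exact_mod_cast haa
    exact sub_lt_sub_left (one_div_lt_one_div_of_lt (hpos a) (by linarith)) 1
  have hlim' : Tendsto (fun n : ℕ => 1 - 1 / ((n : ℝ) + 2)) atTop (𝓝[<] 1) :=
    tendsto_nhdsWithin_iff.2 ⟨hlim, Eventually.of_forall fun n => (hg0 n).2⟩
  -- The common `L¹` bound of all the `U g` and of `u`; their difference is bounded by `B + B`.
  set B : ℝ≥0∞ := ((c⁻¹).toNNReal : ℝ≥0∞) * eLpNorm f 1 (phaseMeasure d) with hB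
  have hBt : B ≠ ⊤ :=
    ENNReal.mul_ne_top ENNReal.coe_ne_top (memLp_one_iff_integrable.2 hf).2.ne
  refine tendsto_wassersteinDist hΩ (zero_le_one.trans hκ)
    (Eventually.of_forall fun n => (hU _ (hg0 n).1 (hg0 n).2).1) iu (B := (B + B).toReal)
    (Eventually.of_forall fun n => ?_) fun S hS hSf =>
      (tendsto_setIntegral_sub hd h0 h1 hε hl hσ hk hf hU iu hu hS hSf).comp hlim'
  obtain ⟨iUn, hUn⟩ := hU _ (hg0 n).1 (hg0 n).2
  exact ENNReal.toReal_mono (ENNReal.add_ne_top.2 ⟨hBt, hBt⟩)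
    ((eLpNorm_sub_le iUn.1 iu.1 le_rfl).trans
      (add_le_add (hUn.eLpNorm_le (hK _ (hg0 n).1 (hg0 n).2) hf) (hu.eLpNorm_le hF hf)))
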